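/- **Definitions.** Write $e(x)=e^{2\pi i x}$. Let $c>0$ be an integer and $\mu,\nu\in\mathbb R$. Let $D_0$ be the $*$-algebra of all $F\in C_c(\mathbb Z\to C_b(\mathbb R\times S^1))$, $S^1=\mathbb R/\mathbb Z$, with $F(x+1,y,p)=e(-cp(y-p\nu))F(x,y,p)$, with product $(F_1F_2)(x,y,p)=\sum_{q\in\mathbb Z}F_1(x,y,q)\,F_2(x-2q\mu,y-2q\nu,p-q)$ and involution $F^*(x,y,p)=\overline{F(x-2p\mu,y-2p\nu,-p)}$. The quantum Heisenberg manifold $D=D^{c}_{\mu,\nu}$ is its $C^*$-completion (in the regular representation $(\lambda(F)\varphi)(x,y,p)=\sum_qF(x,y,q)\varphi(x-2q\mu,y-2q\nu,p-q)$). The Heisenberg group $H_1$, with coordinates $(r,s,t)\in\mathbb R^3$, acts on $D$ by $$\alpha_{(r,s,t)}(F)(x,y,p)=e\big(-p(t+cs(x-r-p\mu))\big)F(x-r,y-s,p),$$ with infinitesimal generators $\partial_1,\partial_2,\partial_3$ in the directions $r,s,t$. The gauge action is $\gamma_t=\alpha_{(0,0,-t)}$, and $D^{(n)}=\{d:\gamma_t(d)=e(nt)d\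 \forall t\}$. The smooth quantum Heisenberg manifold $\mathcal D$ is the $*$-algebra of those $d\in D$ for which $(r,s,t)\mapsto\alpha_{(r,s,t)}(d)$ is $C^\infty$, with the topology of the seminorms $\|\partial_{i_1}\cdots\partial_{i_k}d\|$. A locally convex algebra is a complete Hausdorff locally convex space with a jointly continuous multiplication; $\otimes_\pi$ is the completed projective tensor product. Let $O_E$ be the Pimsner algebra of a full Hilbert bimodule $E$ over a unital $C^*$-algebra $A$ with injective left action, i.e. the universal $C^*$-algebra generated by a covariant representation $A\to O_E$, $\xi\mapsto S_\xi$ of the bimodule; put $\bar S_\xi=S_\xi^*$. Its gauge action $\gamma$ fixes $A$ and multiplies $S_\xi$ by $e(t)$. Let $\mathscr D\subseteq O_E$ be a unital self-adjoint subalgebra which is a locally convex algebra with continuous inclusion, $\mathcal A=\mathscr D\cap A$ and $\mathcal E=\{\xi\in E: S_\xi\in\mathscr D\}$. The smooth Toeplitz algebra is $\mathcal T=\mathcal K\oplus C^\infty(S^1)$ as a locally convex space, where $\mathcal K$ are the rapidly decreasing matrices, with the product of operators on $\ell^2(\mathbb N)$, where $f\in C^\infty(S^1)$ is sent to the Toeplitz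 operator with symbol $f$; $S$ is the unilateral shift and $\bar S$ its adjoint. Let $\mathcal T_{\mathscr D}$ be the closed subalgebra of $\mathscr D\otimes_\pi\mathcal T$ generated by $\mathcal A\otimes1$, $S(\mathcal E)\otimes S$, $\bar S(\mathcal E)\otimes\bar S$. One calls $\mathscr D$ a *smooth Pimsner algebra* if $\mathcal A$ is closed in $\mathscr D$ and * (gauge-smooth) $\gamma$ preserves $\mathscr D$ and $d\mapsto[t\mapsto\gamma_t(d)]$ is a continuous homomorphism $\mathscr D\to C^\infty(\mathbb T)\otimes_\pi\mathscr D$; * (generated by $\mathcal E$) the algebra generated by $S(\mathcal E)$, $\bar S(\mathcal E)$ and $\mathcal A$ is dense in $\mathscr D$; * (canonically split) with $\pi:\mathcal T\to C^\infty(S^1)$ the projection and $\rho:C^\infty(S^1)\to\mathcal T$ the inclusion of the summand, $\mathrm{id}\otimes\rho$ maps $(\mathrm{id}\otimes\pi)(\mathcal T_{\mathscr D})$ into $\mathcal T_{\mathscr D}$; * (tame) there are $l\ge1$ and tuples $\xi_0,\xi_1,\dots$ of elements of $\mathcal E$, $\xi_i$ of length $\lfloor i/l\rfloor+1$, such that,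 for $S_{\xi_i}$ the product of the $S$'s of the entries of $\xi_i$ and $\bar S_{\xi_i}=S_{\xi_i}^*$, the elements $S_{\xi_i}\bar S_{\xi_i}$ of each given length sum up to $1$, and for each continuous seminorm $p$ on $\mathscr D$ the numbers $p(S_{\xi_i})$ and $p(\bar S_{\xi_i})$ grow at most polynomially in $i$. **Proposition.** The smooth quantum Heisenberg manifold $\mathcal D$ is a Fréchet algebra. With $A=D^{(0)}$, $E=D^{(1)}$ (with the scalar products $\xi^*\eta$ and $\xi\eta^*$), the algebra $D$ is the Pimsner algebra $O_E$ with gauge action $\gamma$, and $\mathcal D\subseteq D$ is a smooth Pimsner algebra. Its base $\mathcal D\cap D^{(0)}$ is $C^\infty(\mathbb T^2)$ with its natural topology, a function $f$ being identified with $F(x,y,p)=\delta_{p,0}f(x,y)$. Moreover, for each $n\in\mathbb Z$ there are $\xi_1^n,\xi_2^n\in\mathcal D\cap D^{(n)}$ with $\sum_i(\xi_i^n)^*\xi_i^n=1=\sum_i\xi_i^n(\xi_i^n)^*$ such that for all $n_1,n_2,n_3\in\mathbb N$ there is a constant $C$ with $\|\partial_3^{n_3}\partial_2^{n_2}\partial_1^{n_1}\xi_i^n\|\le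 C(1+|n|)^{n_3+2n_2}$ for all $n$ and $i$. -/

import Mathlib

noncomputable section
open scoped ENNReal ContDiff

/-- The Hilbert space `ℓ²(X)`. -/
abbrev ell2 (X : Type) : Type := lp (fun _ : X => ℂ) 2

theorem memlp_wcomp {X : Type} (m : X → ℂ) (σ : X → X) (hσ : Function.Injective σ) {C : ℝ}
    (hC : ∀ x, ‖m x‖ ≤ C) (φ : ell2 X) : Memℓp (fun x => m x * φ (σ x)) 2 := by
  have h1 : Memℓp (fun x => φ x) 2 := lp.memℓp φ
  rw [memℓp_gen_iff (by norm_num)] at h1 ⊢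
  have h2 := (h1.comp_injective hσ).mul_left (C ^ 2)
  refine Summable.of_nonneg_of_le (fun _ => by positivity) (fun x => ?_) h2
  simp only [Function.comp, ENNReal.toReal_ofNat, Real.rpow_ofNat, norm_mul, mul_pow]
  gcongr
  exact hC x

theorem norm_wcomp_le {X : Type} (m : X → ℂ) (σ : X → X) (hσ : Function.Injective σ) {C : ℝ}
    (hC0 : 0 ≤ C) (hC : ∀ x, ‖m x‖ ≤ C) (φ : ell2 X) :
    ‖(⟨fun x => m x * φ (σ x), memlp_wcomp m σ hσ hC φ⟩ : ell2 X)‖ ≤ C * ‖φ‖ := by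
  have h1 : Memℓp (fun x => φ x) 2 := lp.memℓp φ
  rw [memℓp_gen_iff (by norm_num)] at h1
  refine lp.norm_le_of_tsum_le (by norm_num) (by positivity) ?_
  have h3 := lp.norm_rpow_eq_tsum (p := 2) (by norm_num) φ
  simp only [ENNReal.toReal_ofNat, Real.rpow_ofNat] at h1 h3 ⊢
  rw [mul_pow, h3, ← tsum_mul_left]
  have h2 := (h1.comp_injective hσ).mul_left (C ^ 2)
  have hle : ∀ x, ‖m x * φ (σ x)‖ ^ 2 ≤ C ^ 2 * ‖φ (σ x)‖ ^ 2 := fun x => by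
    rw [norm_mul, mul_pow]; gcongr; exact hC x
  calc ∑' x, ‖m x * φ (σ x)‖ ^ 2 ≤ ∑' x, C ^ 2 * ‖φ (σ x)‖ ^ 2 :=
        (Summable.of_nonneg_of_le (fun _ => by positivity) hle h2).tsum_le_tsum hle h2
    _ ≤ ∑' x, C ^ 2 * ‖φ x‖ ^ 2 :=
        tsum_comp_le_tsum_of_inj (h1.mul_left _) (fun _ => by positivity) hσ

/-- The weighted composition operator `(T φ)(x) = m x * φ (σ x)` on `ℓ²(X)`, for a bounded weight
`m` and an injective map `σ`. -/
def wcomp {X : Type} (m : X → ℂ) (σ : X → X) (hσ : Function.Injective σ)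
    (hm : ∃ C, ∀ x, ‖m x‖ ≤ C) : ell2 X →L[ℂ] ell2 X :=
  LinearMap.mkContinuousOfExistsBound
    { toFun := fun φ => ⟨fun x => m x * φ (σ x), memlp_wcomp m σ hσ hm.choose_spec φ⟩
      map_add' := fun φ ψ => by ext x; exact mul_add _ _ _
      map_smul' := fun a φ => by ext x; simp; ring }
    ⟨max hm.choose 0, fun φ => norm_wcomp_le m σ hσ (le_max_right _ _)
      (fun x => (hm.choose_spec x).trans (le_max_left _ _)) φ⟩

@[simp] theorem wcomp_apply {X : Type} (m : X → ℂ) (σ : X → X) (hσ : Function.Injective σ)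
    (hm : ∃ C, ∀ x, ‖m x‖ ≤ C) (φ : ell2 X) (x : X) :
    wcomp m σ hσ hm φ x = m x * φ (σ x) := rfl

theorem star_wcomp {X : Type} (m : X → ℂ) (σ : X ≃ X) (hm : ∃ C, ∀ x, ‖m x‖ ≤ C) :
    star (wcomp m σ σ.injective hm) =
      wcomp (fun x => star (m (σ.symm x))) σ.symm σ.symm.injective
        (hm.imp fun C h x => by rw [norm_star]; exact h _) := by
  rw [ContinuousLinearMap.star_eq_adjoint, eq_comm, ContinuousLinearMap.eq_adjoint_iff]
  intro φ ψ
  rw [lp.inner_eq_tsum, lp.inner_eq_tsum]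
  rw [← σ.tsum_eq]
  refine tsum_congr fun x => ?_
  simp
  ring

/-- `e(x) = exp(2πix)`. -/
def ee (x : ℝ) : ℂ := Complex.exp (2 * Real.pi * Complex.I * x)

theorem norm_ee (x : ℝ) : ‖ee x‖ = 1 := by
  rw [ee, show (2 * Real.pi * Complex.I * x : ℂ) = ((2 * Real.pi * x : ℝ) : ℂ) * Complex.I by
    push_cast; ring]
  exact Complex.norm_exp_ofReal_mul_I _

theorem ee_add (x y : ℝ) : ee (x + y) = ee x * ee y := by
  rw [ee, ee, ee, ← Complex.exp_add]; push_cast; ring_nf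

theorem ee_zero : ee 0 = 1 := by simp [ee]

theorem star_ee (x : ℝ) : star (ee x) = ee (-x) := by
  simp only [ee, Complex.star_def, ← Complex.exp_conj, map_mul, Complex.conj_I, Complex.conj_ofReal,
    map_ofNat]
  congr 1
  push_cast
  ring

theorem continuous_ee : Continuous ee := by unfold ee; fun_prop

/-- The functions `F ∈ C_c(ℤ → C_b(ℝ × S¹))` with `F(x + 1, y, p) = e(-cp(y - pν)) F(x, y, p)`,
written as functions on `ℝ × ℝ × ℤ` that are `1`-periodic in `y`. -/
structure IsQHMFun (c : ℤ) (ν : ℝ) (F : ℝ → ℝ → ℤ → ℂ) : Prop where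
  finite : {p | ∃ x y, F x y p ≠ 0}.Finite
  continuous : ∀ p, Continuous fun z : ℝ × ℝ => F z.1 z.2 p
  bounded : ∀ p, ∃ C, ∀ x y, ‖F x y p‖ ≤ C
  periodic : ∀ x y p, F x (y + 1) p = F x y p
  quasi : ∀ x y p, F (x + 1) y p = ee (-c * p * (y - p * ν)) * F x y p

/-- The product of the algebra `D₀`. -/
def qhmMul (μ ν : ℝ) (F G : ℝ → ℝ → ℤ → ℂ) : ℝ → ℝ → ℤ → ℂ := fun x y p =>
  ∑ᶠ q : ℤ, F x y q * G (x - 2 * q * μ) (y - 2 * q * ν) (p - q)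

/-- The involution of the algebra `D₀`. -/
def qhmStar (μ ν : ℝ) (F : ℝ → ℝ → ℤ → ℂ) : ℝ → ℝ → ℤ → ℂ := fun x y p =>
  star (F (x - 2 * p * μ) (y - 2 * p * ν) (-p))

/-- The permutation `(x, y, p) ↦ (x - 2qμ, y - 2qν, p - q)` of `ℝ × ℝ × ℤ`. -/
def qhmShift (μ ν : ℝ) (q : ℤ) : ℝ × ℝ × ℤ ≃ ℝ × ℝ × ℤ where
  toFun z := (z.1 - 2 * q * μ, z.2.1 - 2 * q * ν, z.2.2 - q)
  invFun z := (z.1 + 2 * q * μ, z.2.1 + 2 * q * ν, z.2.2 + q)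
  left_inv z := by ext <;> simp
  right_inv z := by ext <;> simp

namespace IsQHMFun

variable {c : ℤ} {μ ν : ℝ} {F G : ℝ → ℝ → ℤ → ℂ}

/-- The regular representation of `D₀` on `ℓ²(ℝ × ℝ × ℤ)`,
`(λ(F) φ)(x, y, p) = ∑_q F(x, y, q) φ(x - 2qμ, y - 2qν, p - q)`. -/
def rep (μ : ℝ) (hF : IsQHMFun c ν F) : ell2 (ℝ × ℝ × ℤ) →L[ℂ] ell2 (ℝ × ℝ × ℤ) :=
  ∑ q ∈ hF.finite.toFinset, wcomp (fun z => F z.1 z.2.1 q) (qhmShift μ ν q)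
    (qhmShift μ ν q).injective ((hF.bounded q).imp fun _ h z => h z.1 z.2.1)

theorem rep_apply (hF : IsQHMFun c ν F) (φ : ell2 (ℝ × ℝ × ℤ)) (z : ℝ × ℝ × ℤ) :
    hF.rep μ φ z = ∑ᶠ q : ℤ, F z.1 z.2.1 q * φ (qhmShift μ ν q z) := by
  rw [finsum_eq_sum_of_support_subset (s := hF.finite.toFinset)]
  · rw [rep, sum_apply, lp.coeFn_sum, Finset.sum_apply]; rfl
  · intro q hq
    simp only [Set.Finite.coe_toFinset, Set.mem_ofPred_eq]
    exact ⟨_, _, left_ne_zero_of_mul hq⟩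

theorem supp (hF : IsQHMFun c ν F) {x y : ℝ} {q : ℤ} (h : q ∉ hF.finite.toFinset) :
    F x y q = 0 := by
  by_contra h'
  exact h (by simpa using ⟨x, y, h'⟩)

theorem add (hF : IsQHMFun c ν F) (hG : IsQHMFun c ν G) : IsQHMFun c ν (F + G) where
  finite := (hF.finite.union hG.finite).subset fun p ⟨x, y, h⟩ => by
    by_contra h'
    simp only [Set.mem_union, Set.mem_ofPred_eq, not_or, not_exists, not_not] at h'
    exact h (by simp [h'.1 x y, h'.2 x y])
  continuous p := (hF.continuous p).add (hG.continuous p)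
  bounded p := by
    obtain ⟨C, hC⟩ := hF.bounded p
    obtain ⟨C', hC'⟩ := hG.bounded p
    exact ⟨C + C', fun x y => (norm_add_le _ _).trans (add_le_add (hC x y) (hC' x y))⟩
  periodic x y p := by simp [hF.periodic, hG.periodic]
  quasi x y p := by simp [hF.quasi, hG.quasi, mul_add]

theorem single {n : ℤ} {f : ℝ → ℝ → ℂ} (hc : Continuous fun z : ℝ × ℝ => f z.1 z.2)
    (hb : ∃ C, ∀ x y, ‖f x y‖ ≤ C) (hp : ∀ x y, f x (y + 1) = f x y)
    (hq : ∀ x y, f (x + 1) y = ee (-c * n * (y - n * ν)) * f x y) :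
    IsQHMFun c ν (fun x y p => if p = n then f x y else 0) where
  finite := (Set.finite_singleton n).subset fun p ⟨x, y, h⟩ => by
    by_contra h'
    exact h (if_neg h')
  continuous p := by by_cases h : p = n <;> simp [h, hc, continuous_const]
  bounded p := by
    by_cases h : p = n
    · simpa [h] using hb
    · exact ⟨0, by simp [h]⟩
  periodic x y p := by simp [hp]
  quasi x y p := by
    by_cases h : p = n
    · subst h; simp [hq]
    · simp [h]

theorem mul (hF : IsQHMFun c ν F) (hG : IsQHMFun c ν G) :
    IsQHMFun c ν (qhmMul μ ν F G) := by
  have key : ∀ x y p, qhmMul μ ν F G x y p = ∑ q ∈ hF.finite.toFinset,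
      F x y q * G (x - 2 * q * μ) (y - 2 * q * ν) (p - q) := fun x y p => by
    refine finsum_eq_sum_of_support_subset _ fun q hq => ?_
    by_contra h
    exact hq (by simp [hF.supp h])
  refine ⟨?_, fun p => ?_, fun p => ?_, fun x y p => ?_, fun x y p => ?_⟩
  · refine ((hF.finite.toFinset ×ˢ hG.finite.toFinset).image fun a => a.1 + a.2).finite_toSet.subset
      fun p ⟨x, y, h⟩ => ?_
    rw [key] at h
    obtain ⟨q, hq, h⟩ := Finset.exists_ne_zero_of_sum_ne_zero h
    simp only [Finset.coe_image, Set.mem_image, Finset.mem_coe, Finset.mem_product]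
    refine ⟨(q, p - q), ⟨hq, ?_⟩, by simp⟩
    by_contra h'
    exact h (by simp [hG.supp h'])
  · simp only [key]
    refine continuous_finsetSum _ fun q _ => (hF.continuous q).mul ?_
    exact (hG.continuous (p - q)).comp
      (f := fun z : ℝ × ℝ => (z.1 - 2 * q * μ, z.2 - 2 * q * ν)) (by fun_prop)
  · choose C hC using hF.bounded
    choose C' hC' using hG.bounded
    refine ⟨∑ q ∈ hF.finite.toFinset, C q * C' (p - q), fun x y => ?_⟩
    rw [key]
    refine (norm_sum_le _ _).trans (Finset.sum_le_sum fun q _ => ?_)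
    rw [norm_mul]
    exact mul_le_mul (hC _ _ _) (hC' _ _ _) (norm_nonneg _) ((norm_nonneg _).trans (hC q x y))
  · simp only [key]
    refine Finset.sum_congr rfl fun q _ => ?_
    rw [hF.periodic, ← hG.periodic _ (y - _)]
    ring_nf
  · simp only [key, Finset.mul_sum]
    refine Finset.sum_congr rfl fun q _ => ?_
    rw [hF.quasi, show x + 1 - 2 * q * μ = (x - 2 * q * μ) + 1 by ring, hG.quasi,
      show -(c : ℝ) * p * (y - p * ν) = -c * q * (y - q * ν) +
        -c * ((p - q : ℤ) : ℝ) * (y - 2 * q * ν - ((p - q : ℤ) : ℝ) * ν) by push_cast; ring, ee_add]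
    ring

theorem star (hF : IsQHMFun c ν F) : IsQHMFun c ν (qhmStar μ ν F) where
  finite := (hF.finite.image Neg.neg).subset fun p ⟨x, y, h⟩ =>
    ⟨-p, ⟨_, _, star_ne_zero.1 h⟩, neg_neg p⟩
  continuous p := ((hF.continuous (-p)).comp
      (f := fun z : ℝ × ℝ => (z.1 - 2 * p * μ, z.2 - 2 * p * ν)) (by fun_prop)).star
  bounded p := (hF.bounded (-p)).imp fun C h x y => by
    rw [qhmStar, norm_star]; exact h _ _
  periodic x y p := by
    rw [qhmStar, qhmStar, ← hF.periodic _ (y - _)]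
    ring_nf
  quasi x y p := by
    rw [qhmStar, qhmStar, show x + 1 - 2 * p * μ = (x - 2 * p * μ) + 1 by ring, hF.quasi,
      star_mul', star_ee]
    congr 2
    push_cast
    ring

theorem rep_add (hF : IsQHMFun c ν F) (hG : IsQHMFun c ν G) :
    hF.rep μ + hG.rep μ = (hF.add hG).rep μ := by
  ext φ z
  rw [rep_apply, add_apply, lp.coeFn_add, Pi.add_apply, rep_apply, rep_apply,
    ← finsum_add_distrib]
  · exact finsum_congr fun q => by simp [add_mul]
  · exact hF.finite.toFinset.finite_toSet.subset fun q hq => by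
      by_contra h; exact hq (by simp [hF.supp h])
  · exact hG.finite.toFinset.finite_toSet.subset fun q hq => by
      by_contra h; exact hq (by simp [hG.supp h])

/-- `λ` is multiplicative. -/
theorem rep_mul (hF : IsQHMFun c ν F) (hG : IsQHMFun c ν G) :
    hF.rep μ * hG.rep μ = (hF.mul hG (μ := μ)).rep μ := by
  ext φ z
  rw [rep_apply, mul_apply_eq_comp, rep_apply]
  simp only [rep_apply]
  have e1 : ∀ q : ℤ, (∑ᶠ r : ℤ, G (qhmShift μ ν q z).1 (qhmShift μ ν q z).2.1 r *
      φ (qhmShift μ ν r (qhmShift μ ν q z))) =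
      ∑ᶠ p : ℤ, G (z.1 - 2 * q * μ) (z.2.1 - 2 * q * ν) (p - q) * φ (qhmShift μ ν p z) := fun q => by
    rw [← finsum_comp_equiv (Equiv.subRight q)]
    refine finsum_congr fun p => ?_
    have : qhmShift μ ν (Equiv.subRight q p) (qhmShift μ ν q z) = qhmShift μ ν p z := by
      ext <;> simp [qhmShift] <;> ring
    rw [this]; rfl
  simp only [e1]
  set S := hF.finite.toFinset
  set P := (S ×ˢ hG.finite.toFinset).image fun a => a.1 + a.2 with hP
  have hz : ∀ q ∈ S, ∀ p ∉ P, ∀ x y, G x y (p - q) = 0 := fun q hq p hp x y => by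
    refine hG.supp fun h => hp ?_
    rw [hP, Finset.mem_image]
    exact ⟨(q, p - q), by simpa [S] using ⟨by simpa [S] using hq, by simpa using h⟩, by simp⟩
  have e2 : ∀ p, qhmMul μ ν F G z.1 z.2.1 p = ∑ q ∈ S,
      F z.1 z.2.1 q * G (z.1 - 2 * q * μ) (z.2.1 - 2 * q * ν) (p - q) := fun p => by
    refine finsum_eq_sum_of_support_subset _ fun q hq => ?_
    by_contra h
    exact hq (by simp [hF.supp h])
  rw [finsum_eq_sum_of_support_subset (s := S) _ (fun q hq => by
      by_contra h; exact hq (by simp [hF.supp h])),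
    finsum_eq_sum_of_support_subset (s := P) _ (fun p hp => by
      by_contra h
      refine hp ?_
      simp only [e2]
      rw [Finset.sum_eq_zero fun q hq => by rw [hz q hq p (by simpa using h), mul_zero], zero_mul])]
  simp only [e2, Finset.sum_mul]
  rw [Finset.sum_comm]
  refine Finset.sum_congr rfl fun q hq => ?_
  rw [finsum_eq_sum_of_support_subset (s := P) _ (fun p hp => by
      by_contra h; exact hp (by simp [hz q hq p (by simpa using h)])), Finset.mul_sum]
  exact Finset.sum_congr rfl fun p _ => by ring

/-- `λ` is involutive. -/
theorem rep_star (hF : IsQHMFun c ν F) :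
    Star.star (hF.rep μ) = (hF.star (μ := μ)).rep μ := by
  ext φ z
  rw [rep_apply, rep, star_sum, sum_apply, lp.coeFn_sum, Finset.sum_apply,
    ← finsum_comp_equiv (Equiv.neg ℤ),
    finsum_eq_sum_of_support_subset (s := hF.finite.toFinset) _ (fun q hq => by
      by_contra h; exact hq (by simp [qhmStar, hF.supp h]))]
  refine Finset.sum_congr rfl fun q _ => ?_
  rw [star_wcomp, wcomp_apply]
  have : (qhmShift μ ν q).symm z = qhmShift μ ν (Equiv.neg ℤ q) z := by
    ext <;> simp [qhmShift]
  rw [this]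
  simp [qhmStar, qhmShift]

end IsQHMFun

/-- The algebra `D₀` inside the bounded operators on `ℓ²(ℝ × ℝ × ℤ)`. -/
def qhmPre (c : ℤ) (μ ν : ℝ) :
    StarSubalgebra ℂ (ell2 (ℝ × ℝ × ℤ) →L[ℂ] ell2 (ℝ × ℝ × ℤ)) where
  carrier := {T | ∃ (F : ℝ → ℝ → ℤ → ℂ) (hF : IsQHMFun c ν F), hF.rep μ = T}
  mul_mem' := by
    rintro _ _ ⟨F, hF, rfl⟩ ⟨G, hG, rfl⟩
    exact ⟨_, _, (hF.rep_mul hG).symm⟩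
  add_mem' := by
    rintro _ _ ⟨F, hF, rfl⟩ ⟨G, hG, rfl⟩
    exact ⟨_, _, (hF.rep_add hG).symm⟩
  algebraMap_mem' a := by
    refine ⟨_, IsQHMFun.single (n := 0) (f := fun _ _ => a) continuous_const ⟨‖a‖, by simp⟩
      (by simp) (by simp [ee_zero]), ?_⟩
    ext φ z
    rw [IsQHMFun.rep_apply, finsum_eq_single _ 0 (by simp +contextual)]
    simp [qhmShift, Algebra.algebraMap_eq_smul_one]
  star_mem' := by
    rintro _ ⟨F, hF, rfl⟩
    exact ⟨_, _, hF.rep_star.symm⟩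

/-- The quantum Heisenberg manifold, the norm closure of `D₀`. -/
def QHM (c : ℤ) (μ ν : ℝ) : Type := (qhmPre c μ ν).topologicalClosure

/-- The C⋆-algebra structure inherited from the bounded operators. -/
def QHM.cstarAlgebra (c : ℤ) (μ ν : ℝ) : CStarAlgebra (QHM c μ ν) :=
  StarSubalgebra.cstarAlgebra (qhmPre c μ ν).topologicalClosure
    (h_closed := (qhmPre c μ ν).isClosed_topologicalClosure)

instance (c : ℤ) (μ ν : ℝ) : CStarAlgebra (QHM c μ ν) := QHM.cstarAlgebra c μ ν

namespace QHM

variable {c : ℤ} {μ ν : ℝ}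

/-- An element of the QHM as an operator on `ℓ²(ℝ × ℝ × ℤ)`. -/
def toOp (c : ℤ) (μ ν : ℝ) :
    QHM c μ ν →⋆ₐ[ℂ] (ell2 (ℝ × ℝ × ℤ) →L[ℂ] ell2 (ℝ × ℝ × ℤ)) :=
  (qhmPre c μ ν).topologicalClosure.subtype

/-- The inclusion of `D₀` into its completion. -/
def ofFun (μ : ℝ) {F : ℝ → ℝ → ℤ → ℂ} (hF : IsQHMFun c ν F) : QHM c μ ν :=
  ⟨hF.rep μ, (qhmPre c μ ν).le_topologicalClosure ⟨F, hF, rfl⟩⟩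

end QHM

/-- The action `α_{(r,s,t)}` of the Heisenberg group on functions. -/
def heisFun (c : ℤ) (μ : ℝ) (g : ℝ × ℝ × ℝ) (F : ℝ → ℝ → ℤ → ℂ) : ℝ → ℝ → ℤ → ℂ :=
  fun x y p => ee (-p * (g.2.2 + c * g.2.1 * (x - g.1 - p * μ))) * F (x - g.1) (y - g.2.1) p

theorem IsQHMFun.heis {c : ℤ} {μ ν : ℝ} {F : ℝ → ℝ → ℤ → ℂ} (hF : IsQHMFun c ν F)
    (g : ℝ × ℝ × ℝ) : IsQHMFun c ν (heisFun c μ g F) where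
  finite := hF.finite.subset fun p ⟨x, y, h⟩ => ⟨_, _, right_ne_zero_of_mul h⟩
  continuous p := by
    refine (continuous_ee.comp (by fun_prop)).mul ?_
    exact (hF.continuous p).comp
      (f := fun z : ℝ × ℝ => (z.1 - g.1, z.2 - g.2.1)) (by fun_prop)
  bounded p := (hF.bounded p).imp fun C h x y => by
    rw [heisFun, norm_mul, norm_ee, one_mul]; exact h _ _
  periodic x y p := by
    rw [heisFun, heisFun, ← hF.periodic _ (y - _)]
    ring_nf
  quasi x y p := by
    rw [heisFun, heisFun, show x + 1 - g.1 = (x - g.1) + 1 by ring, hF.quasi, ← mul_assoc,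
      ← mul_assoc, ← ee_add, ← ee_add]
    congr 2
    ring

/-- The operator on `ℓ²(ℝ × ℝ × ℤ)` given by the formula for `α_{(r,s,t)}`. -/
def heisOp (c : ℤ) (μ : ℝ) (g : ℝ × ℝ × ℝ) : ell2 (ℝ × ℝ × ℤ) →L[ℂ] ell2 (ℝ × ℝ × ℤ) :=
  wcomp (fun z => ee (-z.2.2 * (g.2.2 + c * g.2.1 * (z.1 - g.1 - z.2.2 * μ))))
    ((Equiv.subRight g.1).prodCongr ((Equiv.subRight g.2.1).prodCongr (Equiv.refl ℤ)))
    (Equiv.injective _) ⟨1, fun _ => (norm_ee _).le⟩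

theorem heisOp_mem_unitary (c : ℤ) (μ : ℝ) (g : ℝ × ℝ × ℝ) :
    heisOp c μ g ∈ unitary (ell2 (ℝ × ℝ × ℤ) →L[ℂ] ell2 (ℝ × ℝ × ℤ)) := by
  rw [Unitary.mem_iff, heisOp, star_wcomp]
  constructor <;>
  · ext φ z
    simp only [mul_apply_eq_comp, wcomp_apply, Equiv.symm_apply_apply, Equiv.apply_symm_apply,
      one_apply_eq_self, star_ee, ← mul_assoc, ← ee_add]
    ring_nf
    simp [ee_zero]

/-- Conjugation by `heisOp` as a unitary. -/
def heisAd (c : ℤ) (μ : ℝ) (g : ℝ × ℝ × ℝ) :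
    (ell2 (ℝ × ℝ × ℤ) →L[ℂ] ell2 (ℝ × ℝ × ℤ)) ≃⋆ₐ[ℂ]
      (ell2 (ℝ × ℝ × ℤ) →L[ℂ] ell2 (ℝ × ℝ × ℤ)) :=
  Unitary.conjStarAlgAut ℂ _ ⟨heisOp c μ g, heisOp_mem_unitary c μ g⟩

/-- On `D₀`, conjugation by `heisOp` is the action `α_{(r,s,t)}`. -/
theorem heisAd_rep {c : ℤ} {μ ν : ℝ} {F : ℝ → ℝ → ℤ → ℂ} (hF : IsQHMFun c ν F)
    (g : ℝ × ℝ × ℝ) : heisAd c μ g (hF.rep μ) = (hF.heis g (μ := μ)).rep μ := by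
  have h : heisOp c μ g * hF.rep μ = (hF.heis g (μ := μ)).rep μ * heisOp c μ g := by
    ext φ z
    rw [mul_apply_eq_comp, mul_apply_eq_comp, IsQHMFun.rep_apply, heisOp, wcomp_apply,
      IsQHMFun.rep_apply]
    refine (mul_finsum _ _).trans ?_
    refine finsum_congr fun q => ?_
    have e : ∀ z, (Equiv.subRight g.1).prodCongr ((Equiv.subRight g.2.1).prodCongr (Equiv.refl ℤ)) z
      = (z.1 - g.1, z.2.1 - g.2.1, z.2.2) := fun z => rfl
    have e2 : qhmShift μ ν q (z.1 - g.1, z.2.1 - g.2.1, z.2.2) =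
        ((qhmShift μ ν q z).1 - g.1, (qhmShift μ ν q z).2.1 - g.2.1, (qhmShift μ ν q z).2.2) := by
      ext <;> simp [qhmShift] <;> ring
    have e3 : ee (-z.2.2 * (g.2.2 + c * g.2.1 * (z.1 - g.1 - z.2.2 * μ))) =
        ee (-q * (g.2.2 + c * g.2.1 * (z.1 - g.1 - q * μ))) *
        ee (-(qhmShift μ ν q z).2.2 * (g.2.2 + c * g.2.1 *
          ((qhmShift μ ν q z).1 - g.1 - (qhmShift μ ν q z).2.2 * μ))) := by
      rw [← ee_add]
      simp only [qhmShift, Equiv.coe_fn_mk]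
      push_cast
      ring_nf
    rw [wcomp_apply, e, e, e2, e3, heisFun]
    ring
  have hu := (Unitary.mem_iff.1 (heisOp_mem_unitary c μ g)).2
  rw [heisAd, Unitary.conjStarAlgAut_apply]
  change heisOp c μ g * hF.rep μ * star (heisOp c μ g) = _
  rw [h, mul_assoc, hu, mul_one]

theorem heisAd_mem {c : ℤ} {μ ν : ℝ} (g : ℝ × ℝ × ℝ) {T}
    (hT : T ∈ (qhmPre c μ ν).topologicalClosure) :
    heisAd c μ g T ∈ (qhmPre c μ ν).topologicalClosure := by
  have hcont : Continuous (heisAd c μ g) := by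
    have : ∀ T, heisAd c μ g T = heisOp c μ g * T * star (heisOp c μ g) := fun T => rfl
    simp only [funext this]
    fun_prop
  refine map_mem_closure hcont hT ?_
  rintro _ ⟨F, hF, rfl⟩
  exact ⟨_, _, (heisAd_rep hF g).symm⟩

/-- The action `α_{(r,s,t)}` of the Heisenberg group on the QHM: on `D₀` it is `heisFun`. -/
def heisAct (c : ℤ) (μ ν : ℝ) (g : ℝ × ℝ × ℝ) : QHM c μ ν →⋆ₐ[ℂ] QHM c μ ν :=
  ((heisAd c μ g).toStarAlgHom.comp (QHM.toOp c μ ν)).codRestrict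
    (qhmPre c μ ν).topologicalClosure fun d => heisAd_mem g d.2

theorem heisAct_ofFun {c : ℤ} {μ ν : ℝ} {F : ℝ → ℝ → ℤ → ℂ} (hF : IsQHMFun c ν F)
    (g : ℝ × ℝ × ℝ) : heisAct c μ ν g (QHM.ofFun μ hF) = QHM.ofFun μ (hF.heis g (μ := μ)) :=
  Subtype.ext (heisAd_rep hF g)

/-- The one-parameter subgroups of the coordinates `r`, `s`, `t`. -/
def heisCurve (i : Fin 3) (h : ℝ) : ℝ × ℝ × ℝ := (![(h, 0, 0), (0, h, 0), (0, 0, h)] : Fin 3 → _) i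

/-- The infinitesimal generators `∂₁`, `∂₂`, `∂₃` of the action (indexed by `0`, `1`, `2`). -/
def heisDer (c : ℤ) (μ ν : ℝ) (i : Fin 3) (d : QHM c μ ν) : QHM c μ ν :=
  deriv (fun h => heisAct c μ ν (heisCurve i h) d) 0

/-- The gauge action `γ_t`, for which `D^{(n)}` has degree `n`: on `D₀`, `γ_t F = e(pt) F`. -/
def qhmGauge (c : ℤ) (μ ν : ℝ) (t : ℝ) : QHM c μ ν →⋆ₐ[ℂ] QHM c μ ν :=
  heisAct c μ ν (0, 0, -t)

/-- The `n`-th spectral subspace `D^{(n)}` of the gauge action. -/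
def qhmSpec (c : ℤ) (μ ν : ℝ) (n : ℤ) : Submodule ℂ (QHM c μ ν) where
  carrier := {d | ∀ t : ℝ, qhmGauge c μ ν t d = ee (n * t) • d}
  add_mem' ha hb t := by rw [map_add, ha t, hb t, smul_add]
  zero_mem' t := by simp
  smul_mem' a d hd t := by rw [map_smul, hd t, smul_comm]

/-- The fixed-point algebra `A = D^{(0)}` of the gauge action. -/
def qhmBase (c : ℤ) (μ ν : ℝ) : StarSubalgebra ℂ (QHM c μ ν) where
  carrier := {d | ∀ t : ℝ, qhmGauge c μ ν t d = d}
  mul_mem' ha hb t := by rw [map_mul, ha t, hb t]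
  add_mem' ha hb t := by rw [map_add, ha t, hb t]
  algebraMap_mem' a t := by rw [AlgHomClass.commutes]
  star_mem' ha t := by rw [map_star, ha t]

/-- The `H₁`-smooth elements of the QHM: the orbit map is `C^∞` for the norm. -/
def qhmSmooth (c : ℤ) (μ ν : ℝ) : StarSubalgebra ℂ (QHM c μ ν) where
  carrier := {d | ContDiff ℝ ∞ fun g => heisAct c μ ν g d}
  mul_mem' ha hb := by
    simp only [Set.mem_ofPred_eq, map_mul] at *
    exact ha.mul hb
  add_mem' ha hb := by
    simp only [Set.mem_ofPred_eq, map_add] at *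
    exact ha.add hb
  algebraMap_mem' a := by
    simp only [Set.mem_ofPred_eq, AlgHomClass.commutes]
    exact contDiff_const
  star_mem' ha := by
    simp only [Set.mem_ofPred_eq, map_star] at *
    exact (starL' ℝ : QHM c μ ν ≃L[ℝ] QHM c μ ν).contDiff.comp ha

/-- The smooth quantum Heisenberg manifold. -/
def SmoothQHM (c : ℤ) (μ ν : ℝ) : Type := qhmSmooth c μ ν

namespace SmoothQHM

variable (c : ℤ) (μ ν : ℝ)

instance : Ring (SmoothQHM c μ ν) := inferInstanceAs (Ring (qhmSmooth c μ ν))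
instance : StarRing (SmoothQHM c μ ν) := inferInstanceAs (StarRing (qhmSmooth c μ ν))
instance : Algebra ℂ (SmoothQHM c μ ν) := inferInstanceAs (Algebra ℂ (qhmSmooth c μ ν))
instance : StarModule ℂ (SmoothQHM c μ ν) := inferInstanceAs (StarModule ℂ (qhmSmooth c μ ν))

/-- The inclusion of the smooth QHM into the QHM. -/
def incl : SmoothQHM c μ ν →⋆ₐ[ℂ] QHM c μ ν := (qhmSmooth c μ ν).subtype

/-- The uniform structure of the seminorms `d ↦ ‖∂_{i₁} ⋯ ∂_{i_k} d‖`, that is, the coarsest one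
that makes the maps `d ↦ ∂_{i₁} ⋯ ∂_{i_k} d` into the QHM uniformly continuous. -/
instance : UniformSpace (SmoothQHM c μ ν) :=
  ⨅ w : List (Fin 3), UniformSpace.comap
    (fun d => w.foldr (heisDer c μ ν) (incl c μ ν d)) inferInstance

end SmoothQHM

open scoped TensorProduct

/-! ### Locally convex algebras and completed projective tensor products -/

section Proj

variable {V W : Type*} [AddCommGroup V] [Module ℂ V] [AddCommGroup W] [Module ℂ W]

theorem exists_list_tmul (z : V ⊗[ℂ] W) :
    ∃ l : List (V × W), z = (l.map fun a => a.1 ⊗ₜ[ℂ] a.2).sum := by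
  induction z with
  | zero => exact ⟨[], by simp⟩
  | tmul v w => exact ⟨[(v, w)], by simp⟩
  | add x y hx hy =>
    obtain ⟨l, rfl⟩ := hx
    obtain ⟨l', rfl⟩ := hy
    exact ⟨l ++ l', by simp⟩

/-- The values `∑ p(v_i) q(w_i)` over all representations `z = ∑ v_i ⊗ w_i`. -/
def projValues (p : Seminorm ℂ V) (q : Seminorm ℂ W) (z : V ⊗[ℂ] W) : Set ℝ :=
  {r | ∃ l : List (V × W), z = (l.map fun a => a.1 ⊗ₜ[ℂ] a.2).sum ∧
    r = (l.map fun a => p a.1 * q a.2).sum}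

theorem projValues_nonneg (p : Seminorm ℂ V) (q : Seminorm ℂ W) (z : V ⊗[ℂ] W) :
    ∀ r ∈ projValues p q z, 0 ≤ r := by
  rintro _ ⟨l, -, rfl⟩
  refine List.sum_nonneg fun r hr => ?_
  obtain ⟨a, -, rfl⟩ := List.mem_map.1 hr
  positivity

theorem projValues_nonempty (p : Seminorm ℂ V) (q : Seminorm ℂ W) (z : V ⊗[ℂ] W) :
    (projValues p q z).Nonempty :=
  let ⟨l, hl⟩ := exists_list_tmul z
  ⟨_, l, hl, rfl⟩

/-- The projective tensor product `p ⊗ q` of two seminorms,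
`(p ⊗ q)(z) = inf {∑ p(v_i) q(w_i) | z = ∑ v_i ⊗ w_i}`. -/
def projSeminorm (p : Seminorm ℂ V) (q : Seminorm ℂ W) : Seminorm ℂ (V ⊗[ℂ] W) :=
  Seminorm.ofSMulLE (fun z => sInf (projValues p q z))
    (le_antisymm (csInf_le ⟨0, fun r hr => projValues_nonneg p q 0 r hr⟩ ⟨[], by simp, by simp⟩)
      (Real.sInf_nonneg (projValues_nonneg p q 0)))
    (fun x y => by
      rw [← csInf_add (projValues_nonempty p q x) ⟨0, projValues_nonneg p q x⟩
        (projValues_nonempty p q y) ⟨0, projValues_nonneg p q y⟩]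
      refine csInf_le_csInf ⟨0, projValues_nonneg p q _⟩
        ((projValues_nonempty p q x).add (projValues_nonempty p q y)) ?_
      rintro _ ⟨_, ⟨l, rfl, rfl⟩, _, ⟨l', rfl, rfl⟩, rfl⟩
      exact ⟨l ++ l', by simp, by simp⟩)
    (fun a x => by
      rw [← smul_eq_mul, ← Real.sInf_smul_of_nonneg (norm_nonneg a)]
      refine csInf_le_csInf ⟨0, projValues_nonneg p q _⟩
        ((projValues_nonempty p q x).smul_set) ?_
      rintro _ ⟨_, ⟨l, rfl, rfl⟩, rfl⟩
      refine ⟨l.map fun b => (a • b.1, b.2), ?_, ?_⟩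
      · simp [List.smul_sum, Function.comp_def, TensorProduct.smul_tmul']
      · simp [Function.comp_def, map_smul_eq_mul, mul_assoc, List.sum_map_mul_left])

end Proj

/-- The algebraic tensor product with the projective topology, which is defined by the seminorms
`p ⊗ q` for all continuous seminorms `p` and `q`. -/
def ProjTensor (V W : Type*) [AddCommGroup V] [Module ℂ V] [AddCommGroup W] [Module ℂ W] : Type _ :=
  V ⊗[ℂ] W

namespace ProjTensor

section Module

variable (V W : Type*) [AddCommGroup V] [Module ℂ V] [AddCommGroup W] [Module ℂ W]

instance : AddCommGroup (ProjTensor V W) := inferInstanceAs (AddCommGroup (V ⊗[ℂ] W))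
instance : Module ℂ (ProjTensor V W) := inferInstanceAs (Module ℂ (V ⊗[ℂ] W))

variable [TopologicalSpace V] [TopologicalSpace W]

/-- The seminorms that define the projective topology. -/
def seminorms : SeminormFamily ℂ (ProjTensor V W)
    ({p : Seminorm ℂ V // Continuous p} × {q : Seminorm ℂ W // Continuous q}) :=
  fun a => projSeminorm a.1.1 a.2.1

instance : TopologicalSpace (ProjTensor V W) := (seminorms V W).moduleFilterBasis.topology

theorem withSeminorms : WithSeminorms (seminorms V W) := ⟨rfl⟩

instance : IsTopologicalAddGroup (ProjTensor V W) := (withSeminorms V W).topologicalAddGroup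
instance : ContinuousSMul ℂ (ProjTensor V W) := (withSeminorms V W).continuousSMul
instance : UniformSpace (ProjTensor V W) := IsTopologicalAddGroup.rightUniformSpace _
instance : IsUniformAddGroup (ProjTensor V W) := isUniformAddGroup_of_addCommGroup
instance : UniformContinuousConstSMul ℂ (ProjTensor V W) :=
  uniformContinuousConstSMul_of_continuousConstSMul ℂ _

end Module

instance (V W : Type*) [Ring V] [Algebra ℂ V] [Ring W] [Algebra ℂ W] : Ring (ProjTensor V W) :=
  inferInstanceAs (Ring (V ⊗[ℂ] W))

/-- The map `f ⊗ g` on completed projective tensor products, for continuous linear `f`, `g`. -/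
def mapC {V W V' W' : Type*} [AddCommGroup V] [Module ℂ V] [AddCommGroup W] [Module ℂ W]
    [AddCommGroup V'] [Module ℂ V'] [AddCommGroup W'] [Module ℂ W'] [TopologicalSpace V]
    [TopologicalSpace W] [TopologicalSpace V'] [TopologicalSpace W'] (f : V →ₗ[ℂ] V')
    (g : W →ₗ[ℂ] W') : UniformSpace.Completion (ProjTensor V W) →
      UniformSpace.Completion (ProjTensor V' W') :=
  UniformSpace.Completion.map (TensorProduct.map f g : V ⊗[ℂ] W → V' ⊗[ℂ] W')

end ProjTensor

/-- Locally convex algebras: complete Hausdorff locally convex spaces with a jointly continuous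
multiplication. -/
structure IsLCAlgebra (D : Type*) [Ring D] [Algebra ℂ D] [UniformSpace D] : Prop where
  uniformAddGroup : IsUniformAddGroup D
  continuousSMul : ContinuousSMul ℂ D
  locallyConvex : PolynormableSpace ℂ D
  t2 : T2Space D
  complete : CompleteSpace D
  continuousMul : ContinuousMul D

/-- Fréchet algebras: metrizable locally convex algebras. -/
structure IsFrechetAlgebra (D : Type*) [Ring D] [Algebra ℂ D] [UniformSpace D] : Prop
    extends IsLCAlgebra D where
  countable : (uniformity D).IsCountablyGenerated

/-! ### Smooth functions on the circle and the smooth Toeplitz algebra -/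

/-- The algebra `C^∞(S¹)`, as smooth functions on `ℝ` of period `1`. -/
def smoothCircle : Subalgebra ℂ (ℝ → ℂ) where
  carrier := {f | ContDiff ℝ ∞ f ∧ ∀ t, f (t + 1) = f t}
  mul_mem' ha hb := ⟨ha.1.mul hb.1, fun t => by simp [ha.2, hb.2]⟩
  add_mem' ha hb := ⟨ha.1.add hb.1, fun t => by simp [ha.2, hb.2]⟩
  algebraMap_mem' _ := ⟨contDiff_const, fun _ => rfl⟩

/-- The algebra `C^∞(S¹)` as a type. -/
def SmoothCircle : Type := smoothCircle

namespace SmoothCircle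

instance : CommRing SmoothCircle := inferInstanceAs (CommRing smoothCircle)
instance : Algebra ℂ SmoothCircle := inferInstanceAs (Algebra ℂ smoothCircle)

/-- Evaluation at the point `t` of the circle `ℝ / ℤ`. -/
def eval (t : ℝ) : SmoothCircle →ₗ[ℂ] ℂ :=
  (LinearMap.proj t : (ℝ → ℂ) →ₗ[ℂ] ℂ) ∘ₗ smoothCircle.val.toLinearMap

/-- The topology of uniform convergence of all derivatives. -/
instance : TopologicalSpace SmoothCircle :=
  ⨅ k : ℕ, TopologicalSpace.induced
    (fun f => UniformFun.ofFun (iteratedDeriv k fun t => eval t f)) inferInstance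

theorem contDiff (f : SmoothCircle) : ContDiff ℝ ∞ fun t => eval t f := f.2.1

theorem periodic (f : SmoothCircle) (t : ℝ) : eval (t + 1) f = eval t f := f.2.2 t

/-- The Fourier coefficients `∫₀¹ f(t) e(-nt) dt`. -/
def coeff (n : ℤ) : SmoothCircle →ₗ[ℂ] ℂ where
  toFun f := ∫ t in (0 : ℝ)..1, eval t f * ee (-n * t)
  map_add' f g := by
    have h (f : SmoothCircle) : IntervalIntegrable (fun t : ℝ => eval t f * ee (-n * t))
        MeasureTheory.volume 0 1 :=
      (f.contDiff.continuous.mul (continuous_ee.comp (by fun_prop))).intervalIntegrable _ _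
    simp only [map_add, add_mul]
    exact intervalIntegral.integral_add (h f) (h g)
  map_smul' a f := by
    simp only [map_smul, smul_eq_mul, mul_assoc, intervalIntegral.integral_const_mul,
      RingHom.id_apply]

/-- The derivative of a smooth function on the circle. -/
def derivative (f : SmoothCircle) : SmoothCircle :=
  ⟨deriv fun t => eval t f, (contDiff_infty_iff_deriv.1 f.contDiff).2, fun t => by
    rw [← deriv_comp_add_const]
    congr 1
    exact funext fun t => f.periodic t⟩

theorem coeff_derivative (f : SmoothCircle) (n : ℤ) :
    coeff n f.derivative = 2 * Real.pi * Complex.I * n * coeff n f := by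
  have h1 : ∀ t, HasDerivAt (fun t => eval t f) (eval t f.derivative) t := fun t =>
    (f.contDiff.differentiable (by simp)).differentiableAt.hasDerivAt
  have h2 : ∀ t : ℝ, HasDerivAt (fun t : ℝ => ee (-n * t))
      (-(2 * Real.pi * Complex.I * n) * ee (-n * t)) t := fun t => by
    have : HasDerivAt (fun t : ℝ => 2 * Real.pi * Complex.I * ((-n * t : ℝ) : ℂ))
        (2 * Real.pi * Complex.I * ((-n * 1 : ℝ) : ℂ)) t :=
      (((hasDerivAt_id t).const_mul (-(n : ℝ))).ofReal_comp).const_mul _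
    have := this.cexp
    refine this.congr_deriv ?_
    rw [show ee (-n * t) = Complex.exp (2 * Real.pi * Complex.I * ((-n * t : ℝ) : ℂ)) from rfl]
    push_cast
    ring
  have h3 := intervalIntegral.integral_deriv_mul_eq_sub (a := 0) (b := 1)
    (fun t _ => h1 t) (fun t _ => h2 t)
    (f.derivative.contDiff.continuous.intervalIntegrable _ _)
    (Continuous.intervalIntegrable (u := fun t : ℝ => -(2 * Real.pi * Complex.I * n) * ee (-n * t))
      (continuous_const.mul (continuous_ee.comp (by fun_prop))) _ _)
  have h4 : eval 1 f = eval 0 f := by simpa using f.periodic 0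
  have h5 : ee (-n * 1) = 1 := by
    rw [ee, Complex.exp_eq_one_iff]; exact ⟨-n, by push_cast; ring⟩
  rw [intervalIntegral.integral_add, h4, h5] at h3
  · simp only [mul_zero] at h3
    have h6 : ee 0 = 1 := by simp [ee]
    rw [h6, sub_self, add_eq_zero_iff_eq_neg] at h3
    change (∫ t in (0 : ℝ)..1, _) = _ * ∫ t in (0 : ℝ)..1, _
    rw [h3, ← intervalIntegral.integral_neg, ← intervalIntegral.integral_const_mul]
    congr 1
    ext t
    ring
  · exact (f.derivative.contDiff.continuous.mul
      (continuous_ee.comp (by fun_prop))).intervalIntegrable _ _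
  · exact (f.contDiff.continuous.mul (continuous_const.mul
      (continuous_ee.comp (by fun_prop)))).intervalIntegrable _ _

theorem norm_coeff_le (f : SmoothCircle) : ∃ C, ∀ n, ‖coeff n f‖ ≤ C := by
  refine ⟨∫ t in (0 : ℝ)..1, ‖eval t f‖, fun n => ?_⟩
  refine (intervalIntegral.norm_integral_le_integral_norm zero_le_one).trans (le_of_eq ?_)
  simp [norm_ee]

theorem summable_coeff (f : SmoothCircle) : Summable fun n : ℤ => ‖coeff n f‖ := by
  obtain ⟨C, hC⟩ := norm_coeff_le f.derivative.derivative
  have h0 : Summable fun n : ℤ => C * (1 / (n : ℝ) ^ 2) :=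
    (Real.summable_one_div_int_pow.2 (by norm_num)).mul_left C
  refine (summable_norm_iff.2 ?_)
  refine Summable.of_norm_bounded_eventually h0 ?_
  rw [Filter.eventually_cofinite]
  refine (Set.finite_singleton (0 : ℤ)).subset fun n hn => ?_
  by_contra h
  refine hn ?_
  have hn' : (0 : ℝ) < |(n : ℝ)| := abs_pos.2 (Int.cast_ne_zero.2 h)
  have := hC n
  rw [coeff_derivative, coeff_derivative, norm_mul, norm_mul] at this
  simp only [norm_mul, Complex.norm_ofNat, Complex.norm_real, Complex.norm_I, Complex.norm_intCast,
    Real.norm_eq_abs, abs_of_pos Real.pi_pos, mul_one] at this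
  rw [mul_one_div, ← sq_abs, le_div_iff₀ (by positivity)]
  refine le_trans ?_ this
  have hpi := Real.pi_gt_three
  have hc := norm_nonneg (coeff n f)
  have h1 : |(n : ℝ)| ≤ 2 * Real.pi * |(n : ℝ)| := by nlinarith
  calc ‖coeff n f‖ * |(n : ℝ)| ^ 2 = |(n : ℝ)| * (|(n : ℝ)| * ‖coeff n f‖) := by ring
    _ ≤ (2 * Real.pi * |(n : ℝ)|) * ((2 * Real.pi * |(n : ℝ)|) * ‖coeff n f‖) := by gcongr

end SmoothCircle

/-- The smooth compact operators, as matrices `(a_{ij})` with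
`sup (1 + i)^m (1 + j)^n |a_{ij}| < ∞` for all `m`, `n`. -/
def smoothCompact : Submodule ℂ (ℕ × ℕ → ℂ) where
  carrier := {a | ∀ m n : ℕ, ∃ C : ℝ, ∀ i j : ℕ,
    (1 + i : ℝ) ^ m * (1 + j : ℝ) ^ n * ‖a (i, j)‖ ≤ C}
  add_mem' {a b} ha hb m n := by
    obtain ⟨C, hC⟩ := ha m n
    obtain ⟨C', hC'⟩ := hb m n
    refine ⟨C + C', fun i j => le_trans ?_ (add_le_add (hC i j) (hC' i j))⟩
    rw [← mul_add]
    gcongr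
    exact norm_add_le _ _
  zero_mem' m n := ⟨0, by simp⟩
  smul_mem' z a ha m n := by
    obtain ⟨C, hC⟩ := ha m n
    refine ⟨‖z‖ * C, fun i j => ?_⟩
    rw [Pi.smul_apply, norm_smul, mul_left_comm]
    gcongr
    exact hC i j

/-- The smooth compact operators as a type. -/
def SmoothCompact : Type := smoothCompact

namespace SmoothCompact

instance : AddCommGroup SmoothCompact := inferInstanceAs (AddCommGroup smoothCompact)
instance : Module ℂ SmoothCompact := inferInstanceAs (Module ℂ smoothCompact)

/-- The matrix coefficients. -/
def entry (a : ℕ × ℕ) : SmoothCompact →ₗ[ℂ] ℂ :=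
  (LinearMap.proj a : (ℕ × ℕ → ℂ) →ₗ[ℂ] ℂ) ∘ₗ smoothCompact.subtype

theorem summable (k : SmoothCompact) (m n : ℕ) :
    Summable fun a : ℕ × ℕ => (1 + a.1 : ℝ) ^ m * (1 + a.2 : ℝ) ^ n * ‖entry a k‖ := by
  obtain ⟨C, hC⟩ := k.2 (m + 2) (n + 2)
  have h1 : Summable fun i : ℕ => 1 / (1 + i : ℝ) ^ 2 := by
    have := (summable_nat_add_iff 1).2 (Real.summable_one_div_nat_pow.2 (le_refl 2))
    exact this.congr fun i => by push_cast; ring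
  refine Summable.of_nonneg_of_le (fun _ => by positivity) (fun a => ?_)
    ((h1.mul_of_nonneg h1 (fun _ => by positivity) (fun _ => by positivity)).mul_left C)
  have := hC a.1 a.2
  rw [one_div_mul_one_div, mul_one_div, le_div_iff₀ (by positivity)]
  refine le_trans (le_of_eq ?_) this
  change _ = _ * ‖entry a k‖
  ring

/-- The seminorm `‖a‖_{m,n} = ∑ (1 + i)^m (1 + j)^n |a_{ij}|`. -/
def seminorm (b : ℕ × ℕ) : Seminorm ℂ SmoothCompact :=
  Seminorm.ofSMulLE
    (fun k => ∑' a : ℕ × ℕ, (1 + a.1 : ℝ) ^ b.1 * (1 + a.2 : ℝ) ^ b.2 * ‖entry a k‖)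
    (by simp)
    (fun x y => by
      rw [← (summable x b.1 b.2).tsum_add (summable y b.1 b.2)]
      refine (summable (x + y) b.1 b.2).tsum_le_tsum (fun a => ?_)
        ((summable x b.1 b.2).add (summable y b.1 b.2))
      rw [← mul_add, map_add]
      gcongr
      exact norm_add_le _ _)
    (fun z x => by
      rw [← tsum_mul_left]
      refine le_of_eq (tsum_congr fun a => ?_)
      rw [map_smul, norm_smul]
      ring)

instance : TopologicalSpace SmoothCompact :=
  SeminormFamily.moduleFilterBasis (𝕜 := ℂ) (seminorm) |>.topology

end SmoothCompact

/-- The adjoint `S̄` of the unilateral shift, `(S̄ φ)(n) = φ(n + 1)`. -/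
def shiftStar : ell2 ℕ →L[ℂ] ell2 ℕ :=
  wcomp (fun _ => 1) Nat.succ Nat.succ_injective ⟨1, fun _ => by simp⟩

/-- The unilateral shift `S`. -/
def shift : ell2 ℕ →L[ℂ] ell2 ℕ := star shiftStar

/-- The operator `S^n` for `n ≥ 0` and `S̄^{-n}` for `n < 0`. -/
def shiftPow (n : ℤ) : ell2 ℕ →L[ℂ] ell2 ℕ :=
  if 0 ≤ n then shift ^ n.toNat else shiftStar ^ (-n).toNat

/-- The matrix units `S^i e S̄^j`, where `e = 1 - S S̄`. -/
def matrixUnit (a : ℕ × ℕ) : ell2 ℕ →L[ℂ] ell2 ℕ :=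
  shift ^ a.1 * (1 - shift * shiftStar) * shiftStar ^ a.2

theorem norm_shiftStar_le : ‖shiftStar‖ ≤ 1 :=
  ContinuousLinearMap.opNorm_le_bound _ zero_le_one fun φ =>
    norm_wcomp_le _ _ Nat.succ_injective zero_le_one (fun _ => by simp) φ

theorem norm_pow_le_one {T : ell2 ℕ →L[ℂ] ell2 ℕ} (hT : ‖T‖ ≤ 1) (n : ℕ) : ‖T ^ n‖ ≤ 1 := by
  induction n with
  | zero => rw [pow_zero]; exact ContinuousLinearMap.norm_id_le
  | succ n ih =>
    rw [pow_succ]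
    exact (norm_mul_le _ _).trans (mul_le_one₀ ih (norm_nonneg _) hT)

theorem norm_shift_le : ‖shift‖ ≤ 1 :=
  (norm_star shiftStar).le.trans norm_shiftStar_le

theorem norm_shiftPow_le (n : ℤ) : ‖shiftPow n‖ ≤ 1 := by
  rw [shiftPow]
  split_ifs
  · exact norm_pow_le_one norm_shift_le _
  · exact norm_pow_le_one norm_shiftStar_le _

theorem norm_matrixUnit_le (a : ℕ × ℕ) : ‖matrixUnit a‖ ≤ 2 := by
  have h : ‖(1 - shift * shiftStar : ell2 ℕ →L[ℂ] ell2 ℕ)‖ ≤ 2 := by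
    refine (norm_sub_le _ _).trans ?_
    have h1 : ‖(1 : ell2 ℕ →L[ℂ] ell2 ℕ)‖ ≤ 1 := ContinuousLinearMap.norm_id_le
    have h2 := (norm_mul_le shift shiftStar).trans
      (mul_le_one₀ norm_shift_le (norm_nonneg _) norm_shiftStar_le)
    linarith
  rw [matrixUnit]
  calc _ ≤ ‖shift ^ a.1‖ * ‖(1 - shift * shiftStar : ell2 ℕ →L[ℂ] ell2 ℕ)‖ * ‖shiftStar ^ a.2‖ :=
        norm_mul₃_le
    _ ≤ 1 * 2 * 1 := by
        gcongr
        · exact norm_pow_le_one norm_shift_le _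
        · exact norm_pow_le_one norm_shiftStar_le _
    _ = 2 := by norm_num

/-- The smooth Toeplitz algebra as a locally convex space, the direct sum of the smooth compact
operators and `C^∞(S¹)`. Its product is that of the C⋆-Toeplitz algebra, in which it is included by
`toeplitzIncl`. -/
abbrev SmoothToeplitz : Type := SmoothCompact × SmoothCircle

/-- The inclusion of the smooth Toeplitz algebra into the bounded operators on `ℓ²(ℕ)`: it maps
a smooth compact matrix to its operator and `f ∈ C^∞(S¹)` to the Toeplitz operator with symbol
`f`, so that `e(nt)` goes to `S^n` or `S̄^{-n}`. -/
def toeplitzIncl : SmoothToeplitz →ₗ[ℂ] (ell2 ℕ →L[ℂ] ell2 ℕ) :=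
  LinearMap.coprod
    { toFun := fun k => ∑' a : ℕ × ℕ, SmoothCompact.entry a k • matrixUnit a
      map_add' := fun x y => by
        have h (k : SmoothCompact) : Summable fun a => SmoothCompact.entry a k • matrixUnit a := by
          refine Summable.of_norm_bounded ((k.summable 0 0).mul_right 2) fun a => ?_
          rw [norm_smul]
          simpa using mul_le_mul_of_nonneg_left (norm_matrixUnit_le a) (norm_nonneg _)
        simp only [map_add, add_smul]
        exact (h x).tsum_add (h y)
      map_smul' := fun z x => by
        simp only [map_smul, smul_eq_mul, mul_smul, RingHom.id_apply]
        exact tsum_const_smul'' z }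
    { toFun := fun f => ∑' n : ℤ, SmoothCircle.coeff n f • shiftPow n
      map_add' := fun x y => by
        have h (f : SmoothCircle) : Summable fun n => SmoothCircle.coeff n f • shiftPow n := by
          refine Summable.of_norm_bounded f.summable_coeff fun n => ?_
          rw [norm_smul]
          exact mul_le_of_le_one_right (norm_nonneg _) (norm_shiftPow_le n)
        simp only [map_add, add_smul]
        exact (h x).tsum_add (h y)
      map_smul' := fun z x => by
        simp only [map_smul, smul_eq_mul, mul_smul, RingHom.id_apply]
        exact tsum_const_smul'' z }

/-! ### Pimsner algebras and their smooth subalgebras -/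

universe u v w

/-- `O` is the Pimsner algebra `O_E` of a full Hilbert bimodule `E` over the unital C⋆-algebra `A`
with injective left action. The coefficient algebra `A` and the bimodule `E ≅ S(E)` are identified
with their (isometric) canonical images in `O`, so that the scalar products are
`⟨ξ|η⟩_A = ξ⋆η` and `_A⟨ξ|η⟩ = ξη⋆`. The algebra `O` is generated by `A` and `E` and is universal
for the covariant representations `(π, t)` of the bimodule. -/
structure IsPimsnerAlgebra {O : Type u} [CStarAlgebra O] (A : StarSubalgebra ℂ O)
    (E : Submodule ℂ O) : Prop where
  isClosed_base : IsClosed (A : Set O)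
  isClosed_module : IsClosed (E : Set O)
  left_mul : ∀ a ∈ A, ∀ ξ ∈ E, a * ξ ∈ E
  right_mul : ∀ a ∈ A, ∀ ξ ∈ E, ξ * a ∈ E
  inner_right : ∀ ξ ∈ E, ∀ η ∈ E, star ξ * η ∈ A
  inner_left : ∀ ξ ∈ E, ∀ η ∈ E, ξ * star η ∈ A
  full : closure (Submodule.span ℂ {x : O | ∃ ξ ∈ E, ∃ η ∈ E, x = star ξ * η} : Set O) = A
  left_injective : ∀ a ∈ A, (∀ ξ ∈ E, a * ξ = 0) → a = 0
  generated : Dense (Algebra.adjoin ℂ {x : O | x ∈ A ∨ x ∈ E ∨ star x ∈ E} : Set O)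
  universal : ∀ (B : Type v) [NonUnitalCStarAlgebra B] (π : A →⋆ₙₐ[ℂ] B) (t : E →ₗ[ℂ] B),
    (∀ (a : A) (ξ : E) (h : (a : O) * (ξ : O) ∈ E), t ⟨_, h⟩ = π a * t ξ) →
    (∀ (ξ η : E) (h : star (ξ : O) * (η : O) ∈ A), π ⟨_, h⟩ = star (t ξ) * t η) →
    (∀ (ξ η : E) (h : (ξ : O) * star (η : O) ∈ A), π ⟨_, h⟩ = t ξ * star (t η)) →
    ∃ ρ : O →⋆ₙₐ[ℂ] B, (∀ a : A, ρ a = π a) ∧ ∀ ξ : E, ρ ξ = t ξ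

/-- The gauge action of a Pimsner algebra, as an action of `ℝ` that factors through `ℝ / ℤ`: it is
trivial on `A` and multiplies `S_ξ` by `e(t)`. -/
def IsGaugeAction {O : Type u} [CStarAlgebra O] (A : StarSubalgebra ℂ O) (E : Submodule ℂ O)
    (γ : ℝ → O →⋆ₐ[ℂ] O) : Prop :=
  ∀ t, (∀ a ∈ A, γ t a = a) ∧ ∀ ξ ∈ E, γ t ξ = ee t • ξ

section Smooth

variable {O : Type u} [CStarAlgebra O] (A : StarSubalgebra ℂ O) (E : Submodule ℂ O)
  (γ : ℝ → O →⋆ₐ[ℂ] O) {D : Type w} [Ring D] [StarRing D] [Algebra ℂ D] [UniformSpace D]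
  (ι : D →⋆ₐ[ℂ] O)

variable (D) in
/-- The evaluation `f ⊗ d ↦ f(t) d` on `C^∞(𝕋) ⊗ D`. -/
def evalTensor (t : ℝ) : ProjTensor SmoothCircle D →ₗ[ℂ] D :=
  TensorProduct.lift (LinearMap.lsmul ℂ D ∘ₗ SmoothCircle.eval t)

/-- `D` is gauge-smooth: the gauge action restricts to a continuous homomorphism
`τ : D → C^∞(𝕋) ⊗_π D`, so that the value of `τ d` at `t` is `γ_t(d)`. -/
def IsGaugeSmooth : Prop :=
  ∃ (θ : ℝ → D → D) (τ : D → UniformSpace.Completion (ProjTensor SmoothCircle D)),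
    (∀ t d, ι (θ t d) = γ t (ι d)) ∧
    Continuous τ ∧ τ 1 = 1 ∧ (∀ d d', τ (d + d') = τ d + τ d') ∧
    (∀ (z : ℂ) d, τ (z • d) = z • τ d) ∧ (∀ d d', τ (d * d') = τ d * τ d') ∧
    ∀ t d, UniformSpace.Completion.map (evalTensor D t) (τ d) = θ t d

/-- `D` is generated by `𝓔 = E ∩ D`: the algebra generated by `S(𝓔)`, `S̄(𝓔)` and `D ∩ A` is dense
in `D`. -/
def IsGeneratedByModule : Prop :=
  Dense (Algebra.adjoin ℂ {d : D | ι d ∈ E ∨ ι (star d) ∈ E ∨ ι d ∈ A} : Set D)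

/-- The algebraic Toeplitz algebra of `D`: the subalgebra of `D ⊗ 𝒯` generated by `𝒜 ⊗ 1`,
`S(𝓔) ⊗ S` and `S̄(𝓔) ⊗ S̄`, where `𝒜 = D ∩ A` and `𝓔 = E ∩ D`. The products are computed in
`D ⊗ B(ℓ²(ℕ))`, in which `D ⊗ 𝒯` is included. -/
def toeplitzPre : Set (D ⊗[ℂ] SmoothToeplitz) :=
  {z | TensorProduct.map (LinearMap.id : D →ₗ[ℂ] D) toeplitzIncl z ∈
    Algebra.adjoin ℂ
      ({x : D ⊗[ℂ] (ell2 ℕ →L[ℂ] ell2 ℕ) | (∃ a : D, ι a ∈ A ∧ x = a ⊗ₜ 1) ∨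
        (∃ ξ : D, ι ξ ∈ E ∧ x = ξ ⊗ₜ shift) ∨
        (∃ ξ : D, ι ξ ∈ E ∧ x = star ξ ⊗ₜ shiftStar)})}

/-- The Toeplitz algebra of `D`, a closed subspace of `D ⊗_π 𝒯`. -/
def toeplitzOf : Set (UniformSpace.Completion (ProjTensor D SmoothToeplitz)) :=
  closure ((fun z : ProjTensor D SmoothToeplitz =>
    (z : UniformSpace.Completion (ProjTensor D SmoothToeplitz))) '' toeplitzPre A E ι)

/-- The extension `0 → Ker π_D → 𝒯_D → Im π_D → 0` is canonically split, where `π_D` is the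
restriction of `id ⊗ π : D ⊗_π 𝒯 → D ⊗_π C^∞(S¹)`: the canonical split `id ⊗ ρ` maps the image of
`π_D` into `𝒯_D`. Here `π` and `ρ` are the projection to and the inclusion of the summand
`C^∞(S¹)` of `𝒯`. -/
def IsCanonicallySplit : Prop :=
  ∀ x ∈ toeplitzOf A E ι,
    ProjTensor.mapC (LinearMap.id : D →ₗ[ℂ] D) (LinearMap.inr ℂ SmoothCompact SmoothCircle)
      (ProjTensor.mapC (LinearMap.id : D →ₗ[ℂ] D) (LinearMap.snd ℂ SmoothCompact SmoothCircle) x) ∈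
    toeplitzOf A E ι

/-- `D` is tame: there is an admissible sequence `ξ_i` of multivectors of elements of `𝓔`, with
`S_{ξ_i}` and `S̄_{ξ_i} = S_{ξ_i}⋆` of polynomial growth. The lengths of the multivectors are
`1, …, 1, 2, …, 2, 3, …` with each value taken `l` times, and the products `S_{ξ_i} S̄_{ξ_i}` of the
same length sum up to one. -/
def IsTame : Prop :=
  ∃ (l : ℕ) (ξ : ℕ → List D), 0 < l ∧ (∀ i, ∀ x ∈ ξ i, ι x ∈ E) ∧
    (∀ i, (ξ i).length = i / l + 1) ∧
    (∀ n : ℕ, ∑ j ∈ Finset.range l, (ξ (n * l + j)).prod * star (ξ (n * l + j)).prod = 1) ∧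
    ∀ p : Seminorm ℂ D, Continuous p → ∃ (C : ℝ) (k : ℕ), ∀ i : ℕ,
      p (ξ i).prod ≤ C * (1 + i : ℝ) ^ k ∧ p (star (ξ i).prod) ≤ C * (1 + i : ℝ) ^ k

/-- `D`, included by `ι` into the Pimsner algebra `O = O_E` with base `A` and gauge action `γ`, is a
smooth Pimsner algebra. Unitality is part of `ι` being a unital homomorphism. -/
structure IsSmoothPimsnerAlgebra : Prop where
  pimsner : IsPimsnerAlgebra.{u, v} A E
  gauge : IsGaugeAction A E γ
  lcAlgebra : IsLCAlgebra D
  injective : Function.Injective ι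
  continuous : Continuous ι
  closed_base : IsClosed {d : D | ι d ∈ A}
  gaugeSmooth : IsGaugeSmooth γ ι
  generated : IsGeneratedByModule A E ι
  split : IsCanonicallySplit A E ι
  tame : IsTame E ι

end Smooth

/-! ### Smooth functions on the two-torus -/

/-- The algebra `C^∞(𝕋²)`, as smooth functions on `ℝ²` of period `1` in both variables. -/
def SmoothTorus : Type :=
  {f : ℝ × ℝ → ℂ // ContDiff ℝ ∞ f ∧ ∀ x y, f (x + 1, y) = f (x, y) ∧ f (x, y + 1) = f (x, y)}

namespace SmoothTorus

/-- The topology of uniform convergence of all derivatives. -/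
instance : TopologicalSpace SmoothTorus :=
  ⨅ k : ℕ, TopologicalSpace.induced
    (fun f => UniformFun.ofFun (iteratedFDeriv ℝ k f.1)) inferInstance

theorem bounded (f : SmoothTorus) : ∃ C, ∀ x y : ℝ, ‖f.1 (x, y)‖ ≤ C := by
  have h1 : ∀ y, Function.Periodic (fun x => f.1 (x, y)) 1 := fun y x => (f.2.2 x y).1
  have h2 : ∀ x, Function.Periodic (fun y => f.1 (x, y)) 1 := fun x y => (f.2.2 x y).2
  obtain ⟨C, hC⟩ := (isCompact_Icc.prod isCompact_Icc :
    IsCompact (Set.Icc (0 : ℝ) 1 ×ˢ Set.Icc (0 : ℝ) 1)).exists_bound_of_continuousOn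
    f.2.1.continuous.continuousOn
  refine ⟨C, fun x y => ?_⟩
  obtain ⟨x', hx', ex⟩ := (h1 y).exists_mem_Ico₀ one_pos x
  obtain ⟨y', hy', ey⟩ := (h2 x').exists_mem_Ico₀ one_pos y
  have : f.1 (x, y) = f.1 (x', y') := ex.trans ey
  rw [this]
  exact hC _ ⟨Set.Ico_subset_Icc_self hx', Set.Ico_subset_Icc_self hy'⟩

/-- A smooth function on the torus as an element of degree `0` of the QHM. -/
def toQHM (c : ℤ) (μ ν : ℝ) (f : SmoothTorus) : QHM c μ ν :=
  QHM.ofFun μ (IsQHMFun.single (c := c) (ν := ν) (n := 0) (f := fun x y => f.1 (x, y))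
    f.2.1.continuous f.bounded (fun x y => (f.2.2 x y).2)
    (fun x y => by simp [ee_zero, (f.2.2 x y).1]))

end SmoothTorus

end

noncomputable section
open scoped ENNReal ContDiff Topology TensorProduct
open Filter

/-! ### Matrix coefficients of elements of the quantum Heisenberg manifold -/

/-! The algebra `D` is realized by operators on `ℓ²(ℝ × ℝ × ℤ)`, so that an element is determined by
its matrix coefficients (`QHM.ext_coef`) and the Heisenberg group acts by conjugation with
unitaries. By equivariance an orbit map is differentiable everywhere once it is so at the identity
(`hasHeisDer_of_zero`), and a set of elements that contains the derivatives of its members consists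
of smooth elements (`mem_qhmSmooth_of_hasHeisDer`). Together with the exchange of limits and
derivatives this gives completeness, and the Leibniz rule gives joint continuity of the product.

The gauge action is the central direction of the group, and `∂₃` is multiplication by `-2πin` on
degree `n`. Hence the spectral components of a smooth element decay rapidly
(`SmoothQHM.exists_seminorm_proj_le'`), the element is the sum of its components, and continuous
statements need a proof only for homogeneous elements. The homomorphism into `C^∞(𝕋) ⊗_π 𝒟` is `d ↦
∑ e(n·) ⊗ d_n`.

The elements of degree `n` given by functions are sections of a line bundle on the torus, which is
trivial over the cylinder left after removal of a circle `x = const`. Two cylinders cover the torus.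
Two weights, independent of `n`, whose squares sum to `1` yield the frames in all degrees. In the
trivialization `∂₁` differentiates the weight, while `∂₂` and `∂₃` bring in polynomials in `n` of
degree two and one (`der_polyFam`); this is the asserted growth. Frames of successive degrees differ
by a factor of degree one, a translated cut-off (`frame_mul_frameStep`), so that the frame elements
are products of vectors of `𝓔`: this is tameness.

The frame of degree one and its adjoint reduce any homogeneous element to degree zero
(`homogeneous_induction`), which shows that `A` and `E` generate. For universality, a covariant
representation is viewed as its graph in `D × B`. The C⋆-identity makes the graph contractive in
each degree because `x⋆x` lies over `A`; on sums of `2N + 1` degrees this costs a factor `2N + 1`,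
which powers of `x⋆x` remove (`IsGraphTriple.norm_le`). The closed graph is then a homomorphism.

For the splitting, the algebraic Toeplitz algebra lies in the span of all `d ⊗ E_{ij}` and of the `d
⊗ Sⁿ` with `d` of degree `n`, and contains the latter. The projection to symbols kills the former
and fixes the latter, so it preserves the algebra. In degree zero the generators are `-∂_x`, `-∂_y`
and `0`, and function values are diagonal matrix coefficients, which identifies the base with
`C^∞(𝕋²)`. -/

theorem ee_ne_zero (x : ℝ) : ee x ≠ 0 := by
  rw [← norm_ne_zero_iff, norm_ee]; exact one_ne_zero

theorem ee_intCast (n : ℤ) : ee n = 1 := by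
  rw [ee, Complex.exp_eq_one_iff]
  exact ⟨n, by push_cast; ring⟩

theorem contDiff_ee {n : WithTop ℕ∞} : ContDiff ℝ n ee := by
  unfold ee
  exact Complex.contDiff_exp.comp (contDiff_const.mul Complex.ofRealCLM.contDiff)

theorem hasDerivAt_ee (x : ℝ) : HasDerivAt ee (2 * Real.pi * Complex.I * ee x) x := by
  have h : HasDerivAt (fun t : ℝ => (2 * Real.pi * Complex.I : ℂ) * (t : ℂ))
      (2 * Real.pi * Complex.I * 1) x := (hasDerivAt_id x).ofReal_comp.const_mul _
  refine h.cexp.congr_deriv ?_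
  rw [ee]; ring

theorem HasDerivAt.ee_comp {f : ℝ → ℝ} {f' x : ℝ} (hf : HasDerivAt f f' x) :
    HasDerivAt (fun t => ee (f t)) (2 * Real.pi * Complex.I * f' * ee (f x)) x :=
  ((hasDerivAt_ee (f x)).scomp x hf).congr_deriv (by rw [Complex.real_smul]; ring)

namespace QHM

variable {c : ℤ} {μ ν : ℝ}

theorem toOp_injective : Function.Injective (toOp c μ ν) := Subtype.val_injective

theorem norm_toOp (d : QHM c μ ν) : ‖toOp c μ ν d‖ = ‖d‖ := rfl

/-- The inclusion into the bounded operators as a continuous linear map. -/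
def toOpL (c : ℤ) (μ ν : ℝ) :
    QHM c μ ν →L[ℂ] (ell2 (ℝ × ℝ × ℤ) →L[ℂ] ell2 (ℝ × ℝ × ℤ)) :=
  LinearMap.mkContinuous (toOp c μ ν).toAlgHom.toLinearMap 1 fun d => by
    rw [one_mul]; exact (norm_toOp d).le

/-- The matrix coefficient `⟨δ_z, d δ_w⟩`. -/
def coef (z w : ℝ × ℝ × ℤ) : QHM c μ ν →L[ℂ] ℂ :=
  (lp.evalCLM ℂ (fun _ : ℝ × ℝ × ℤ => ℂ) 2 z).comp
    ((ContinuousLinearMap.apply ℂ _ (lp.single 2 w (1 : ℂ))).comp (toOpL c μ ν))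

theorem coef_apply (z w : ℝ × ℝ × ℤ) (d : QHM c μ ν) :
    coef z w d = toOp c μ ν d (lp.single 2 w (1 : ℂ)) z := rfl

/-- The unit vectors span a dense subspace of `ℓ²`. Identities in the completion are checked on
coefficients, where no function is attached to a general element. -/
theorem ext_coef {d d' : QHM c μ ν} (h : ∀ z w, coef z w d = coef z w d') : d = d' := by
  refine toOp_injective ?_
  refine lp.ext_continuousLinearMap (by norm_num) fun w => ?_
  ext z
  exact h z w

/-- The third coordinates of `z` and `w` determine the only shift that could carry `z` to `w`, so at
most one term of the sum survives. -/
theorem coef_ofFun {F : ℝ → ℝ → ℤ → ℂ} (hF : IsQHMFun c ν F) (z w : ℝ × ℝ × ℤ) :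
    coef z w (ofFun μ hF) =
      if qhmShift μ ν (z.2.2 - w.2.2) z = w then F z.1 z.2.1 (z.2.2 - w.2.2) else 0 := by
  rw [coef_apply]
  change hF.rep μ _ z = _
  rw [IsQHMFun.rep_apply, finsum_eq_single _ (z.2.2 - w.2.2)]
  · split_ifs with h
    · rw [h, lp.single_apply_self, mul_one]
    · rw [lp.single_apply_ne _ _ _ h, mul_zero]
  · intro q hq
    rw [lp.single_apply_ne, mul_zero]
    rintro rfl
    exact hq (by simp [qhmShift])

theorem dense_ofFun : Dense {d : QHM c μ ν | ∃ F, ∃ hF : IsQHMFun c ν F, ofFun μ hF = d} := by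
  intro d
  rw [mem_closure_iff_seq_limit]
  have hd : (d : _).1 ∈ closure ((qhmPre c μ ν : Set _)) := d.2
  obtain ⟨u, hu, hlim⟩ := mem_closure_iff_seq_limit.1 hd
  choose F hF e using hu
  refine ⟨fun n => ofFun μ (hF n), fun n => ⟨_, _, rfl⟩, ?_⟩
  refine tendsto_subtype_rng.2 ?_
  refine hlim.congr fun n => (e n).symm

/-- A homogeneous function acts as a single weighted shift, whose norm is controlled by the supremum
of the weight. -/
theorem norm_le_of_bound {n : ℤ} {f : ℝ → ℝ → ℂ}
    (hF : IsQHMFun c ν (fun x y p => if p = n then f x y else 0)) {C : ℝ} (hC : 0 ≤ C)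
    (h : ∀ x y, ‖f x y‖ ≤ C) : ‖(ofFun μ hF : QHM c μ ν)‖ ≤ C := by
  change ‖hF.rep μ‖ ≤ C
  refine ContinuousLinearMap.opNorm_le_bound _ hC fun φ => ?_
  have : hF.rep μ φ = ⟨fun z => f z.1 z.2.1 * φ (qhmShift μ ν n z),
      memlp_wcomp (fun z : ℝ × ℝ × ℤ => f z.1 z.2.1) _ (qhmShift μ ν n).injective
        (fun z => h z.1 z.2.1) φ⟩ := by
    ext z
    rw [IsQHMFun.rep_apply, finsum_eq_single _ n (fun q hq => by simp [hq])]
    simp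
  rw [this]
  exact norm_wcomp_le (fun z : ℝ × ℝ × ℤ => f z.1 z.2.1) _ (qhmShift μ ν n).injective hC
    (fun z => h z.1 z.2.1) φ

theorem norm_coef_le (z w : ℝ × ℝ × ℤ) (d : QHM c μ ν) : ‖coef z w d‖ ≤ ‖d‖ := by
  rw [coef_apply]
  refine (lp.norm_apply_le_norm (by norm_num) _ z).trans ?_
  refine (ContinuousLinearMap.le_opNorm _ _).trans ?_
  rw [lp.norm_single (by norm_num), norm_one, mul_one, norm_toOp]

theorem ofFun_congr {F G : ℝ → ℝ → ℤ → ℂ} (hF : IsQHMFun c ν F) (hG : IsQHMFun c ν G)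
    (h : F = G) : (ofFun μ hF : QHM c μ ν) = ofFun μ hG := by
  subst h; rfl

theorem ofFun_mul {F G : ℝ → ℝ → ℤ → ℂ} (hF : IsQHMFun c ν F) (hG : IsQHMFun c ν G) :
    (ofFun μ hF * ofFun μ hG : QHM c μ ν) = ofFun μ (hF.mul hG (μ := μ)) :=
  Subtype.ext (hF.rep_mul hG)

theorem ofFun_star {F : ℝ → ℝ → ℤ → ℂ} (hF : IsQHMFun c ν F) :
    star (ofFun μ hF : QHM c μ ν) = ofFun μ (hF.star (μ := μ)) :=
  Subtype.ext hF.rep_star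

/-- Away from the graph of the shifts, matrix coefficients vanish. -/
theorem coef_eq_zero {z w : ℝ × ℝ × ℤ} (h : qhmShift μ ν (z.2.2 - w.2.2) z ≠ w)
    (d : QHM c μ ν) : coef z w d = 0 := by
  refine dense_ofFun.induction (P := fun d => coef z w d = 0) ?_ ?_ d
  · rintro _ ⟨F, hF, rfl⟩
    rw [coef_ofFun, if_neg h]
  · exact isClosed_eq (coef z w).continuous continuous_const

/-- Matrix coefficients do not depend on the base level. -/
theorem coef_shift_level (x y : ℝ) (p q : ℤ) (d : QHM c μ ν) :
    coef (x, y, p) (qhmShift μ ν q (x, y, p)) d = coef (x, y, 0) (qhmShift μ ν q (x, y, 0)) d := by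
  refine dense_ofFun.induction (P := fun d => coef (x, y, p) (qhmShift μ ν q (x, y, p)) d =
    coef (x, y, 0) (qhmShift μ ν q (x, y, 0)) d) ?_ ?_ d
  · rintro _ ⟨F, hF, rfl⟩
    simp [coef_ofFun, qhmShift]
  · exact isClosed_eq (coef _ _).continuous (coef _ _).continuous

end QHM

/-! ### The action of the Heisenberg group -/

/-- The product of the Heisenberg group for which `heisAct` is an action. -/
def heisMul (c : ℤ) (g h : ℝ × ℝ × ℝ) : ℝ × ℝ × ℝ :=
  (g.1 + h.1, g.2.1 + h.2.1, g.2.2 + h.2.2 + c * g.2.1 * h.1)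

/-- The phase of `g` is read at `x - g.1` rather than at `x - g.1 - h.1`; the discrepancy `c * g.2.1
* h.1` is the cocycle of the group. -/
theorem heisOp_mul (c : ℤ) (μ : ℝ) (g h : ℝ × ℝ × ℝ) :
    heisOp c μ g * heisOp c μ h = heisOp c μ (heisMul c g h) := by
  ext φ z
  simp only [heisOp, mul_apply_eq_comp, wcomp_apply, ← mul_assoc, ← ee_add]
  congr 1
  · congr 1
    simp [heisMul]
    ring
  · refine congr_arg φ ?_
    ext <;> simp [heisMul, sub_sub]

section Action

variable {c : ℤ} {μ ν : ℝ}

theorem toOp_heisAct (g : ℝ × ℝ × ℝ) (d : QHM c μ ν) :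
    QHM.toOp c μ ν (heisAct c μ ν g d) =
      heisOp c μ g * QHM.toOp c μ ν d * star (heisOp c μ g) := rfl

theorem heisAct_heisAct (g h : ℝ × ℝ × ℝ) (d : QHM c μ ν) :
    heisAct c μ ν g (heisAct c μ ν h d) = heisAct c μ ν (heisMul c g h) d := by
  refine QHM.toOp_injective ?_
  rw [toOp_heisAct, toOp_heisAct, toOp_heisAct, ← heisOp_mul, star_mul]
  simp only [mul_assoc]

theorem heisOp_zero (c : ℤ) (μ : ℝ) : heisOp c μ 0 = 1 := by
  ext φ z
  rw [heisOp, wcomp_apply, one_apply_eq_self]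
  simp only [Prod.snd_zero, Prod.fst_zero, mul_zero, zero_mul, add_zero, ee_zero, one_mul]
  refine congr_arg φ ?_
  ext <;> simp

theorem heisAct_zero (d : QHM c μ ν) : heisAct c μ ν 0 d = d := by
  refine QHM.toOp_injective ?_
  rw [toOp_heisAct, heisOp_zero, star_one, one_mul, mul_one]

theorem norm_heisAct_le (g : ℝ × ℝ × ℝ) (d : QHM c μ ν) : ‖heisAct c μ ν g d‖ ≤ ‖d‖ :=
  NonUnitalStarAlgHom.norm_apply_le (heisAct c μ ν g) d

/-- `heisAct` as a continuous linear map. -/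
def heisActL (c : ℤ) (μ ν : ℝ) (g : ℝ × ℝ × ℝ) : QHM c μ ν →L[ℂ] QHM c μ ν :=
  LinearMap.mkContinuous (heisAct c μ ν g).toAlgHom.toLinearMap 1 fun d => by
    rw [one_mul]; exact norm_heisAct_le g d

theorem heisActL_apply (g : ℝ × ℝ × ℝ) (d : QHM c μ ν) :
    heisActL c μ ν g d = heisAct c μ ν g d := rfl

theorem continuous_heisAct (g : ℝ × ℝ × ℝ) : Continuous (heisAct c μ ν g) :=
  (heisActL c μ ν g).continuous

theorem coef_heisAct (g : ℝ × ℝ × ℝ) (z w : ℝ × ℝ × ℤ) (d : QHM c μ ν) :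
    QHM.coef z w (heisAct c μ ν g d) =
      ee (-z.2.2 * (g.2.2 + c * g.2.1 * (z.1 - g.1 - z.2.2 * μ))) *
      ee (w.2.2 * (g.2.2 + c * g.2.1 * (w.1 - g.1 - w.2.2 * μ))) *
      QHM.coef (z.1 - g.1, z.2.1 - g.2.1, z.2.2) (w.1 - g.1, w.2.1 - g.2.1, w.2.2) d := by
  rw [QHM.coef_apply, toOp_heisAct, mul_apply_eq_comp, mul_apply_eq_comp]
  have h : star (heisOp c μ g) (lp.single 2 w (1 : ℂ)) =
      ee (w.2.2 * (g.2.2 + c * g.2.1 * (w.1 - g.1 - w.2.2 * μ))) •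
        lp.single 2 (w.1 - g.1, w.2.1 - g.2.1, w.2.2) (1 : ℂ) := by
    rw [heisOp, star_wcomp]
    ext v
    rw [wcomp_apply, lp.coeFn_smul, Pi.smul_apply]
    by_cases hv : v = (w.1 - g.1, w.2.1 - g.2.1, w.2.2)
    · subst hv
      have : ((Equiv.subRight g.1).prodCongr ((Equiv.subRight g.2.1).prodCongr (Equiv.refl ℤ))).symm
          (w.1 - g.1, w.2.1 - g.2.1, w.2.2) = w := by
        ext <;> simp
      rw [this, lp.single_apply_self, lp.single_apply_self, star_ee]
      simp
    · rw [lp.single_apply_ne _ _ _ hv, lp.single_apply_ne]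
      · simp
      · rintro rfl
        exact hv (by ext <;> simp)
  rw [h, map_smul, map_smul, lp.coeFn_smul, Pi.smul_apply, heisOp, wcomp_apply, smul_eq_mul,
    QHM.coef_apply]
  simp only [Equiv.prodCongr_apply, Prod.map, Equiv.subRight_apply, Equiv.refl_apply]
  ring

theorem coef_qhmGauge (t : ℝ) (z w : ℝ × ℝ × ℤ) (d : QHM c μ ν) :
    QHM.coef z w (qhmGauge c μ ν t d) = ee ((z.2.2 - w.2.2) * t) * QHM.coef z w d := by
  rw [qhmGauge, coef_heisAct, ← ee_add]
  simp only [sub_zero]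
  congr 2
  ring

/-- The gauge action comes from central elements of the Heisenberg group. Hence spectral projections
preserve smoothness and commute with the generators. -/
theorem heisAct_qhmGauge (g : ℝ × ℝ × ℝ) (t : ℝ) (d : QHM c μ ν) :
    heisAct c μ ν g (qhmGauge c μ ν t d) = qhmGauge c μ ν t (heisAct c μ ν g d) := by
  rw [qhmGauge, heisAct_heisAct, heisAct_heisAct]
  congr 1
  ext <;> simp [heisMul]
  ring_nf

theorem ofFun_single_mem_qhmSpec {n : ℤ} {f : ℝ → ℝ → ℂ}
    (hF : IsQHMFun c ν (fun x y p => if p = n then f x y else 0)) :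
    QHM.ofFun μ hF ∈ qhmSpec c μ ν n := by
  intro t
  refine QHM.ext_coef fun z w => ?_
  rw [coef_qhmGauge, map_smul, smul_eq_mul, QHM.coef_ofFun]
  split_ifs with h1 h2
  · rw [← h2]; push_cast; rfl
  · simp
  · simp

/-- A homogeneous element has non-zero matrix coefficients only between levels that differ by its
degree. -/
theorem coef_eq_zero_of_mem_qhmSpec {n : ℤ} {d : QHM c μ ν} (hd : d ∈ qhmSpec c μ ν n)
    {z w : ℝ × ℝ × ℤ} (h : z.2.2 - w.2.2 ≠ n) : QHM.coef z w d = 0 := by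
  by_contra h0
  have hn : ((z.2.2 - w.2.2 - n : ℤ) : ℝ) ≠ 0 := Int.cast_ne_zero.2 (sub_ne_zero.2 h)
  -- At this time the phases of the two sides differ by `e(1/2) = -1`.
  set t : ℝ := 1 / (2 * ((z.2.2 - w.2.2 - n : ℤ) : ℝ)) with ht
  have h1 := congr_arg (QHM.coef z w) (hd t)
  rw [coef_qhmGauge, map_smul, smul_eq_mul] at h1
  have h2 := mul_right_cancel₀ h0 h1
  have h3 : ee (1 / 2) = 1 := by
    have : ((z.2.2 : ℝ) - w.2.2) * t = n * t + 1 / 2 := by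
      rw [ht]; push_cast at hn ⊢; field_simp; ring
    rw [this, ee_add] at h2
    exact mul_left_cancel₀ (ee_ne_zero _) (h2.trans (mul_one _).symm)
  have h4 : ee (1 / 2) = -1 := by
    rw [ee, ← Complex.exp_pi_mul_I]; congr 1; push_cast; ring
  rw [h4] at h3
  norm_num at h3

end Action

/-! ### The differential of an orbit map -/

section Differential

/-- The differential of an orbit map of the Heisenberg group, in terms of the values of the
generators: `(a, b, e) ↦ a (u₀ - c s u₂) + b u₁ + e u₂`. -/
def heisForm {X : Type*} [NormedAddCommGroup X] [NormedSpace ℝ X] (k : ℝ) (u : Fin 3 → X) :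
    ℝ × ℝ × ℝ →L[ℝ] X :=
  (ContinuousLinearMap.fst ℝ ℝ (ℝ × ℝ)).smulRight (u 0 - k • u 2) +
    ((ContinuousLinearMap.fst ℝ ℝ ℝ).comp (ContinuousLinearMap.snd ℝ ℝ (ℝ × ℝ))).smulRight (u 1) +
    ((ContinuousLinearMap.snd ℝ ℝ ℝ).comp (ContinuousLinearMap.snd ℝ ℝ (ℝ × ℝ))).smulRight (u 2)

variable {X : Type*} [NormedAddCommGroup X] [NormedSpace ℝ X]

theorem heisForm_apply (k : ℝ) (u : Fin 3 → X) (v : ℝ × ℝ × ℝ) :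
    heisForm k u v = v.1 • (u 0 - k • u 2) + v.2.1 • u 1 + v.2.2 • u 2 := rfl

/-- The constant depends only on `k`: convergence of the generators' values becomes uniform
convergence of the differentials wherever `k` is bounded. -/
theorem norm_heisForm_le (k : ℝ) (u : Fin 3 → X) {C : ℝ} (hC : ∀ i, ‖u i‖ ≤ C) :
    ‖heisForm k u‖ ≤ (3 + |k|) * C := by
  have hC0 : 0 ≤ C := (norm_nonneg _).trans (hC 0)
  refine ContinuousLinearMap.opNorm_le_bound _ (by positivity) fun v => ?_
  rw [heisForm_apply]
  have h1 : ‖v.1‖ ≤ ‖v‖ := norm_fst_le v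
  have h2 : ‖v.2.1‖ ≤ ‖v‖ := (norm_fst_le v.2).trans (norm_snd_le v)
  have h3 : ‖v.2.2‖ ≤ ‖v‖ := (norm_snd_le v.2).trans (norm_snd_le v)
  calc _ ≤ ‖v.1‖ * (‖u 0‖ + |k| * ‖u 2‖) + ‖v.2.1‖ * ‖u 1‖ + ‖v.2.2‖ * ‖u 2‖ := by
        refine (norm_add₃_le).trans ?_
        rw [norm_smul, norm_smul, norm_smul]
        gcongr
        refine (norm_sub_le _ _).trans ?_
        rw [norm_smul, Real.norm_eq_abs]
    _ ≤ ‖v‖ * (C + |k| * C) + ‖v‖ * C + ‖v‖ * C := by gcongr <;> exact hC _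
    _ = _ := by ring

theorem ContDiff.heisForm {n : WithTop ℕ∞} {Y : Type*} [NormedAddCommGroup Y] [NormedSpace ℝ Y]
    {k : Y → ℝ} {u : Y → Fin 3 → X} (hk : ContDiff ℝ n k) (hu : ∀ i, ContDiff ℝ n fun y => u y i) :
    ContDiff ℝ n fun y => heisForm (k y) (u y) := by
  unfold _root_.heisForm
  exact ((contDiff_const.smulRight ((hu 0).sub (hk.smul (hu 2)))).add
    (contDiff_const.smulRight (hu 1))).add (contDiff_const.smulRight (hu 2))

end Differential

/-! ### Smooth elements and the generators of the action -/

section Smooth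

variable {c : ℤ} {μ ν : ℝ}

/-- The orbit map of `d` is differentiable everywhere, with the elements `u i` as the values of the
generators. -/
def HasHeisDer (d : QHM c μ ν) (u : Fin 3 → QHM c μ ν) : Prop :=
  ∀ g, HasFDerivAt (fun g => heisAct c μ ν g d)
    (heisForm (c * g.2.1) fun i => heisAct c μ ν g (u i)) g

/-- Near `g` the orbit map is the orbit map near the identity followed by the bounded operator
`heisActL c μ ν g`, so the chain rule applies. -/
theorem hasHeisDer_of_zero {d : QHM c μ ν} {u : Fin 3 → QHM c μ ν}
    (h : HasFDerivAt (fun g => heisAct c μ ν g d) (heisForm 0 u) 0) : HasHeisDer d u := by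
  intro g
  -- The group element `g⁻¹g'` is exactly `L (g' - g)`; the cocycle contributes the term `-c *
  -- g.2.1` in the third coordinate.
  let L : ℝ × ℝ × ℝ →L[ℝ] ℝ × ℝ × ℝ :=
    (ContinuousLinearMap.fst ℝ ℝ (ℝ × ℝ)).prod
      (((ContinuousLinearMap.fst ℝ ℝ ℝ).comp (ContinuousLinearMap.snd ℝ ℝ (ℝ × ℝ))).prod
        ((ContinuousLinearMap.snd ℝ ℝ ℝ).comp (ContinuousLinearMap.snd ℝ ℝ (ℝ × ℝ)) -
          (c * g.2.1) • ContinuousLinearMap.fst ℝ ℝ (ℝ × ℝ)))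
  have hLv : ∀ v, L v = (v.1, v.2.1, v.2.2 - c * g.2.1 * v.1) := fun v => rfl
  have hL : HasFDerivAt (fun g' => L (g' - g)) L g :=
    L.hasFDerivAt.comp g ((hasFDerivAt_id g).sub_const g)
  have h0 : L (g - g) = 0 := by simp
  have h1 : HasFDerivAt (fun g' => heisAct c μ ν (L (g' - g)) d) ((heisForm 0 u).comp L) g :=
    HasFDerivAt.comp g (f := fun g' => L (g' - g)) (g := fun g => heisAct c μ ν g d)
      (by rw [h0]; exact h) hL
  have h2 := ((heisActL c μ ν g).restrictScalars ℝ).hasFDerivAt.comp g h1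
  refine (h2.congr_fderiv ?_).congr_of_eventuallyEq (Eventually.of_forall fun g' => ?_)
  · refine ContinuousLinearMap.ext fun v => ?_
    change heisActL c μ ν g (heisForm 0 u (L v)) = _
    have hr : ∀ (r : ℝ) (x : QHM c μ ν), heisActL c μ ν g (r • x) = r • heisActL c μ ν g x :=
      fun r x => map_smul ((heisActL c μ ν g).restrictScalars ℝ) r x
    rw [hLv, heisForm_apply, heisForm_apply]
    simp only [map_add, hr, heisActL_apply, zero_smul, sub_zero]
    module
  · simp only [Function.comp, ContinuousLinearMap.coe_restrictScalars', heisActL_apply,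
      heisAct_heisAct]
    refine congr_arg (fun h => heisAct c μ ν h d) ?_
    rw [hLv]
    ext
    · simp [heisMul]
    · simp [heisMul]
    · simp only [heisMul, Prod.fst_sub, Prod.snd_sub]
      ring

theorem hasDerivAt_heisCurve (i : Fin 3) : HasDerivAt (heisCurve i) (heisCurve i 1) 0 := by
  fin_cases i
  · exact (hasDerivAt_id _).prodMk ((hasDerivAt_const _ _).prodMk (hasDerivAt_const _ _))
  · exact (hasDerivAt_const _ _).prodMk ((hasDerivAt_id _).prodMk (hasDerivAt_const _ _))
  · exact (hasDerivAt_const _ _).prodMk ((hasDerivAt_const _ _).prodMk (hasDerivAt_id _))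

theorem heisCurve_zero (i : Fin 3) : heisCurve i 0 = 0 := by
  fin_cases i <;> rfl

theorem heisForm_heisCurve {X : Type*} [NormedAddCommGroup X] [NormedSpace ℝ X] (u : Fin 3 → X)
    (i : Fin 3) : heisForm 0 u (heisCurve i 1) = u i := by
  rw [heisForm_apply]
  fin_cases i <;> simp [heisCurve]

theorem HasHeisDer.hasDerivAt {d : QHM c μ ν} {u : Fin 3 → QHM c μ ν} (h : HasHeisDer d u)
    (i : Fin 3) : HasDerivAt (fun t => heisAct c μ ν (heisCurve i t) d) (u i) 0 := by
  have h0 := h (heisCurve i 0)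
  have := h0.comp_hasDerivAt 0 (hasDerivAt_heisCurve i)
  refine this.congr_deriv ?_
  rw [heisCurve_zero]
  simp only [heisAct_zero, Prod.snd_zero, Prod.fst_zero, mul_zero, heisForm_heisCurve]

theorem HasHeisDer.heisDer_eq {d : QHM c μ ν} {u : Fin 3 → QHM c μ ν} (h : HasHeisDer d u)
    (i : Fin 3) : heisDer c μ ν i d = u i := (h.hasDerivAt i).deriv

theorem mem_qhmSmooth_iff {d : QHM c μ ν} :
    d ∈ qhmSmooth c μ ν ↔ ContDiff ℝ ∞ fun g => heisAct c μ ν g d := Iff.rfl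

theorem hasHeisDer_of_mem {d : QHM c μ ν} (hd : d ∈ qhmSmooth c μ ν) :
    HasHeisDer d fun i => heisDer c μ ν i d := by
  have h : HasFDerivAt (fun g => heisAct c μ ν g d) (fderiv ℝ (fun g => heisAct c μ ν g d) 0) 0 :=
    ((mem_qhmSmooth_iff.1 hd).differentiable (by simp)).differentiableAt.hasFDerivAt
  set L := fderiv ℝ (fun g => heisAct c μ ν g d) 0
  -- A linear map on `ℝ³` is recovered from the three coordinate directions; at the identity the
  -- cocycle term is absent.
  have hL : L = heisForm 0 fun i => L (heisCurve i 1) := by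
    refine ContinuousLinearMap.ext fun v => ?_
    rw [heisForm_apply, zero_smul, sub_zero, ← map_smul, ← map_smul, ← map_smul, ← map_add,
      ← map_add]
    congr 1
    ext <;> simp [heisCurve]
  rw [hL] at h
  have h' := hasHeisDer_of_zero h
  have : (fun i => heisDer c μ ν i d) = fun i => L (heisCurve i 1) := funext h'.heisDer_eq
  rw [this]
  exact h'

theorem heisDer_mem_qhmSmooth {d : QHM c μ ν} (hd : d ∈ qhmSmooth c μ ν) (i : Fin 3) :
    heisDer c μ ν i d ∈ qhmSmooth c μ ν := by
  rw [mem_qhmSmooth_iff] at *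
  -- These are the left-invariant vector fields. The orbit of `∂_i d` is the derivative of the orbit
  -- of `d` along `X i`, hence smooth.
  let X : Fin 3 → ℝ × ℝ × ℝ → ℝ × ℝ × ℝ :=
    ![fun g => (1, 0, c * g.2.1), fun _ => (0, 1, 0), fun _ => (0, 0, 1)]
  have hX : ContDiff ℝ ∞ (X i) := by
    fin_cases i <;> dsimp [X] <;> fun_prop
  have h : (fun g => heisAct c μ ν g (heisDer c μ ν i d)) =
      fun g => fderiv ℝ (fun g => heisAct c μ ν g d) g (X i g) := by
    funext g
    rw [(hasHeisDer_of_mem (mem_qhmSmooth_iff.2 hd) g).fderiv, heisForm_apply]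
    fin_cases i <;> simp [X]
  rw [h]
  exact (hd.fderiv_right (by simp)).clm_apply hX

/-- A set that is closed under derivatives consists of smooth elements. -/
theorem mem_qhmSmooth_of_hasHeisDer {S : Set (QHM c μ ν)}
    (hS : ∀ d ∈ S, ∃ u : Fin 3 → QHM c μ ν, (∀ i, u i ∈ S) ∧ HasHeisDer d u)
    {d : QHM c μ ν} (hd : d ∈ S) : d ∈ qhmSmooth c μ ν := by
  rw [mem_qhmSmooth_iff, contDiff_infty]
  intro n
  induction n generalizing d with
  | zero =>
    obtain ⟨u, -, h⟩ := hS d hd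
    exact contDiff_zero.2 (continuous_iff_continuousAt.2 fun g => (h g).continuousAt)
  | succ n ih =>
    obtain ⟨u, hu, h⟩ := hS d hd
    push_cast
    rw [contDiff_succ_iff_hasFDerivAt]
    -- The differential is built from the orbit maps of the `u i`, which belong to `S` again and are
    -- `C^n` by induction.
    refine ⟨_, ?_, h⟩
    refine ContDiff.heisForm ?_ fun i => ih (hu i)
    fun_prop

theorem hasDerivAt_heisAct {d : QHM c μ ν} (hd : d ∈ qhmSmooth c μ ν) (i : Fin 3) :
    HasDerivAt (fun t => heisAct c μ ν (heisCurve i t) d) (heisDer c μ ν i d) 0 :=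
  (hasHeisDer_of_mem hd).hasDerivAt i

theorem heisDer_add {d d' : QHM c μ ν} (hd : d ∈ qhmSmooth c μ ν) (hd' : d' ∈ qhmSmooth c μ ν)
    (i : Fin 3) : heisDer c μ ν i (d + d') = heisDer c μ ν i d + heisDer c μ ν i d' := by
  rw [heisDer]
  simp only [map_add]
  exact ((hasDerivAt_heisAct hd i).add (hasDerivAt_heisAct hd' i)).deriv

theorem heisDer_smul {d : QHM c μ ν} (hd : d ∈ qhmSmooth c μ ν) (a : ℂ) (i : Fin 3) :
    heisDer c μ ν i (a • d) = a • heisDer c μ ν i d := by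
  rw [heisDer]
  simp only [map_smul]
  exact ((hasDerivAt_heisAct hd i).const_smul a).deriv

theorem heisDer_mul {d d' : QHM c μ ν} (hd : d ∈ qhmSmooth c μ ν) (hd' : d' ∈ qhmSmooth c μ ν)
    (i : Fin 3) : heisDer c μ ν i (d * d') = heisDer c μ ν i d * d' + d * heisDer c μ ν i d' := by
  rw [heisDer]
  simp only [map_mul]
  refine ((hasDerivAt_heisAct hd i).mul (hasDerivAt_heisAct hd' i)).deriv.trans ?_
  rw [heisCurve_zero, heisAct_zero, heisAct_zero]

theorem heisDer_star {d : QHM c μ ν} (hd : d ∈ qhmSmooth c μ ν) (i : Fin 3) :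
    heisDer c μ ν i (star d) = star (heisDer c μ ν i d) := by
  rw [heisDer]
  simp only [map_star]
  exact (hasDerivAt_heisAct hd i).star.deriv

end Smooth

/-! ### The Fréchet algebra of smooth elements -/

namespace SmoothQHM

variable {c : ℤ} {μ ν : ℝ}

theorem incl_mem (d : SmoothQHM c μ ν) : incl c μ ν d ∈ qhmSmooth c μ ν := d.2

theorem incl_injective : Function.Injective (incl c μ ν) := Subtype.val_injective

/-- An element of the QHM with smooth orbit map as an element of the smooth QHM. -/
def mk (d : QHM c μ ν) (hd : d ∈ qhmSmooth c μ ν) : SmoothQHM c μ ν := ⟨d, hd⟩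

@[simp] theorem incl_mk (d : QHM c μ ν) (hd : d ∈ qhmSmooth c μ ν) : incl c μ ν (mk d hd) = d := rfl

/-- The generators as endomorphisms of the smooth QHM. -/
def der (i : Fin 3) : SmoothQHM c μ ν →ₗ[ℂ] SmoothQHM c μ ν where
  toFun d := mk (heisDer c μ ν i (incl c μ ν d)) (heisDer_mem_qhmSmooth d.incl_mem i)
  map_add' d d' := incl_injective (by
    simp only [map_add, incl_mk, heisDer_add d.incl_mem d'.incl_mem])
  map_smul' a d := incl_injective (by
    simp only [map_smul, incl_mk, heisDer_smul d.incl_mem, RingHom.id_apply])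

theorem incl_der (i : Fin 3) (d : SmoothQHM c μ ν) :
    incl c μ ν (der i d) = heisDer c μ ν i (incl c μ ν d) := rfl

theorem der_mul (i : Fin 3) (d d' : SmoothQHM c μ ν) :
    der i (d * d') = der i d * d' + d * der i d' :=
  incl_injective (by
    rw [incl_der, map_mul, heisDer_mul d.incl_mem d'.incl_mem, map_add, map_mul, map_mul,
      incl_der, incl_der])

theorem der_star (i : Fin 3) (d : SmoothQHM c μ ν) : der i (star d) = star (der i d) :=
  incl_injective (by
    rw [incl_der, map_star, heisDer_star d.incl_mem, map_star, incl_der])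

/-- Iterated derivatives along a word in the generators. -/
def wder (w : List (Fin 3)) : SmoothQHM c μ ν →ₗ[ℂ] SmoothQHM c μ ν :=
  w.foldr (fun i L => der i ∘ₗ L) LinearMap.id

@[simp] theorem wder_nil (d : SmoothQHM c μ ν) : wder [] d = d := rfl

@[simp] theorem wder_cons (i : Fin 3) (w : List (Fin 3)) (d : SmoothQHM c μ ν) :
    wder (i :: w) d = der i (wder w d) := rfl

theorem wder_append (w w' : List (Fin 3)) (d : SmoothQHM c μ ν) :
    wder (w ++ w') d = wder w (wder w' d) := by
  induction w with
  | nil => rfl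
  | cons i w ih => rw [List.cons_append, wder_cons, ih, wder_cons]

theorem incl_wder (w : List (Fin 3)) (d : SmoothQHM c μ ν) :
    incl c μ ν (wder w d) = w.foldr (heisDer c μ ν) (incl c μ ν d) := by
  induction w with
  | nil => rfl
  | cons i w ih => rw [wder_cons, incl_der, ih, List.foldr_cons]

theorem wder_star (w : List (Fin 3)) (d : SmoothQHM c μ ν) : wder w (star d) = star (wder w d) := by
  induction w with
  | nil => rfl
  | cons i w ih => rw [wder_cons, ih, wder_cons, der_star]

/-- `wder` with values in the QHM. -/
def wderI (w : List (Fin 3)) : SmoothQHM c μ ν →ₗ[ℂ] QHM c μ ν :=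
  (incl c μ ν).toAlgHom.toLinearMap ∘ₗ wder w

theorem wderI_apply (w : List (Fin 3)) (d : SmoothQHM c μ ν) :
    wderI w d = incl c μ ν (wder w d) := rfl

/-- The seminorms that define the topology. -/
def seminorm : SeminormFamily ℂ (SmoothQHM c μ ν) (List (Fin 3)) :=
  fun w => (normSeminorm ℂ (QHM c μ ν)).comp (wderI w)

theorem seminorm_apply (w : List (Fin 3)) (d : SmoothQHM c μ ν) :
    seminorm w d = ‖incl c μ ν (wder w d)‖ := rfl

theorem uniformSpace_eq : (inferInstance : UniformSpace (SmoothQHM c μ ν)) =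
    ⨅ w : List (Fin 3), UniformSpace.comap (wderI w) inferInstance := by
  refine iInf_congr fun w => ?_
  congr 1
  funext d
  exact (incl_wder w d).symm

instance : IsUniformAddGroup (SmoothQHM c μ ν) := by
  have := isUniformAddGroup_iInf (us' := fun w : List (Fin 3) =>
    UniformSpace.comap (wderI (c := c) (μ := μ) (ν := ν) w) inferInstance)
    fun w => IsUniformAddGroup.comap (wderI w)
  rwa [← uniformSpace_eq] at this

theorem topology_eq : (inferInstance : TopologicalSpace (SmoothQHM c μ ν)) =
    ⨅ w : List (Fin 3), TopologicalSpace.induced (wderI w) inferInstance := by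
  refine (congr_arg (fun u => u.toTopologicalSpace) uniformSpace_eq).trans ?_
  rw [UniformSpace.toTopologicalSpace_iInf]
  rfl

theorem withSeminorms : WithSeminorms (seminorm (c := c) (μ := μ) (ν := ν)) := by
  rw [SeminormFamily.withSeminorms_iff_nhds_eq_iInf]
  refine (congr_arg (fun t => @nhds _ t 0) topology_eq).trans ?_
  rw [nhds_iInf]
  refine iInf_congr fun w => ?_
  rw [nhds_induced, map_zero, ← comap_norm_nhds_zero, comap_comap]
  rfl

instance : ContinuousSMul ℂ (SmoothQHM c μ ν) := withSeminorms.continuousSMul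

instance : PolynormableSpace ℂ (SmoothQHM c μ ν) := withSeminorms.toPolynormableSpace

theorem continuous_wderI (w : List (Fin 3)) : Continuous (wderI (c := c) (μ := μ) (ν := ν) w) :=
  continuous_iff_le_induced.2 (topology_eq.le.trans (iInf_le _ w))

theorem continuous_incl : Continuous (incl c μ ν) := continuous_wderI []

theorem continuous_of_wderI {Y : Type*} [TopologicalSpace Y] {f : Y → SmoothQHM c μ ν}
    (h : ∀ w, Continuous fun y => wderI w (f y)) : Continuous f := by
  rw [continuous_iff_coinduced_le]
  refine le_trans ?_ topology_eq.symm.le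
  exact le_iInf fun w => continuous_iff_coinduced_le.1 (continuous_induced_rng.2 (h w))

theorem continuous_der (i : Fin 3) : Continuous (der (c := c) (μ := μ) (ν := ν) i) := by
  refine continuous_of_wderI fun w => ?_
  have : (fun d => wderI w (der i d)) = wderI (c := c) (μ := μ) (ν := ν) (w ++ [i]) := by
    funext d
    rw [wderI_apply, wderI_apply, wder_append]; rfl
  rw [this]
  exact continuous_wderI _

instance : T2Space (SmoothQHM c μ ν) :=
  T2Space.of_injective_continuous incl_injective continuous_incl

instance : ContinuousMul (SmoothQHM c μ ν) := by
  refine ⟨continuous_of_wderI fun w => ?_⟩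
  -- The last letter of a word acts on the element before the others, so peeling it off lets the
  -- Leibniz rule leave the shorter word on two products.
  induction w using List.reverseRecOn with
  | nil =>
    have : (fun y : SmoothQHM c μ ν × SmoothQHM c μ ν => wderI [] (y.1 * y.2)) =
        fun y => incl c μ ν y.1 * incl c μ ν y.2 := by
      funext y; exact map_mul (incl c μ ν) _ _
    rw [this]
    exact (continuous_incl.comp continuous_fst).mul (continuous_incl.comp continuous_snd)
  | append_singleton w i ih =>
    have : (fun y : SmoothQHM c μ ν × SmoothQHM c μ ν => wderI (w ++ [i]) (y.1 * y.2)) =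
        fun y => wderI w (der i y.1 * y.2) + wderI w (y.1 * der i y.2) := by
      funext y
      rw [wderI_apply, wder_append, wder_cons, wder_nil, der_mul, map_add, map_add]; rfl
    rw [this]
    exact (ih.comp (((continuous_der i).comp continuous_fst).prodMk continuous_snd)).add
      (ih.comp (continuous_fst.prodMk ((continuous_der i).comp continuous_snd)))

theorem countable_uniformity : (uniformity (SmoothQHM c μ ν)).IsCountablyGenerated := by
  have h : uniformity (SmoothQHM c μ ν) = ⨅ w : List (Fin 3),
      comap (Prod.map (wderI w) (wderI w)) (uniformity (QHM c μ ν)) := by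
    refine (congr_arg (fun u => @uniformity _ u) uniformSpace_eq).trans ?_
    rw [iInf_uniformity]
    rfl
  rw [h]
  infer_instance

/-- The limit of the derivatives of a sequence of smooth elements is the derivative of the limit. -/
theorem hasHeisDer_of_tendsto {d : ℕ → QHM c μ ν} {e : ℕ → Fin 3 → QHM c μ ν} {a : QHM c μ ν}
    {b : Fin 3 → QHM c μ ν} (hd : ∀ n, HasHeisDer (d n) (e n)) (ha : Tendsto d atTop (𝓝 a))
    (hb : ∀ i, Tendsto (fun n => e n i) atTop (𝓝 (b i))) : HasHeisDer a b := by
  refine hasHeisDer_of_zero ?_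
  -- Restricting to the unit ball bounds the coefficient `c * g.2.1` by `|c|`, which makes the
  -- convergence of the differentials uniform.
  have key := hasFDerivAt_of_tendstoUniformlyOn (𝕜 := ℝ) (l := atTop)
    (s := Metric.ball (0 : ℝ × ℝ × ℝ) 1) (f := fun n g => heisAct c μ ν g (d n))
    (f' := fun n g => heisForm (c * g.2.1) fun i => heisAct c μ ν g (e n i))
    (g := fun g => heisAct c μ ν g a)
    (g' := fun g => heisForm (c * g.2.1) fun i => heisAct c μ ν g (b i))
    Metric.isOpen_ball ?_ (fun n g _ => hd n g)
    (fun g _ => ((continuous_heisAct g).tendsto a).comp ha) (Metric.mem_ball_self one_pos)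
  · simpa [heisAct_zero] using key
  · rw [Metric.tendstoUniformlyOn_iff]
    intro ε hε
    have hpos : 0 < ε / (2 * (3 + |(c : ℝ)|)) := by positivity
    have : ∀ᶠ n in atTop, ∀ i, ‖b i - e n i‖ ≤ ε / (2 * (3 + |(c : ℝ)|)) := by
      rw [eventually_all]
      intro i
      have := (tendsto_iff_norm_sub_tendsto_zero.1 (hb i)).eventually (ge_mem_nhds hpos)
      filter_upwards [this] with n hn
      rwa [norm_sub_rev]
    filter_upwards [this] with n hn g hg
    have hg' : |g.2.1| ≤ 1 := by
      have h1 : ‖g‖ < 1 := by simpa using hg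
      exact ((norm_fst_le g.2).trans (norm_snd_le g)).trans h1.le
    have hsub : (heisForm (c * g.2.1) fun i => heisAct c μ ν g (b i)) -
        (heisForm (c * g.2.1) fun i => heisAct c μ ν g (e n i)) =
        heisForm (c * g.2.1) fun i => heisAct c μ ν g (b i - e n i) := by
      refine ContinuousLinearMap.ext fun v => ?_
      simp only [sub_apply, heisForm_apply, map_sub]
      module
    rw [dist_eq_norm, hsub]
    have h1 := norm_heisForm_le (c * g.2.1) (fun i => heisAct c μ ν g (b i - e n i))
      fun i => (norm_heisAct_le g _).trans (hn i)
    have h2 : |c * g.2.1| ≤ |(c : ℝ)| := by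
      rw [abs_mul]; exact mul_le_of_le_one_right (abs_nonneg _) hg'
    calc _ ≤ _ := h1
      _ ≤ (3 + |(c : ℝ)|) * (ε / (2 * (3 + |(c : ℝ)|))) := by gcongr
      _ = ε / 2 := by field_simp
      _ < ε := by linarith

/-- Along a Cauchy sequence the derivatives for each word converge in `D`. The limits are
derivatives of one another, so their set is stable under the generators and its members are smooth.
Metrizability allows sequences. -/
instance : CompleteSpace (SmoothQHM c μ ν) := by
  have := countable_uniformity (c := c) (μ := μ) (ν := ν)
  refine UniformSpace.complete_of_cauchySeq_tendsto fun d hd => ?_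
  have h1 : ∀ w, ∃ e, Tendsto (fun n => wderI w (d n)) atTop (𝓝 e) := fun w =>
    cauchySeq_tendsto_of_complete (hd.map (uniformContinuous_addMonoidHom_of_continuous
      (f := (wderI w).toAddMonoidHom) (continuous_wderI w)))
  choose e he using h1
  have h2 : ∀ w, HasHeisDer (e w) fun i => e (i :: w) := fun w =>
    hasHeisDer_of_tendsto (d := fun n => wderI w (d n)) (e := fun n i => wderI (i :: w) (d n))
      (fun n => hasHeisDer_of_mem (wder w (d n)).incl_mem) (he w) fun i => he (i :: w)
  have h3 : ∀ w, e w ∈ qhmSmooth c μ ν := fun w =>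
    mem_qhmSmooth_of_hasHeisDer (S := Set.range e)
      (by rintro _ ⟨w, rfl⟩; exact ⟨_, fun i => ⟨_, rfl⟩, h2 w⟩) ⟨w, rfl⟩
  refine ⟨mk (e []) (h3 []), ?_⟩
  have h4 : ∀ w, wderI w (mk (e []) (h3 [])) = e w := fun w => by
    induction w with
    | nil => rfl
    | cons i w ih =>
      rw [wderI_apply, wder_cons, incl_der, ← wderI_apply, ih, (h2 w).heisDer_eq]
  rw [withSeminorms.tendsto_nhds]
  intro w ε hε
  have := (tendsto_iff_norm_sub_tendsto_zero.1 (he w)).eventually (gt_mem_nhds hε)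
  filter_upwards [this] with n hn
  rwa [seminorm_apply, ← wderI_apply, map_sub, h4]

theorem isFrechetAlgebra : IsFrechetAlgebra (SmoothQHM c μ ν) where
  uniformAddGroup := inferInstance
  continuousSMul := inferInstance
  locallyConvex := inferInstance
  t2 := inferInstance
  complete := inferInstance
  continuousMul := inferInstance
  countable := countable_uniformity

end SmoothQHM

/-! ### Spectral projections of the gauge action -/

theorem integral_ee_mul (k : ℤ) : ∫ t in (0 : ℝ)..1, ee (k * t) = if k = 0 then 1 else 0 := by
  split_ifs with h
  · simp [h, ee_zero]
  · have hk : (2 * Real.pi * Complex.I * k : ℂ) ≠ 0 := by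
      simp [Real.pi_ne_zero, h]
    have hd : ∀ t : ℝ, HasDerivAt (fun t : ℝ => (2 * Real.pi * Complex.I * k : ℂ)⁻¹ * ee (k * t))
        (ee (k * t)) t := fun t => by
      have h1 : HasDerivAt (fun t : ℝ => (k : ℝ) * t) k t := by
        simpa using (hasDerivAt_id t).const_mul (k : ℝ)
      refine (h1.ee_comp.const_mul _).congr_deriv ?_
      rw [← mul_assoc]
      push_cast
      rw [inv_mul_cancel₀ hk, one_mul]
    rw [intervalIntegral.integral_eq_sub_of_hasDerivAt (fun t _ => hd t)
      ((continuous_ee.comp (by fun_prop)).intervalIntegrable _ _)]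
    rw [mul_one, mul_zero, ee_intCast, ee_zero, sub_self]

section Spectral

variable {c : ℤ} {μ ν : ℝ}

theorem IsQHMFun.component {F : ℝ → ℝ → ℤ → ℂ} (hF : IsQHMFun c ν F) (q : ℤ) :
    IsQHMFun c ν (fun x y p => if p = q then F x y q else 0) :=
  IsQHMFun.single (f := fun x y => F x y q) (hF.continuous q) (hF.bounded q)
    (fun x y => hF.periodic x y q) (fun x y => hF.quasi x y q)

theorem QHM.ofFun_eq_sum {F : ℝ → ℝ → ℤ → ℂ} (hF : IsQHMFun c ν F) :
    (QHM.ofFun μ hF : QHM c μ ν) =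
      ∑ q ∈ hF.finite.toFinset, QHM.ofFun μ (hF.component q) := by
  refine QHM.ext_coef fun z w => ?_
  rw [map_sum]
  simp only [QHM.coef_ofFun]
  split_ifs with h
  · rw [Finset.sum_ite_eq]
    split_ifs with h'
    · rfl
    · exact hF.supp h'
  · simp

/-- Finite sums of homogeneous elements are dense. -/
theorem QHM.dense_span_qhmSpec :
    Dense (Submodule.span ℂ {d : QHM c μ ν | ∃ n, d ∈ qhmSpec c μ ν n} : Set (QHM c μ ν)) := by
  refine QHM.dense_ofFun.mono ?_
  rintro _ ⟨F, hF, rfl⟩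
  rw [QHM.ofFun_eq_sum hF]
  exact Submodule.sum_mem _ fun q _ => Submodule.subset_span ⟨q, ofFun_single_mem_qhmSpec _⟩

/-- On homogeneous elements the orbit is a character times a constant. The `γ_t` are contractive, so
the general orbit is a uniform limit of finite sums of these. -/
theorem continuous_qhmGauge_apply (d : QHM c μ ν) : Continuous fun t => qhmGauge c μ ν t d := by
  have h : ∀ x ∈ (Submodule.span ℂ {d : QHM c μ ν | ∃ n, d ∈ qhmSpec c μ ν n}),
      Continuous fun t => qhmGauge c μ ν t x := fun x hx => by
    induction hx using Submodule.span_induction with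
    | mem x hx =>
      obtain ⟨n, hn⟩ := hx
      simp only [hn _]
      exact (continuous_ee.comp (by fun_prop)).smul continuous_const
    | zero => simpa using continuous_const
    | add x y _ _ hx hy =>
      simp only [map_add]
      exact hx.add hy
    | smul a x _ hx =>
      simp only [map_smul]
      exact hx.const_smul a
  obtain ⟨u, hu, hlim⟩ := mem_closure_iff_seq_limit.1 (QHM.dense_span_qhmSpec d)
  have : TendstoUniformly (fun n t => qhmGauge c μ ν t (u n)) (fun t => qhmGauge c μ ν t d)
      atTop := by
    rw [Metric.tendstoUniformly_iff]
    intro ε hε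
    filter_upwards [(tendsto_iff_norm_sub_tendsto_zero.1 hlim).eventually (gt_mem_nhds hε)]
      with n hn t
    rw [dist_eq_norm, ← map_sub]
    refine (norm_heisAct_le _ _).trans_lt ?_
    rwa [norm_sub_rev]
  exact this.continuous (Frequently.of_forall fun n => h _ (hu n))

/-- The projection onto the `n`-th spectral subspace of the gauge action. -/
def specProj (c : ℤ) (μ ν : ℝ) (n : ℤ) : QHM c μ ν →L[ℂ] QHM c μ ν :=
  LinearMap.mkContinuous
    { toFun := fun d => ∫ t in (0 : ℝ)..1, ee (-n * t) • qhmGauge c μ ν t d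
      map_add' := fun d d' => by
        have h (d : QHM c μ ν) : IntervalIntegrable (fun t : ℝ => ee (-n * t) • qhmGauge c μ ν t d)
            MeasureTheory.volume 0 1 :=
          ((continuous_ee.comp (by fun_prop)).smul
            (continuous_qhmGauge_apply d)).intervalIntegrable _ _
        simp only [map_add, smul_add]
        exact intervalIntegral.integral_add (h d) (h d')
      map_smul' := fun a d => by
        simp only [map_smul, RingHom.id_apply, smul_comm _ a]
        exact intervalIntegral.integral_smul a _ } 1 fun d => by
    have := intervalIntegral.norm_integral_le_of_norm_le_const (a := 0) (b := 1) (C := ‖d‖)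
      (f := fun t => ee (-n * t) • qhmGauge c μ ν t d) fun t _ => by
        rw [norm_smul, norm_ee, one_mul]; exact norm_heisAct_le _ _
    simpa using this

theorem specProj_apply (n : ℤ) (d : QHM c μ ν) :
    specProj c μ ν n d = ∫ t in (0 : ℝ)..1, ee (-n * t) • qhmGauge c μ ν t d := rfl

theorem norm_specProj_le (n : ℤ) (d : QHM c μ ν) : ‖specProj c μ ν n d‖ ≤ ‖d‖ :=
  ((specProj c μ ν n).le_of_opNorm_le (LinearMap.mkContinuous_norm_le _ zero_le_one _) d).trans
    (one_mul _).le

/-- A coefficient between levels `p` and `q` is multiplied by `e((p - q)t)` under `γ_t`, and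
integration against `e(-nt)` selects `p - q = n`. -/
theorem coef_specProj (n : ℤ) (z w : ℝ × ℝ × ℤ) (d : QHM c μ ν) :
    QHM.coef z w (specProj c μ ν n d) = if z.2.2 - w.2.2 = n then QHM.coef z w d else 0 := by
  rw [specProj_apply, ← ContinuousLinearMap.intervalIntegral_comp_comm]
  · have : ∀ t : ℝ, QHM.coef z w (ee (-n * t) • qhmGauge c μ ν t d) =
        ee ((z.2.2 - w.2.2 - n : ℤ) * t) * QHM.coef z w d := fun t => by
      rw [map_smul, coef_qhmGauge, smul_eq_mul, ← mul_assoc, ← ee_add]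
      congr 2
      push_cast
      ring
    simp only [this]
    rw [intervalIntegral.integral_mul_const, integral_ee_mul]
    simp only [sub_eq_zero, ite_mul, one_mul, zero_mul]
  · exact ((continuous_ee.comp (by fun_prop)).smul
      (continuous_qhmGauge_apply d)).intervalIntegrable _ _

theorem specProj_mem (n : ℤ) (d : QHM c μ ν) : specProj c μ ν n d ∈ qhmSpec c μ ν n := by
  intro t
  refine QHM.ext_coef fun z w => ?_
  rw [coef_qhmGauge, map_smul, smul_eq_mul, coef_specProj]
  split_ifs with h
  · rw [← h]; push_cast; rfl
  · simp

theorem specProj_of_mem {m : ℤ} {d : QHM c μ ν} (hd : d ∈ qhmSpec c μ ν m) (n : ℤ) :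
    specProj c μ ν n d = if m = n then d else 0 := by
  refine QHM.ext_coef fun z w => ?_
  rw [coef_specProj]
  by_cases h : z.2.2 - w.2.2 = m
  · rw [h]; split_ifs <;> simp
  · have := coef_eq_zero_of_mem_qhmSpec hd h
    rw [this]
    split_ifs <;> simp [this]

theorem heisAct_specProj (g : ℝ × ℝ × ℝ) (n : ℤ) (d : QHM c μ ν) :
    heisAct c μ ν g (specProj c μ ν n d) = specProj c μ ν n (heisAct c μ ν g d) := by
  rw [← heisActL_apply, specProj_apply, ← ContinuousLinearMap.intervalIntegral_comp_comm]
  · simp only [map_smul, heisActL_apply, heisAct_qhmGauge]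
    rfl
  · exact ((continuous_ee.comp (by fun_prop)).smul
      (continuous_qhmGauge_apply d)).intervalIntegrable _ _

theorem specProj_mem_qhmSmooth {d : QHM c μ ν} (hd : d ∈ qhmSmooth c μ ν) (n : ℤ) :
    specProj c μ ν n d ∈ qhmSmooth c μ ν := by
  rw [mem_qhmSmooth_iff] at *
  simp only [heisAct_specProj]
  exact ((specProj c μ ν n).restrictScalars ℝ).contDiff.comp hd

theorem heisDer_specProj {d : QHM c μ ν} (hd : d ∈ qhmSmooth c μ ν) (n : ℤ) (i : Fin 3) :
    heisDer c μ ν i (specProj c μ ν n d) = specProj c μ ν n (heisDer c μ ν i d) := by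
  rw [heisDer]
  simp only [heisAct_specProj]
  exact (((specProj c μ ν n).restrictScalars ℝ).hasFDerivAt.comp_hasDerivAt (0 : ℝ)
    (hasDerivAt_heisAct hd i)).deriv

/-- The sign appears because the gauge action runs through the centre backwards. This eigenvalue is
what converts smoothness into decay in the degree. -/
theorem heisDer_two_of_mem {n : ℤ} {d : QHM c μ ν} (hd : d ∈ qhmSpec c μ ν n) :
    heisDer c μ ν 2 d = (-(2 * Real.pi * Complex.I * n) : ℂ) • d := by
  have h : ∀ t : ℝ, heisAct c μ ν (heisCurve 2 t) d = ee (-n * t) • d := fun t => by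
    have := hd (-t)
    rw [qhmGauge, neg_neg] at this
    rw [show heisCurve 2 t = (0, 0, t) from rfl, this]
    congr 2; ring
  rw [heisDer]
  simp only [h]
  have h1 : HasDerivAt (fun t : ℝ => -(n : ℝ) * t) (-n) 0 := by
    simpa using (hasDerivAt_id (0 : ℝ)).const_mul (-(n : ℝ))
  refine (h1.ee_comp.smul_const d).deriv.trans ?_
  rw [mul_zero, ee_zero]
  push_cast
  ring_nf

theorem mul_mem_qhmSpec {m n : ℤ} {d d' : QHM c μ ν} (hd : d ∈ qhmSpec c μ ν m)
    (hd' : d' ∈ qhmSpec c μ ν n) : d * d' ∈ qhmSpec c μ ν (m + n) := fun t => by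
  rw [map_mul, hd t, hd' t, smul_mul_smul_comm, ← ee_add]
  push_cast
  ring_nf

theorem star_mem_qhmSpec {n : ℤ} {d : QHM c μ ν} (hd : d ∈ qhmSpec c μ ν n) :
    star d ∈ qhmSpec c μ ν (-n) := fun t => by
  rw [map_star, hd t, star_smul, star_ee]
  push_cast
  ring_nf

theorem mem_qhmBase_iff {d : QHM c μ ν} : d ∈ qhmBase c μ ν ↔ d ∈ qhmSpec c μ ν 0 := by
  refine forall_congr' fun t => ?_
  rw [Int.cast_zero, zero_mul, ee_zero, one_smul]

theorem isClosed_qhmSpec (n : ℤ) : IsClosed (qhmSpec c μ ν n : Set (QHM c μ ν)) := by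
  have : (qhmSpec c μ ν n : Set (QHM c μ ν)) =
      ⋂ t : ℝ, {d | qhmGauge c μ ν t d = ee (n * t) • d} := by
    ext d; simp [qhmSpec]
  rw [this]
  exact isClosed_iInter fun t => isClosed_eq (continuous_heisAct _) (continuous_const_smul _)

theorem isClosed_qhmBase : IsClosed (qhmBase c μ ν : Set (QHM c μ ν)) := by
  have : (qhmBase c μ ν : Set (QHM c μ ν)) = qhmSpec c μ ν 0 := by
    ext d; exact mem_qhmBase_iff
  rw [this]
  exact isClosed_qhmSpec 0

end Spectral

namespace SmoothQHM

variable {c : ℤ} {μ ν : ℝ}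

/-- The spectral projections of the smooth QHM. -/
def proj (n : ℤ) : SmoothQHM c μ ν →ₗ[ℂ] SmoothQHM c μ ν where
  toFun d := mk (specProj c μ ν n (incl c μ ν d)) (specProj_mem_qhmSmooth d.incl_mem n)
  map_add' d d' := incl_injective (by simp only [map_add, incl_mk])
  map_smul' a d := incl_injective (by simp only [map_smul, incl_mk, RingHom.id_apply])

theorem incl_proj (n : ℤ) (d : SmoothQHM c μ ν) :
    incl c μ ν (proj n d) = specProj c μ ν n (incl c μ ν d) := rfl

theorem der_proj (i : Fin 3) (n : ℤ) (d : SmoothQHM c μ ν) :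
    der i (proj n d) = proj n (der i d) :=
  incl_injective (by rw [incl_der, incl_proj, heisDer_specProj d.incl_mem, incl_proj, incl_der])

theorem wder_proj (w : List (Fin 3)) (n : ℤ) (d : SmoothQHM c μ ν) :
    wder w (proj n d) = proj n (wder w d) := by
  induction w with
  | nil => rfl
  | cons i w ih => rw [wder_cons, ih, der_proj, wder_cons]

theorem proj_der_two (n : ℤ) (d : SmoothQHM c μ ν) :
    proj n (der 2 d) = (-(2 * Real.pi * Complex.I * n) : ℂ) • proj n d :=
  incl_injective (by
    rw [← der_proj, incl_der, map_smul, incl_proj, heisDer_two_of_mem (specProj_mem n _)])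

/-- Applying `∂₃` to a component of degree `n` multiplies its seminorms by `2π|n| ≥ |n|`, so every
power of `|n|` is paid for by one more derivative. -/
theorem exists_seminorm_proj_le (w : List (Fin 3)) (k : ℕ) :
    ∃ p : Seminorm ℂ (SmoothQHM c μ ν), Continuous p ∧
      ∀ (n : ℤ) d, (1 + |(n : ℝ)|) ^ k * seminorm w (proj n d) ≤ p d := by
  induction k with
  | zero =>
    refine ⟨seminorm w, withSeminorms.continuous_seminorm w, fun n d => ?_⟩
    rw [pow_zero, one_mul, seminorm_apply, seminorm_apply, wder_proj, incl_proj]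
    exact norm_specProj_le _ _
  | succ k ih =>
    obtain ⟨p, hp, h⟩ := ih
    refine ⟨p + p.comp (der 2), hp.add (hp.comp (continuous_der 2)), fun n d => ?_⟩
    have h1 := h n d
    have h2 := h n (der 2 d)
    have h3 : |(n : ℝ)| * seminorm w (proj n d) ≤ seminorm w (proj n (der 2 d)) := by
      rw [proj_der_two, map_smul_eq_mul]
      gcongr
      simp only [norm_neg, norm_mul, Complex.norm_ofNat, Complex.norm_real, Complex.norm_I,
        Complex.norm_intCast, Real.norm_eq_abs, abs_of_pos Real.pi_pos, mul_one]
      have := Real.pi_gt_three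
      have h0 := abs_nonneg (n : ℝ)
      nlinarith
    calc (1 + |(n : ℝ)|) ^ (k + 1) * seminorm w (proj n d) =
          (1 + |(n : ℝ)|) ^ k * seminorm w (proj n d) +
            (1 + |(n : ℝ)|) ^ k * (|(n : ℝ)| * seminorm w (proj n d)) := by ring
      _ ≤ p d + (1 + |(n : ℝ)|) ^ k * seminorm w (proj n (der 2 d)) := by gcongr
      _ ≤ p d + p (der 2 d) := by gcongr

theorem exists_seminorm_bound {q : Seminorm ℂ (SmoothQHM c μ ν)} (hq : Continuous q) :
    ∃ (s : Finset (List (Fin 3))) (C : NNReal), ∀ d, q d ≤ C * ∑ w ∈ s, seminorm w d := by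
  obtain ⟨s, C, -, h⟩ := Seminorm.bound_of_continuous withSeminorms q hq
  refine ⟨s, C, fun d => (h d).trans ?_⟩
  rw [smul_apply, NNReal.smul_def, smul_eq_mul]
  gcongr
  have := Seminorm.finset_sup_le_sum (seminorm (c := c) (μ := μ) (ν := ν)) s d
  simpa using this

/-- The spectral components of a smooth element are rapidly decreasing. -/
theorem exists_seminorm_proj_le' {q : Seminorm ℂ (SmoothQHM c μ ν)} (hq : Continuous q) (k : ℕ) :
    ∃ p : Seminorm ℂ (SmoothQHM c μ ν), Continuous p ∧
      ∀ (n : ℤ) d, (1 + |(n : ℝ)|) ^ k * q (proj n d) ≤ p d := by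
  obtain ⟨s, C, h⟩ := exists_seminorm_bound hq
  choose p hp hle using fun w => exists_seminorm_proj_le (c := c) (μ := μ) (ν := ν) w k
  refine ⟨C • ∑ w ∈ s, p w, ?_, fun n d => ?_⟩
  · have : Continuous fun d => (C : ℝ) * ∑ w ∈ s, p w d :=
      continuous_const.mul (continuous_finsetSum _ fun w _ => hp w)
    refine this.congr fun d => ?_
    rw [smul_apply, NNReal.smul_def, smul_eq_mul, sum_apply]
  · rw [smul_apply, NNReal.smul_def, smul_eq_mul, sum_apply]
    calc _ ≤ (1 + |(n : ℝ)|) ^ k * (C * ∑ w ∈ s, seminorm w (proj n d)) := by gcongr; exact h _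
      _ = C * ∑ w ∈ s, (1 + |(n : ℝ)|) ^ k * seminorm w (proj n d) := by
        rw [mul_left_comm, Finset.mul_sum]
      _ ≤ C * ∑ w ∈ s, p w d := by gcongr with w _; exact hle w n d

theorem summable_one_add_abs_sq : Summable fun n : ℤ => ((1 + |(n : ℝ)|) ^ 2)⁻¹ := by
  have h : Summable fun n : ℤ => 1 / (n : ℝ) ^ 2 :=
    Real.summable_one_div_int_pow.2 (by norm_num)
  refine Summable.of_norm_bounded_eventually h ?_
  rw [Filter.eventually_cofinite]
  refine (Set.finite_singleton (0 : ℤ)).subset fun n hn => ?_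
  by_contra h0
  refine hn ?_
  have hn' : (0 : ℝ) < |(n : ℝ)| := abs_pos.2 (Int.cast_ne_zero.2 h0)
  rw [Real.norm_of_nonneg (by positivity), one_div, ← sq_abs (n : ℝ)]
  gcongr
  linarith

/-- Decay of order two gives absolute convergence. The sum is identified through matrix
coefficients, each of which sees exactly one component. -/
theorem hasSum_specProj (d : SmoothQHM c μ ν) :
    HasSum (fun n => specProj c μ ν n (incl c μ ν d)) (incl c μ ν d) := by
  obtain ⟨p, -, hp⟩ := exists_seminorm_proj_le (c := c) (μ := μ) (ν := ν) [] 2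
  have hs : Summable fun n => specProj c μ ν n (incl c μ ν d) := by
    refine Summable.of_norm_bounded (summable_one_add_abs_sq.mul_right (p d)) fun n => ?_
    rw [inv_mul_eq_div, le_div_iff₀ (by positivity), mul_comm]
    exact hp n d
  have : ∑' n, specProj c μ ν n (incl c μ ν d) = incl c μ ν d := by
    refine QHM.ext_coef fun z w => ?_
    rw [ContinuousLinearMap.map_tsum _ hs]
    simp only [coef_specProj]
    rw [tsum_eq_single (z.2.2 - w.2.2) fun n hn => if_neg hn.symm, if_pos rfl]
  exact hs.hasSum_iff.2 this

/-- The projections commute with the generators, so convergence in each seminorm is norm convergence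
for a derivative of `d`. -/
theorem hasSum_proj (d : SmoothQHM c μ ν) : HasSum (fun n => proj n d) d := by
  rw [HasSum, withSeminorms.tendsto_nhds]
  intro w ε hε
  have h := hasSum_specProj (wder w d)
  filter_upwards [(tendsto_iff_norm_sub_tendsto_zero.1 h).eventually (gt_mem_nhds hε)] with s hs
  rw [seminorm_apply, map_sub, map_sub, map_sum, map_sum]
  simpa only [wder_proj, incl_proj] using hs

theorem dense_span_homogeneous :
    Dense (Submodule.span ℂ {d : SmoothQHM c μ ν | ∃ n, incl c μ ν d ∈ qhmSpec c μ ν n} :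
      Set (SmoothQHM c μ ν)) := fun d =>
  mem_closure_of_tendsto (hasSum_proj d) (Eventually.of_forall fun _ =>
    Submodule.sum_mem _ fun n _ => Submodule.subset_span ⟨n, specProj_mem n _⟩)

end SmoothQHM

/-! ### Smooth sections of the line bundles of the quantum Heisenberg manifold -/

/-- A first-order expansion uniform in the parameter `z ∈ K`: the map `g ↦ Φ(g, z) - dΦ(0, z)(g, 0)`
has small derivative near `0`, uniformly on `K` by compactness, and the mean value inequality
applies. It serves to turn pointwise derivatives of sections into derivatives in norm. -/
theorem eventually_norm_sub_fderiv_le {E Z F : Type*} [NormedAddCommGroup E] [NormedSpace ℝ E]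
    [NormedAddCommGroup Z] [NormedSpace ℝ Z] [NormedAddCommGroup F] [NormedSpace ℝ F]
    {Φ : E × Z → F} (hΦ : ContDiff ℝ 1 Φ) {K : Set Z} (hK : IsCompact K) {ε : ℝ} (hε : 0 < ε) :
    ∀ᶠ g in 𝓝 (0 : E), ∀ z ∈ K, ‖Φ (g, z) - Φ (0, z) - fderiv ℝ Φ (0, z) (g, 0)‖ ≤ ε * ‖g‖ := by
  have hc : Continuous (fderiv ℝ Φ) := hΦ.continuous_fderiv one_ne_zero
  have h1 : ∀ᶠ g in 𝓝 (0 : E), ∀ z ∈ K, ‖fderiv ℝ Φ (g, z) - fderiv ℝ Φ (0, z)‖ < ε := by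
    refine hK.eventually_forall_of_forall_eventually fun z _ => ?_
    have : Continuous fun p : E × Z => ‖fderiv ℝ Φ (p.1, p.2) - fderiv ℝ Φ (0, p.2)‖ :=
      ((hc.comp (by fun_prop)).sub (hc.comp (by fun_prop))).norm
    exact this.continuousAt.eventually_lt continuousAt_const (by simpa using hε)
  obtain ⟨δ, hδ, hball⟩ := Metric.eventually_nhds_iff_ball.1 h1
  refine Metric.eventually_nhds_iff_ball.2 ⟨δ, hδ, fun g hg z hz => ?_⟩
  have h2 : ∀ x, HasFDerivAt (fun g => Φ (g, z) - fderiv ℝ Φ (0, z) (g, 0))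
      ((fderiv ℝ Φ (x, z) - fderiv ℝ Φ (0, z)).comp (ContinuousLinearMap.inl ℝ E Z)) x := fun x => by
    have e1 : HasFDerivAt (fun g : E => (g, z)) (ContinuousLinearMap.inl ℝ E Z) x :=
      hasFDerivAt_prodMk_left x z
    have e2 := ((hΦ.differentiable one_ne_zero).differentiableAt (x := (x, z))).hasFDerivAt.comp x e1
    have e3 := ((fderiv ℝ Φ (0, z)).comp (ContinuousLinearMap.inl ℝ E Z)).hasFDerivAt (x := x)
    exact (e2.sub e3).congr_fderiv (by ext; simp)
  have h3 := (convex_ball (0 : E) δ).norm_image_sub_le_of_norm_hasFDerivWithin_le (C := ε)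
    (fun x _ => (h2 x).hasFDerivWithinAt) (fun x hx => ?_) (Metric.mem_ball_self hδ) hg
  · have h0 : fderiv ℝ Φ (0, z) (0, 0) = 0 := map_zero (fderiv ℝ Φ (0, z))
    rw [h0, sub_zero, sub_zero] at h3
    rwa [sub_right_comm]
  · refine (ContinuousLinearMap.opNorm_comp_le _ _).trans ?_
    refine (mul_le_of_le_one_right (norm_nonneg _) ?_).trans (hball x hx z hz).le
    exact ContinuousLinearMap.norm_inl_le_one ℝ E Z

section Sections

/-- Continuous functions of degree `n`, periodic in `y` and quasi-periodic in `x`. -/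
def secSub (c : ℤ) (ν : ℝ) (n : ℤ) : Submodule ℂ (ℝ × ℝ → ℂ) where
  carrier := {f | Continuous f ∧ (∀ x y, f (x, y + 1) = f (x, y)) ∧
    ∀ x y, f (x + 1, y) = ee (-c * n * (y - n * ν)) * f (x, y)}
  add_mem' ha hb := ⟨ha.1.add hb.1, fun x y => by simp [ha.2.1, hb.2.1],
    fun x y => by simp [ha.2.2, hb.2.2, mul_add]⟩
  zero_mem' := ⟨continuous_const, by simp, by simp⟩
  smul_mem' a f hf := ⟨hf.1.const_smul a, fun x y => by simp [hf.2.1],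
    fun x y => by simp [hf.2.2]; ring⟩

variable {c : ℤ} {μ ν : ℝ} {n : ℤ}

/-- The quasi-period is a phase, so `|f|` is periodic in both variables and all suprema may be taken
over the compact unit square. -/
theorem secSub_norm_reduce {f : ℝ × ℝ → ℂ} (hf : f ∈ secSub c ν n) (z : ℝ × ℝ) :
    ∃ z' ∈ (Set.Icc (0 : ℝ) 1 ×ˢ Set.Icc (0 : ℝ) 1), ‖f z‖ = ‖f z'‖ := by
  have h1 : ∀ y, Function.Periodic (fun x => ‖f (x, y)‖) 1 := fun y x => by
    simp only [hf.2.2, norm_mul, norm_ee, one_mul]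
  have h2 : ∀ x, Function.Periodic (fun y => ‖f (x, y)‖) 1 := fun x y => by
    simp only [hf.2.1]
  obtain ⟨x', hx', ex⟩ := (h1 z.2).exists_mem_Ico₀ one_pos z.1
  obtain ⟨y', hy', ey⟩ := (h2 x').exists_mem_Ico₀ one_pos z.2
  exact ⟨(x', y'), ⟨Set.Ico_subset_Icc_self hx', Set.Ico_subset_Icc_self hy'⟩, ex.trans ey⟩

theorem secSub_bounded {f : ℝ × ℝ → ℂ} (hf : f ∈ secSub c ν n) :
    ∃ C, ∀ x y, ‖f (x, y)‖ ≤ C := by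
  obtain ⟨C, hC⟩ := (isCompact_Icc.prod isCompact_Icc :
    IsCompact (Set.Icc (0 : ℝ) 1 ×ˢ Set.Icc (0 : ℝ) 1)).exists_bound_of_continuousOn
    hf.1.continuousOn
  refine ⟨C, fun x y => ?_⟩
  obtain ⟨z', hz', e⟩ := secSub_norm_reduce hf (x, y)
  rw [e]
  exact hC _ hz'

theorem isQHMFun_of_mem_secSub {f : ℝ × ℝ → ℂ} (hf : f ∈ secSub c ν n) :
    IsQHMFun c ν (fun x y p => if p = n then f (x, y) else 0) :=
  IsQHMFun.single (f := fun x y => f (x, y)) hf.1 (secSub_bounded hf) hf.2.1 hf.2.2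

variable (μ) in
/-- A section of degree `n` as an element of the QHM. -/
def secL (c : ℤ) (ν : ℝ) (n : ℤ) : secSub c ν n →ₗ[ℂ] QHM c μ ν where
  toFun f := QHM.ofFun μ (isQHMFun_of_mem_secSub f.2)
  map_add' f g := QHM.ext_coef fun z w => by
    simp only [map_add, QHM.coef_ofFun]
    split_ifs <;> simp
  map_smul' a f := QHM.ext_coef fun z w => by
    simp only [map_smul, QHM.coef_ofFun, RingHom.id_apply]
    split_ifs <;> simp

theorem secL_apply (f : secSub c ν n) : secL μ c ν n f = QHM.ofFun μ (isQHMFun_of_mem_secSub f.2) :=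
  rfl

theorem secL_mem_qhmSpec (f : secSub c ν n) : secL μ c ν n f ∈ qhmSpec c μ ν n :=
  ofFun_single_mem_qhmSpec _

theorem norm_secL_le (f : secSub c ν n) {C : ℝ} (hC : 0 ≤ C) (h : ∀ z, ‖f.1 z‖ ≤ C) :
    ‖secL μ c ν n f‖ ≤ C :=
  QHM.norm_le_of_bound (f := fun x y => f.1 (x, y)) _ hC fun x y => h (x, y)

/-- The action of the Heisenberg group on sections. -/
def secAct (c : ℤ) (μ : ℝ) (n : ℤ) (f : ℝ × ℝ → ℂ) (g : ℝ × ℝ × ℝ) (z : ℝ × ℝ) : ℂ :=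
  ee (-n * (g.2.2 + c * g.2.1 * (z.1 - g.1 - n * μ))) * f (z.1 - g.1, z.2 - g.2.1)

theorem secAct_mem {f : ℝ × ℝ → ℂ} (hf : f ∈ secSub c ν n) (g : ℝ × ℝ × ℝ) :
    secAct c μ n f g ∈ secSub c ν n := by
  have h := (isQHMFun_of_mem_secSub hf).heis g (μ := μ)
  have e : ∀ x y, heisFun c μ g (fun x y p => if p = n then f (x, y) else 0) x y n =
      secAct c μ n f g (x, y) := fun x y => by simp [heisFun, secAct]
  refine ⟨?_, fun x y => ?_, fun x y => ?_⟩
  · simpa only [e] using h.continuous n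
  · simpa only [e] using h.periodic x y n
  · simpa only [e] using h.quasi x y n

theorem heisAct_secL (f : secSub c ν n) (g : ℝ × ℝ × ℝ) :
    heisAct c μ ν g (secL μ c ν n f) = secL μ c ν n ⟨secAct c μ n f.1 g, secAct_mem f.2 g⟩ := by
  rw [secL_apply, heisAct_ofFun, secL_apply]
  refine QHM.ofFun_congr _ _ ?_
  funext x y p
  by_cases h : p = n
  · subst h; simp [heisFun, secAct]
  · simp [heisFun, h]

/-- The generators of the action on smooth sections. -/
def secDer (c : ℤ) (μ : ℝ) (n : ℤ) (f : ℝ × ℝ → ℂ) : Fin 3 → ℝ × ℝ → ℂ :=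
  ![fun z => -fderiv ℝ f z (1, 0),
    fun z => -(2 * Real.pi * Complex.I * n * c * (z.1 - n * μ)) * f z - fderiv ℝ f z (0, 1),
    fun z => -(2 * Real.pi * Complex.I * n) * f z]

theorem contDiff_secDer {f : ℝ × ℝ → ℂ} (hf : ContDiff ℝ ∞ f) (i : Fin 3) :
    ContDiff ℝ ∞ (secDer c μ n f i) := by
  have h : ∀ v, ContDiff ℝ ∞ fun z => fderiv ℝ f z v := fun v =>
    (hf.fderiv_right (by simp)).clm_apply contDiff_const
  have h0 : ContDiff ℝ ∞ fun z : ℝ × ℝ => (z.1 : ℂ) :=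
    Complex.ofRealCLM.contDiff.comp contDiff_fst
  fin_cases i
  · exact (h _).neg
  · exact ((contDiff_const.mul (h0.sub contDiff_const)).neg.mul hf).sub (h _)
  · exact contDiff_const.mul hf

theorem contDiff_secAct {f : ℝ × ℝ → ℂ} (hf : ContDiff ℝ ∞ f) :
    ContDiff ℝ ∞ fun p : (ℝ × ℝ × ℝ) × (ℝ × ℝ) => secAct c μ n f p.1 p.2 := by
  unfold secAct
  refine (contDiff_ee.comp ?_).mul (hf.comp ?_) <;> fun_prop

/-- The left side is the derivative along the line `t ↦ (t • g, z)`, which can also be computed from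
the explicit formula; uniqueness of derivatives compares the two. -/
theorem fderiv_secAct {f : ℝ × ℝ → ℂ} (hf : ContDiff ℝ ∞ f) (g : ℝ × ℝ × ℝ) (z : ℝ × ℝ) :
    fderiv ℝ (fun p : (ℝ × ℝ × ℝ) × (ℝ × ℝ) => secAct c μ n f p.1 p.2) (0, z) (g, 0) =
      g.1 * secDer c μ n f 0 z + g.2.1 * secDer c μ n f 1 z + g.2.2 * secDer c μ n f 2 z := by
  have h1 : HasDerivAt (fun t : ℝ => (t • g, z)) (g, 0) 0 := by
    have : HasDerivAt (fun t : ℝ => t • g) ((1 : ℝ) • g) 0 := (hasDerivAt_id (0 : ℝ)).smul_const g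
    rw [one_smul] at this
    exact this.prodMk (hasDerivAt_const _ _)
  have h2 : HasFDerivAt (fun p : (ℝ × ℝ × ℝ) × (ℝ × ℝ) => secAct c μ n f p.1 p.2)
      (fderiv ℝ (fun p : (ℝ × ℝ × ℝ) × (ℝ × ℝ) => secAct c μ n f p.1 p.2) (0, z))
      ((0 : ℝ) • g, z) := by
    rw [zero_smul]
    exact ((contDiff_secAct hf).differentiable (by simp)).differentiableAt.hasFDerivAt
  have h3 := h2.comp_hasDerivAt (0 : ℝ) h1
  have h4 : HasDerivAt (fun t : ℝ => -(n : ℝ) * (t * g.2.2 + c * (t * g.2.1) *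
      (z.1 - t * g.1 - n * μ))) (-n * (g.2.2 + c * g.2.1 * (z.1 - n * μ))) 0 := by
    have a : ∀ r : ℝ, HasDerivAt (fun t : ℝ => t * r) r 0 := fun r => by
      simpa using (hasDerivAt_id (0 : ℝ)).mul_const r
    have b := (((a g.2.1).const_mul (c : ℝ)).mul (((hasDerivAt_const (0 : ℝ) z.1).sub (a g.1)).sub
      (hasDerivAt_const (0 : ℝ) ((n : ℝ) * μ))))
    refine (((a g.2.2).add b).const_mul (-(n : ℝ))).congr_deriv ?_
    simp
  have h5 : HasDerivAt (fun t : ℝ => (z.1 - t * g.1, z.2 - t * g.2.1)) (-g.1, -g.2.1) 0 := by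
    have a : ∀ r s : ℝ, HasDerivAt (fun t : ℝ => s - t * r) (-r) 0 := fun r s => by
      simpa using ((hasDerivAt_id (0 : ℝ)).mul_const r).const_sub s
    exact (a _ _).prodMk (a _ _)
  have h6 : HasFDerivAt f (fderiv ℝ f z) (z.1 - 0 * g.1, z.2 - 0 * g.2.1) := by
    simpa using (hf.differentiable (by simp)).differentiableAt.hasFDerivAt
  have h7 := h4.ee_comp.mul (h6.comp_hasDerivAt (0 : ℝ) h5)
  have h8 := h3.unique h7
  rw [h8]
  have h9 : ((-g.1, -g.2.1) : ℝ × ℝ) = (-g.1) • (1, 0) + (-g.2.1) • (0, 1) := by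
    ext <;> simp
  rw [h9, map_add, map_smul, map_smul]
  simp [secDer, ee_zero]
  ring

-- Differentiating the quasi-periodicity relation in `y` produces a term from the phase. In the
-- second generator it is cancelled by the change of the factor `x - nμ` under `x ↦ x + 1`.
variable (μ) in
theorem secDer_mem {f : ℝ × ℝ → ℂ} (hf : f ∈ secSub c ν n) (hs : ContDiff ℝ ∞ f) (i : Fin 3) :
    secDer c μ n f i ∈ secSub c ν n := by
  refine ⟨(contDiff_secDer hs i).continuous, fun x y => ?_, fun x y => ?_⟩
  · have hp : ∀ v, fderiv ℝ f (x, y + 1) v = fderiv ℝ f (x, y) v := fun v => by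
      have : (fun z : ℝ × ℝ => f (z + (0, 1))) = f := by
        funext z
        rw [show z + (0, 1) = (z.1, z.2 + 1) by ext <;> simp, hf.2.1]
      conv_rhs => rw [← this]
      rw [fderiv_comp_add_right]
      simp
    fin_cases i <;> simp [secDer, hp, hf.2.1]
  · have hp : ∀ v, fderiv ℝ f (x + 1, y) v = ee (-c * n * (y - n * ν)) * fderiv ℝ f (x, y) v +
        (-(2 * Real.pi * Complex.I * c * n) * v.2) * ee (-c * n * (y - n * ν)) * f (x, y) := fun v => by
      have e : (fun z : ℝ × ℝ => f (z + (1, 0))) =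
          fun z => ee (-c * n * (z.2 - n * ν)) * f z := by
        funext z
        rw [show z + (1, 0) = (z.1 + 1, z.2) by ext <;> simp, hf.2.2]
      have e1 : fderiv ℝ f (x + 1, y) = fderiv ℝ (fun z : ℝ × ℝ => f (z + (1, 0))) (x, y) := by
        rw [fderiv_comp_add_right]; simp
      have hv : HasDerivAt (fun t : ℝ => ((x, y) : ℝ × ℝ) + t • v) v 0 := by
        have := ((hasDerivAt_id (0 : ℝ)).smul_const v).const_add (x, y)
        simpa using this
      have hv2 : HasDerivAt (fun t : ℝ => -(c : ℝ) * n * (y + t * v.2 - n * ν)) (-c * n * v.2) 0 := by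
        have := ((((hasDerivAt_id (0 : ℝ)).mul_const v.2).const_add y).sub_const
          ((n : ℝ) * ν)).const_mul (-(c : ℝ) * n)
        simpa using this
      have d1 : HasFDerivAt f (fderiv ℝ f (x, y)) ((x, y) + (0 : ℝ) • v) := by
        rw [zero_smul, add_zero]
        exact (hs.differentiable (by simp)).differentiableAt.hasFDerivAt
      have d2 : HasFDerivAt (fun z : ℝ × ℝ => f (z + (1, 0))) (fderiv ℝ f (x + 1, y))
          ((x, y) + (0 : ℝ) • v) := by
        rw [zero_smul, add_zero, e1]
        refine DifferentiableAt.hasFDerivAt ?_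
        exact ((hs.differentiable (by simp)).comp (by fun_prop)).differentiableAt
      have d3 := d2.comp_hasDerivAt (0 : ℝ) hv
      have d4 := hv2.ee_comp.mul (d1.comp_hasDerivAt (0 : ℝ) hv)
      rw [e] at d3
      have := d3.unique d4
      rw [this]
      simp
      ring
    fin_cases i
    · simp [secDer, hp]
    · simp [secDer, hp, hf.2.2]
      ring
    · simp [secDer, hf.2.2]
      ring

/-- The remainder of the first-order expansion is again a section of degree `n`. Its operator norm
is therefore bounded by its supremum over the unit square, where the uniform expansion applies. -/
theorem hasHeisDer_secL {f : ℝ × ℝ → ℂ} (hf : f ∈ secSub c ν n) (hs : ContDiff ℝ ∞ f) :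
    HasHeisDer (secL μ c ν n ⟨f, hf⟩)
      fun i => secL μ c ν n ⟨secDer c μ n f i, secDer_mem μ hf hs i⟩ := by
  refine hasHeisDer_of_zero ?_
  rw [hasFDerivAt_iff_isLittleO_nhds_zero, Asymptotics.isLittleO_iff]
  intro ε hε
  have h := eventually_norm_sub_fderiv_le (Φ := fun p : (ℝ × ℝ × ℝ) × (ℝ × ℝ) =>
    secAct c μ n f p.1 p.2) ((contDiff_secAct hs).of_le (by simp))
    (isCompact_Icc.prod isCompact_Icc : IsCompact (Set.Icc (0 : ℝ) 1 ×ˢ Set.Icc (0 : ℝ) 1)) hε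
  filter_upwards [h] with g hg
  set R : secSub c ν n := ⟨secAct c μ n f g, secAct_mem hf g⟩ - ⟨secAct c μ n f 0, secAct_mem hf 0⟩ -
    ((g.1 : ℂ) • ⟨secDer c μ n f 0, secDer_mem μ hf hs 0⟩ +
     (g.2.1 : ℂ) • ⟨secDer c μ n f 1, secDer_mem μ hf hs 1⟩ +
     (g.2.2 : ℂ) • ⟨secDer c μ n f 2, secDer_mem μ hf hs 2⟩) with hR
  have e : heisAct c μ ν (0 + g) (secL μ c ν n ⟨f, hf⟩) - heisAct c μ ν 0 (secL μ c ν n ⟨f, hf⟩) -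
      heisForm 0 (fun i => secL μ c ν n ⟨secDer c μ n f i, secDer_mem μ hf hs i⟩) g =
      secL μ c ν n R := by
    rw [hR, map_sub, map_sub, map_add, map_add, map_smul, map_smul, map_smul, zero_add,
      heisAct_secL, heisAct_secL, heisForm_apply]
    simp only [zero_smul, sub_zero, Complex.coe_smul]
  rw [e]
  refine norm_secL_le _ (by positivity) fun z => ?_
  obtain ⟨z', hz', ez⟩ := secSub_norm_reduce R.2 z
  rw [ez]
  have := hg z' hz'
  rw [fderiv_secAct hs] at this
  exact this

theorem secL_mem_qhmSmooth {f : ℝ × ℝ → ℂ} (hf : f ∈ secSub c ν n) (hs : ContDiff ℝ ∞ f) :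
    secL μ c ν n ⟨f, hf⟩ ∈ qhmSmooth c μ ν :=
  mem_qhmSmooth_of_hasHeisDer
    (S := {d | ∃ (f : ℝ × ℝ → ℂ) (hf : f ∈ secSub c ν n), ContDiff ℝ ∞ f ∧
      d = secL μ c ν n ⟨f, hf⟩})
    (by
      rintro _ ⟨f, hf, hs, rfl⟩
      exact ⟨_, fun i => ⟨_, secDer_mem μ hf hs i, contDiff_secDer hs i, rfl⟩,
        hasHeisDer_secL hf hs⟩) ⟨f, hf, hs, rfl⟩

theorem heisDer_secL {f : ℝ × ℝ → ℂ} (hf : f ∈ secSub c ν n) (hs : ContDiff ℝ ∞ f) (i : Fin 3) :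
    heisDer c μ ν i (secL μ c ν n ⟨f, hf⟩) =
      secL μ c ν n ⟨secDer c μ n f i, secDer_mem μ hf hs i⟩ :=
  (hasHeisDer_secL hf hs).heisDer_eq i

theorem coef_secL (f : secSub c ν n) (z w : ℝ × ℝ × ℤ) :
    QHM.coef z w (secL μ c ν n f) =
      if qhmShift μ ν n z = w then f.1 (z.1, z.2.1) else 0 := by
  rw [secL_apply, QHM.coef_ofFun]
  by_cases h : z.2.2 - w.2.2 = n
  · rw [h, if_pos rfl]
  · rw [if_neg h, ite_self, if_neg]
    rintro rfl
    exact h (by simp [qhmShift])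

theorem secL_mul_apply {m k : ℤ} (f : secSub c ν n) (g : secSub c ν m) (h : secSub c ν k)
    (hk : n + m = k)
    (H : ∀ x y, f.1 (x, y) * g.1 (x - 2 * n * μ, y - 2 * n * ν) = h.1 (x, y)) :
    secL μ c ν n f * secL μ c ν m g = secL μ c ν k h := by
  subst hk
  rw [secL_apply, secL_apply, QHM.ofFun_mul, secL_apply]
  refine QHM.ofFun_congr _ _ ?_
  funext x y p
  rw [qhmMul, finsum_eq_single _ n (fun q hq => by simp [hq])]
  by_cases h : p = n + m
  · subst h
    simp [← H]
  · rw [if_neg h, if_pos rfl, if_neg (fun h' => h (by linarith)), mul_zero]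

theorem star_secL_apply {m : ℤ} (f : secSub c ν n) (g : secSub c ν m) (hm : m = -n)
    (H : ∀ x y, star (f.1 (x + 2 * n * μ, y + 2 * n * ν)) = g.1 (x, y)) :
    star (secL μ c ν n f) = secL μ c ν m g := by
  subst hm
  rw [secL_apply, QHM.ofFun_star, secL_apply]
  refine QHM.ofFun_congr _ _ ?_
  funext x y p
  rw [qhmStar]
  by_cases h : p = -n
  · subst h
    simp [← H]
  · rw [if_neg h, if_neg (fun h' => h (by linarith)), star_zero]

end Sections

/-! ### Sections supported in cylinders -/

section Cyl

/-- Smooth `1`-periodic functions that vanish near `-σ + ℤ`. -/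
def cylSub (σ : ℝ) : Submodule ℂ (ℝ → ℂ) where
  carrier := {a | ContDiff ℝ ∞ a ∧ (∀ x, a (x + 1) = a x) ∧
    ∀ k : ℤ, ∀ᶠ x in 𝓝 ((k : ℝ) - σ), a x = 0}
  add_mem' ha hb := ⟨ha.1.add hb.1, fun x => by simp [ha.2.1, hb.2.1], fun k => by
    filter_upwards [ha.2.2 k, hb.2.2 k] with x h1 h2; simp [h1, h2]⟩
  zero_mem' := ⟨contDiff_const, by simp, fun k => Eventually.of_forall fun _ => rfl⟩
  smul_mem' z a ha := ⟨ha.1.const_smul z, fun x => by simp [ha.2.1], fun k => by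
    filter_upwards [ha.2.2 k] with x h1; simp [h1]⟩

variable {σ : ℝ}

/-- The function `⌊x + σ⌋` is locally constant off `-σ + ℤ`, and near that set `a` vanishes.
Products of `a` with smooth expressions in the floor are therefore smooth. -/
theorem cylSub_eventually {a : ℝ → ℂ} (ha : a ∈ cylSub σ) (x : ℝ) :
    ∀ᶠ x' in 𝓝 x, a x' = 0 ∨ ⌊x' + σ⌋ = ⌊x + σ⌋ := by
  by_cases h : (⌊x + σ⌋ : ℝ) = x + σ
  · have := ha.2.2 ⌊x + σ⌋
    rw [h, add_sub_cancel_right] at this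
    filter_upwards [this] with x' hx' using Or.inl hx'
  · have h1 : (⌊x + σ⌋ : ℝ) < x + σ := lt_of_le_of_ne (Int.floor_le _) h
    have hc : ContinuousAt (fun x' => x' + σ) x := by fun_prop
    filter_upwards [hc.tendsto.eventually_const_lt h1, hc.tendsto.eventually_lt_const (Int.lt_floor_add_one _)]
      with x' h2 h3
    exact Or.inr (Int.floor_eq_iff.2 ⟨h2.le, h3⟩)

/-- The derivative on `cylSub`. -/
def cylDeriv (a : cylSub σ) : cylSub σ :=
  ⟨deriv a.1, (contDiff_infty_iff_deriv.1 a.2.1).2, fun x => by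
    rw [← deriv_comp_add_const]
    congr 1
    exact funext fun t => a.2.2.1 t, fun k => by
    filter_upwards [(a.2.2.2 k).eventually_nhds] with x hx
    have : a.1 =ᶠ[𝓝 x] fun _ => 0 := hx
    rw [this.deriv_eq, deriv_const]⟩

/-- Multiplication by the coordinate `x - ⌊x + σ⌋` on `cylSub`. -/
def cylCoord (a : cylSub σ) : cylSub σ :=
  ⟨fun x => ((x - ⌊x + σ⌋ : ℝ) : ℂ) * a.1 x, contDiff_iff_contDiffAt.2 fun x => by
    have h : (fun x' : ℝ => ((x' - ⌊x' + σ⌋ : ℝ) : ℂ) * a.1 x') =ᶠ[𝓝 x]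
        fun x' : ℝ => ((x' - ⌊x + σ⌋ : ℝ) : ℂ) * a.1 x' := by
      filter_upwards [cylSub_eventually a.2 x] with x' hx'
      rcases hx' with h | h
      · simp [h]
      · rw [h]
    refine ContDiffAt.congr_of_eventuallyEq ?_ h
    exact ((Complex.ofRealCLM.contDiff.comp (contDiff_id.sub contDiff_const)).mul
      a.2.1).contDiffAt, fun x => by
    beta_reduce
    rw [a.2.2.1, show x + 1 + σ = x + σ + 1 by ring, Int.floor_add_one]
    push_cast
    ring_nf, fun k => by
    filter_upwards [a.2.2.2 k] with x hx
    rw [hx, mul_zero]⟩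

/-- The section of degree `n` that is trivialized by `a` on the cylinder. -/
def cylFun (c : ℤ) (ν : ℝ) (n : ℤ) (σ : ℝ) (a : ℝ → ℂ) (z : ℝ × ℝ) : ℂ :=
  a z.1 * ee (-c * n * ⌊z.1 + σ⌋ * (z.2 - n * ν))

variable {c : ℤ} {μ ν : ℝ} {n : ℤ}

theorem cylFun_eventuallyEq {a : ℝ → ℂ} (ha : a ∈ cylSub σ) (z : ℝ × ℝ) :
    cylFun c ν n σ a =ᶠ[𝓝 z] fun z' => a z'.1 * ee (-c * n * ⌊z.1 + σ⌋ * (z'.2 - n * ν)) := by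
  have := (continuous_fst (X := ℝ) (Y := ℝ)).continuousAt (x := z) |>.eventually
    (cylSub_eventually ha z.1)
  filter_upwards [this] with z' hz'
  rcases hz' with h | h
  · simp [cylFun, h]
  · rw [cylFun, h]

theorem contDiff_cylFun {a : ℝ → ℂ} (ha : a ∈ cylSub σ) : ContDiff ℝ ∞ (cylFun c ν n σ a) := by
  refine contDiff_iff_contDiffAt.2 fun z => ?_
  refine ContDiffAt.congr_of_eventuallyEq ?_ (cylFun_eventuallyEq ha z)
  refine ContDiff.contDiffAt ?_
  exact (ha.1.comp contDiff_fst).mul (contDiff_ee.comp (by fun_prop))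

theorem cylFun_mem {a : ℝ → ℂ} (ha : a ∈ cylSub σ) : cylFun c ν n σ a ∈ secSub c ν n := by
  refine ⟨(contDiff_cylFun ha).continuous, fun x y => ?_, fun x y => ?_⟩
  · simp only [cylFun]
    -- The shift `y ↦ y + 1` changes the argument of the phase by an integer.
    rw [show -(c : ℝ) * n * ⌊x + σ⌋ * (y + 1 - n * ν) =
      -c * n * ⌊x + σ⌋ * (y - n * ν) + ((-c * n * ⌊x + σ⌋ : ℤ) : ℝ) by push_cast; ring,
      ee_add, ee_intCast, mul_one]
  · simp only [cylFun]
    rw [ha.2.1, show x + 1 + σ = x + σ + 1 by ring, Int.floor_add_one, mul_left_comm, ← ee_add]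
    push_cast
    ring_nf

theorem fderiv_cylFun {a : ℝ → ℂ} (ha : a ∈ cylSub σ) (z v : ℝ × ℝ) :
    fderiv ℝ (cylFun c ν n σ a) z v = v.1 * cylFun c ν n σ (deriv a) z +
      v.2 * (-(2 * Real.pi * Complex.I * c * n * ⌊z.1 + σ⌋) * cylFun c ν n σ a z) := by
  have hv : HasDerivAt (fun t : ℝ => z + t • v) v 0 := by
    have := ((hasDerivAt_id (0 : ℝ)).smul_const v).const_add z
    simpa using this
  have h0 : HasFDerivAt (cylFun c ν n σ a) (fderiv ℝ (cylFun c ν n σ a) z) (z + (0 : ℝ) • v) := by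
    rw [zero_smul, add_zero]
    exact ((contDiff_cylFun ha).differentiable (by simp)).differentiableAt.hasFDerivAt
  have h1 := h0.comp_hasDerivAt (0 : ℝ) hv
  have h2 : HasDerivAt (fun t : ℝ => z.1 + t * v.1) v.1 0 := by
    simpa using ((hasDerivAt_id (0 : ℝ)).mul_const v.1).const_add z.1
  have h3 : HasDerivAt (fun t : ℝ => -(c : ℝ) * n * ⌊z.1 + σ⌋ * (z.2 + t * v.2 - n * ν))
      (-c * n * ⌊z.1 + σ⌋ * v.2) 0 := by
    have := ((((hasDerivAt_id (0 : ℝ)).mul_const v.2).const_add z.2).sub_const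
      ((n : ℝ) * ν)).const_mul (-(c : ℝ) * n * ⌊z.1 + σ⌋)
    simpa using this
  have h4 : HasDerivAt a (deriv a z.1) (z.1 + 0 * v.1) := by
    rw [zero_mul, add_zero]
    exact (ha.1.differentiable (by simp)).differentiableAt.hasDerivAt
  have h5 := (h4.scomp (0 : ℝ) h2).mul h3.ee_comp
  have hc : ContinuousAt (fun t : ℝ => z + t • v) 0 := hv.continuousAt
  have h6 : ∀ᶠ t : ℝ in 𝓝 0, cylFun c ν n σ a (z + t • v) =
      a (z.1 + t * v.1) * ee (-c * n * ⌊z.1 + σ⌋ * (z.2 + t * v.2 - n * ν)) := by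
    have hz := cylFun_eventuallyEq (c := c) (ν := ν) (n := n) ha z
    have := hc.eventually (p := fun z' => cylFun c ν n σ a z' =
      a z'.1 * ee (-c * n * ⌊z.1 + σ⌋ * (z'.2 - n * ν))) (by beta_reduce; rw [zero_smul, add_zero]; exact hz)
    simpa using this
  have h7 := h1.unique (h5.congr_of_eventuallyEq h6)
  rw [h7]
  simp [cylFun, Function.comp]
  ring

/-- The sections `cylFun` as elements of the smooth QHM. -/
def cyl (μ : ℝ) (c : ℤ) (ν : ℝ) (n : ℤ) (σ : ℝ) : cylSub σ →ₗ[ℂ] SmoothQHM c μ ν where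
  toFun a := SmoothQHM.mk (secL μ c ν n ⟨cylFun c ν n σ a.1, cylFun_mem a.2⟩)
    (secL_mem_qhmSmooth _ (contDiff_cylFun a.2))
  map_add' a b := SmoothQHM.incl_injective (by
    rw [map_add, SmoothQHM.incl_mk, SmoothQHM.incl_mk, SmoothQHM.incl_mk, ← map_add]
    congr 1
    ext z
    exact add_mul _ _ _)
  map_smul' r a := SmoothQHM.incl_injective (by
    rw [map_smul, SmoothQHM.incl_mk, SmoothQHM.incl_mk, ← map_smul]
    congr 1
    ext z
    exact mul_assoc _ _ _)

theorem incl_cyl (a : cylSub σ) : SmoothQHM.incl c μ ν (cyl μ c ν n σ a) =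
    secL μ c ν n ⟨cylFun c ν n σ a.1, cylFun_mem a.2⟩ := rfl

theorem incl_cyl_mem (a : cylSub σ) :
    SmoothQHM.incl c μ ν (cyl μ c ν n σ a) ∈ qhmSpec c μ ν n := secL_mem_qhmSpec _

theorem der_zero_cyl (a : cylSub σ) :
    SmoothQHM.der 0 (cyl μ c ν n σ a) = -cyl μ c ν n σ (cylDeriv a) := by
  refine SmoothQHM.incl_injective ?_
  rw [SmoothQHM.incl_der, incl_cyl, heisDer_secL _ (contDiff_cylFun a.2), ← map_neg, incl_cyl]
  congr 1
  ext z
  simp only [secDer, Matrix.cons_val_zero, fderiv_cylFun a.2]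
  simp [cylDeriv, cylFun]

/-- The `y`-derivative of the phase replaces the unbounded coordinate `x` by `x - ⌊x + σ⌋`, which is
periodic. One factor `n` is the degree and a second one comes from `nμ`, so each `∂₂` costs `n²`. -/
theorem der_one_cyl (a : cylSub σ) :
    SmoothQHM.der 1 (cyl μ c ν n σ a) = (-(2 * Real.pi * Complex.I * c) * n : ℂ) •
      (cyl μ c ν n σ (cylCoord a) - (n * μ : ℂ) • cyl μ c ν n σ a) := by
  refine SmoothQHM.incl_injective ?_
  rw [SmoothQHM.incl_der, incl_cyl, heisDer_secL _ (contDiff_cylFun a.2), ← map_smul (cyl μ c ν n σ),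
    ← map_sub (cyl μ c ν n σ), ← map_smul (cyl μ c ν n σ), incl_cyl]
  congr 1
  ext z
  simp only [secDer, Matrix.cons_val_one, fderiv_cylFun a.2, Matrix.cons_val_zero]
  simp [cylCoord, cylFun]
  ring

theorem der_two_cyl (a : cylSub σ) :
    SmoothQHM.der 2 (cyl μ c ν n σ a) = (-(2 * Real.pi * Complex.I) * n : ℂ) • cyl μ c ν n σ a := by
  refine SmoothQHM.incl_injective ?_
  rw [SmoothQHM.incl_der, heisDer_two_of_mem (incl_cyl_mem a), map_smul]
  congr 1
  ring

theorem cylSub_bounded {a : ℝ → ℂ} (ha : a ∈ cylSub σ) : ∃ C, 0 ≤ C ∧ ∀ x, ‖a x‖ ≤ C := by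
  obtain ⟨C, hC⟩ := (isCompact_Icc : IsCompact (Set.Icc (0 : ℝ) 1)).exists_bound_of_continuousOn
    ha.1.continuous.continuousOn
  have hp : Function.Periodic a 1 := ha.2.1
  refine ⟨C, (norm_nonneg _).trans (hC 0 (by simp)), fun x => ?_⟩
  obtain ⟨x', hx', e⟩ := hp.exists_mem_Ico₀ one_pos x
  rw [e]
  exact hC _ (Set.Ico_subset_Icc_self hx')

variable (σ c μ ν) in
/-- Families of sections, indexed by the degree, with polynomial coefficients of degree at
most `K`. -/
def polyFam (K : ℕ) : Submodule ℂ (ℤ → SmoothQHM c μ ν) :=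
  Submodule.span ℂ {F | ∃ (m : ℕ) (a : cylSub σ), m ≤ K ∧
    F = fun n : ℤ => (n : ℂ) ^ m • cyl μ c ν n σ a}

theorem polyFam_bound {K : ℕ} {F : ℤ → SmoothQHM c μ ν} (hF : F ∈ polyFam σ c μ ν K) :
    ∃ C : ℝ, ∀ n, ‖SmoothQHM.incl c μ ν (F n)‖ ≤ C * (1 + |(n : ℝ)|) ^ K := by
  induction hF using Submodule.span_induction with
  | mem F hF =>
    obtain ⟨m, a, hm, rfl⟩ := hF
    obtain ⟨C, hC, h⟩ := cylSub_bounded a.2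
    refine ⟨C, fun n => ?_⟩
    rw [map_smul, norm_smul, norm_pow, Complex.norm_intCast, mul_comm]
    have h0 := abs_nonneg (n : ℝ)
    gcongr
    · refine norm_secL_le _ hC fun z => ?_
      change ‖cylFun c ν n σ a.1 z‖ ≤ C
      rw [cylFun, norm_mul, norm_ee, mul_one]
      exact h _
    · calc |(n : ℝ)| ^ m ≤ (1 + |(n : ℝ)|) ^ m := by gcongr; linarith
        _ ≤ _ := pow_le_pow_right₀ (by linarith) hm
  | zero => exact ⟨0, fun n => by simp⟩
  | add F G _ _ hF hG =>
    obtain ⟨C, hC⟩ := hF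
    obtain ⟨C', hC'⟩ := hG
    refine ⟨C + C', fun n => ?_⟩
    rw [Pi.add_apply, map_add, add_mul]
    exact (norm_add_le _ _).trans (add_le_add (hC n) (hC' n))
  | smul r F _ hF =>
    obtain ⟨C, hC⟩ := hF
    refine ⟨‖r‖ * C, fun n => ?_⟩
    rw [Pi.smul_apply, map_smul, norm_smul, mul_assoc]
    gcongr
    exact hC n

/-- The growth in the degree that is caused by a derivative. -/
def derWeight : Fin 3 → ℕ := ![0, 2, 1]

/-- The generators act on the trivializing function by operations that do not involve `n`; the
degree enters only through polynomial coefficients. Constants uniform in `n` thus survive iteration.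
-/
theorem der_polyFam (i : Fin 3) {K : ℕ} {F : ℤ → SmoothQHM c μ ν} (hF : F ∈ polyFam σ c μ ν K) :
    (fun n => SmoothQHM.der i (F n)) ∈ polyFam σ c μ ν (derWeight i + K) := by
  induction hF using Submodule.span_induction with
  | mem F hF =>
    obtain ⟨m, a, hm, rfl⟩ := hF
    have key : ∀ (k : ℕ) (b : cylSub σ), k ≤ derWeight i + K →
        (fun n : ℤ => (n : ℂ) ^ k • cyl μ c ν n σ b) ∈ polyFam σ c μ ν (derWeight i + K) :=
      fun k b hk => Submodule.subset_span ⟨k, b, hk, rfl⟩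
    fin_cases i
    · have : (fun n : ℤ => SmoothQHM.der 0 ((n : ℂ) ^ m • cyl μ c ν n σ a)) =
          -fun n : ℤ => (n : ℂ) ^ m • cyl μ c ν n σ (cylDeriv a) := by
        funext n
        rw [map_smul, der_zero_cyl, smul_neg]
        rfl
      exact this ▸ neg_mem (key m _ (by simp [derWeight, hm]))
    · have : (fun n : ℤ => SmoothQHM.der 1 ((n : ℂ) ^ m • cyl μ c ν n σ a)) =
          (-(2 * Real.pi * Complex.I * c) : ℂ) •
            ((fun n : ℤ => (n : ℂ) ^ (m + 1) • cyl μ c ν n σ (cylCoord a)) -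
              (μ : ℂ) • fun n : ℤ => (n : ℂ) ^ (m + 2) • cyl μ c ν n σ a) := by
        funext n
        rw [map_smul, der_one_cyl]
        simp only [Pi.smul_apply, Pi.sub_apply]
        module
      exact this ▸ Submodule.smul_mem _ _ (sub_mem (key _ _ (by simp [derWeight]; omega))
        (Submodule.smul_mem _ _ (key _ _ (by simp [derWeight]; omega))))
    · have : (fun n : ℤ => SmoothQHM.der 2 ((n : ℂ) ^ m • cyl μ c ν n σ a)) =
          (-(2 * Real.pi * Complex.I) : ℂ) •
            (fun n : ℤ => (n : ℂ) ^ (m + 1) • cyl μ c ν n σ a) := by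
        funext n
        rw [map_smul, der_two_cyl]
        simp only [Pi.smul_apply]
        module
      exact this ▸ Submodule.smul_mem _ _ (key _ _ (by simp [derWeight]; omega))
  | zero =>
    have : (fun n => SmoothQHM.der i ((0 : ℤ → SmoothQHM c μ ν) n)) = 0 := by
      funext n; exact map_zero (SmoothQHM.der i)
    rw [this]
    exact zero_mem _
  | add F G _ _ hF hG =>
    have : (fun n => SmoothQHM.der i ((F + G) n)) =
        (fun n => SmoothQHM.der i (F n)) + fun n => SmoothQHM.der i (G n) := by
      funext n; exact map_add _ _ _
    exact this ▸ add_mem hF hG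
  | smul r F _ hF =>
    have : (fun n => SmoothQHM.der i ((r • F) n)) = r • fun n => SmoothQHM.der i (F n) := by
      funext n; exact map_smul (SmoothQHM.der i) r (F n)
    exact this ▸ Submodule.smul_mem _ _ hF

theorem wder_cyl_bound (w : List (Fin 3)) (a : cylSub σ) :
    ∃ C : ℝ, ∀ n, ‖SmoothQHM.incl c μ ν (SmoothQHM.wder w (cyl μ c ν n σ a))‖ ≤
      C * (1 + |(n : ℝ)|) ^ (w.map derWeight).sum := by
  refine polyFam_bound (σ := σ) (F := fun n => SmoothQHM.wder w (cyl μ c ν n σ a)) ?_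
  induction w with
  | nil => exact Submodule.subset_span ⟨0, a, le_rfl, funext fun n => by simp⟩
  | cons i w ih => exact der_polyFam i ih

/-! ### A partition of unity on the circle -/

/-- A smooth periodic function that vanishes near `ℤ` and is `1` near `1 / 2 + ℤ`. -/
def circleStep (x : ℝ) : ℝ := Real.smoothTransition (1 / 2 - Real.cos (2 * Real.pi * x))

theorem contDiff_comp_cos (r s : ℝ) : ContDiff ℝ ∞
    fun x : ℝ => Real.smoothTransition (r + s * Real.cos (2 * Real.pi * x)) :=
  Real.smoothTransition.contDiff.comp
    (contDiff_const.add (contDiff_const.mul (Real.contDiff_cos.comp (by fun_prop))))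

theorem cos_two_pi_add_one (x : ℝ) :
    Real.cos (2 * Real.pi * (x + 1)) = Real.cos (2 * Real.pi * x) := by
  rw [mul_add, mul_one, Real.cos_add_two_pi]

theorem cos_two_pi_int (k : ℤ) : Real.cos (2 * Real.pi * k) = 1 := by
  rw [mul_comm]; exact Real.cos_int_mul_two_pi k

theorem cos_two_pi_int_sub_half (k : ℤ) : Real.cos (2 * Real.pi * (k - 1 / 2)) = -1 := by
  rw [show 2 * Real.pi * (k - 1 / 2) = k * (2 * Real.pi) - Real.pi by ring]
  exact Real.cos_int_mul_two_pi_sub_pi k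

/-- The two shifts of the cylinders that cover the torus. -/
def cylShift : Fin 2 → ℝ := ![0, 1 / 2]

/-- The two weights `sin` and `cos` of `circleStep`. -/
def cylWeight : Fin 2 → ℝ → ℝ :=
  ![fun x => Real.sin (Real.pi / 2 * circleStep x), fun x => Real.cos (Real.pi / 2 * circleStep x)]

/-- Cut-off functions that are `1` on the supports of the weights. -/
def cylCut : Fin 2 → ℝ → ℝ :=
  ![fun x => Real.smoothTransition (3 + (-4) * Real.cos (2 * Real.pi * x)),
    fun x => Real.smoothTransition (3 + 4 * Real.cos (2 * Real.pi * x))]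

theorem contDiff_circleStep : ContDiff ℝ ∞ circleStep := by
  have := contDiff_comp_cos (1 / 2) (-1)
  have e : circleStep = fun x => Real.smoothTransition (1 / 2 + -1 * Real.cos (2 * Real.pi * x)) := by
    funext x
    rw [circleStep, neg_one_mul, sub_eq_add_neg]
  rwa [e]

theorem circleStep_add_one (x : ℝ) : circleStep (x + 1) = circleStep x := by
  rw [circleStep, circleStep, cos_two_pi_add_one]

theorem sum_cylWeight_sq (x : ℝ) : ∑ i, cylWeight i x ^ 2 = 1 := by
  simp [cylWeight, Fin.sum_univ_two]

/-- Near integers the step is `0` and the sine vanishes; near half-integers the step is `1` and the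
cosine vanishes. Each weight thus lives on its own cylinder. -/
theorem cylWeight_mem (i : Fin 2) : (fun x => (cylWeight i x : ℂ)) ∈ cylSub (cylShift i) := by
  have hc : Continuous fun x : ℝ => Real.cos (2 * Real.pi * x) := by fun_prop
  refine ⟨Complex.ofRealCLM.contDiff.comp ?_, fun x => ?_, fun k => ?_⟩
  · have : ContDiff ℝ ∞ fun x => Real.pi / 2 * circleStep x := contDiff_const.mul contDiff_circleStep
    fin_cases i
    · exact Real.contDiff_sin.comp this
    · exact Real.contDiff_cos.comp this
  · fin_cases i <;> simp [cylWeight, circleStep_add_one]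
  · fin_cases i
    · have h0 : 1 / 2 < Real.cos (2 * Real.pi * ((k : ℝ) - cylShift 0)) := by
        simp only [cylShift, Matrix.cons_val_zero, sub_zero, cos_two_pi_int]; norm_num
      filter_upwards [(hc.tendsto _).eventually_const_lt h0] with x hx
      have : circleStep x = 0 := Real.smoothTransition.zero_of_nonpos (by linarith)
      simp [cylWeight, this]
    · have h0 : Real.cos (2 * Real.pi * ((k : ℝ) - cylShift 1)) < - (1 / 2) := by
        simp only [cylShift, Matrix.cons_val_one, cos_two_pi_int_sub_half, Matrix.cons_val_fin_one]
        norm_num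
      filter_upwards [(hc.tendsto _).eventually_lt_const h0] with x hx
      have : circleStep x = 1 := Real.smoothTransition.one_of_one_le (by linarith)
      simp [cylWeight, this]

theorem cylCut_mem (i : Fin 2) (r : ℝ) :
    (fun x => (cylCut i (x + r) : ℂ)) ∈ cylSub (cylShift i + r) := by
  have hc : Continuous fun x : ℝ => Real.cos (2 * Real.pi * (x + r)) := by fun_prop
  refine ⟨Complex.ofRealCLM.contDiff.comp ?_, fun x => ?_, fun k => ?_⟩
  · have h : ContDiff ℝ ∞ fun x : ℝ => x + r := by fun_prop
    fin_cases i
    · exact (contDiff_comp_cos 3 (-4)).comp h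
    · exact (contDiff_comp_cos 3 4).comp h
  · beta_reduce
    rw [add_right_comm]
    fin_cases i
    · simp only [cylCut, Fin.zero_eta, Matrix.cons_val_zero, cos_two_pi_add_one]
    · simp only [cylCut, Fin.mk_one, Matrix.cons_val_one, Matrix.cons_val_fin_one,
        cos_two_pi_add_one]
  · fin_cases i
    · have h0 : 3 / 4 < Real.cos (2 * Real.pi * ((k : ℝ) - (cylShift 0 + r) + r)) := by
        rw [show (k : ℝ) - (cylShift 0 + r) + r = k by simp [cylShift], cos_two_pi_int]; norm_num
      filter_upwards [(hc.tendsto _).eventually_const_lt h0] with x hx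
      have : cylCut 0 (x + r) = 0 := Real.smoothTransition.zero_of_nonpos (by linarith)
      simp [this]
    · have h0 : Real.cos (2 * Real.pi * ((k : ℝ) - (cylShift 1 + r) + r)) < - (3 / 4) := by
        rw [show (k : ℝ) - (cylShift 1 + r) + r = k - 1 / 2 by simp [cylShift]; ring,
          cos_two_pi_int_sub_half]
        norm_num
      filter_upwards [(hc.tendsto _).eventually_lt_const h0] with x hx
      have : cylCut 1 (x + r) = 0 := Real.smoothTransition.zero_of_nonpos (by linarith)
      simp [this]

/-- The sine weight is supported where `cos(2πx) ≤ 1/2`, so that `3 - 4cos(2πx) ≥ 1`; the cosine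
weight where `cos(2πx) ≥ -1/2`, so that `3 + 4cos(2πx) ≥ 1`. There the cut-off equals `1`. -/
theorem cylWeight_mul_cylCut (i : Fin 2) (x : ℝ) : cylWeight i x * cylCut i x = cylWeight i x := by
  fin_cases i
  · simp only [Fin.zero_eta, cylWeight, cylCut, Matrix.cons_val_zero]
    by_cases h : Real.cos (2 * Real.pi * x) ≤ 1 / 2
    · rw [Real.smoothTransition.one_of_one_le (by linarith), mul_one]
    · rw [circleStep, Real.smoothTransition.zero_of_nonpos
        (show 1 / 2 - Real.cos (2 * Real.pi * x) ≤ 0 by linarith)]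
      simp
  · simp only [Fin.mk_one, cylWeight, cylCut, Matrix.cons_val_one, Matrix.cons_val_fin_one]
    by_cases h : -(1 / 2) ≤ Real.cos (2 * Real.pi * x)
    · rw [Real.smoothTransition.one_of_one_le (by linarith), mul_one]
    · rw [circleStep, Real.smoothTransition.one_of_one_le
        (show 1 ≤ 1 / 2 - Real.cos (2 * Real.pi * x) by linarith)]
      simp

/-! ### The frames -/

variable (c μ ν) in
/-- The frame of the module of degree `n`. -/
def frame (n : ℤ) (i : Fin 2) : SmoothQHM c μ ν :=
  cyl μ c ν n (cylShift i) ⟨_, cylWeight_mem i⟩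

variable (c μ ν) in
/-- The elements of degree `1` by which the frames of successive degrees differ. -/
def frameStep (n : ℕ) (i : Fin 2) : SmoothQHM c μ ν :=
  cyl μ c ν 1 (cylShift i + 2 * n * μ) ⟨_, cylCut_mem i (2 * n * μ)⟩

theorem incl_frame_mem (n : ℤ) (i : Fin 2) :
    SmoothQHM.incl c μ ν (frame c μ ν n i) ∈ qhmSpec c μ ν n := incl_cyl_mem _

theorem incl_frameStep_mem (n : ℕ) (i : Fin 2) :
    SmoothQHM.incl c μ ν (frameStep c μ ν n i) ∈ qhmSpec c μ ν 1 := incl_cyl_mem _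

/-- A left factor of degree `n` translates the right factor by `2nμ` in `x`, which undoes the shift
in `frameStep`. Both factors are then trivialized on the same cylinder, where their phases combine
to the one of degree `n + 1` and the cut-off does not alter the weight. -/
theorem frame_mul_frameStep (n : ℕ) (i : Fin 2) :
    frame c μ ν n i * frameStep c μ ν n i = frame c μ ν (n + 1 : ℕ) i := by
  refine SmoothQHM.incl_injective ?_
  rw [map_mul, frame, frameStep, frame, incl_cyl, incl_cyl, incl_cyl]
  refine secL_mul_apply _ _ _ (by push_cast; ring) fun x y => ?_
  simp only [cylFun, Int.cast_natCast, sub_add_cancel]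
  rw [show x - 2 * n * μ + (cylShift i + 2 * n * μ) = x + cylShift i by ring,
    mul_mul_mul_comm, ← ee_add, ← Complex.ofReal_mul, cylWeight_mul_cylCut]
  push_cast
  ring_nf

theorem secL_one : secL μ c ν 0 ⟨fun _ => 1, continuous_const, by simp, by simp [ee_zero]⟩ = 1 := by
  refine QHM.ext_coef fun z w => ?_
  rw [coef_secL, QHM.coef_apply, map_one, one_apply_eq_self]
  have : qhmShift μ ν 0 z = z := by ext <;> simp [qhmShift]
  rw [this]
  split_ifs with h
  · rw [h, lp.single_apply_self]
  · rw [lp.single_apply_ne _ _ _ h]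

variable (μ) in
theorem starSec_mem {f : ℝ × ℝ → ℂ} (hf : f ∈ secSub c ν n) :
    (fun z : ℝ × ℝ => star (f (z.1 + 2 * n * μ, z.2 + 2 * n * ν))) ∈ secSub c ν (-n) := by
  have h := (isQHMFun_of_mem_secSub hf).star (μ := μ)
  have e : ∀ x y, qhmStar μ ν (fun x y p => if p = n then f (x, y) else 0) x y (-n) =
      star (f (x + 2 * n * μ, y + 2 * n * ν)) := fun x y => by simp [qhmStar]
  refine ⟨?_, fun x y => ?_, fun x y => ?_⟩
  · simpa only [e] using h.continuous (-n)
  · simpa only [e] using h.periodic x y (-n)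
  · simpa only [e] using h.quasi x y (-n)

/-- Each summand has degree zero and is the function `|cylFun|²`, in which the phase disappears;
what remains is the sum of the squared weights. -/
theorem sum_frame_mul_star (n : ℤ) : ∑ i, frame c μ ν n i * star (frame c μ ν n i) = 1 := by
  refine SmoothQHM.incl_injective ?_
  rw [map_sum, map_one, ← secL_one]
  have h : ∀ i, ∃ f : secSub c ν 0, (∀ z, f.1 z = ((cylWeight i z.1 ^ 2 : ℝ) : ℂ)) ∧
      SmoothQHM.incl c μ ν (frame c μ ν n i * star (frame c μ ν n i)) = secL μ c ν 0 f := fun i => by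
    have hm := cylWeight_mem i
    have hst := starSec_mem μ (cylFun_mem (c := c) (ν := ν) (n := n) hm)
    refine ⟨⟨fun z => ((cylWeight i z.1 ^ 2 : ℝ) : ℂ), ?_, fun x y => rfl, fun x y => ?_⟩,
      fun z => rfl, ?_⟩
    · have := (hm.1.continuous.pow 2).comp (continuous_fst (X := ℝ) (Y := ℝ))
      refine this.congr fun z => ?_
      simp
    · have := hm.2.1 x
      simp only [Complex.ofReal_pow, this]
      simp [ee_zero]
    · rw [map_mul, map_star, frame, incl_cyl, star_secL_apply _ ⟨_, hst⟩ rfl fun x y => rfl]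
      refine secL_mul_apply _ _ _ (by ring) fun x y => ?_
      simp only [sub_add_cancel, Complex.star_def, Complex.mul_conj, Complex.normSq_eq_norm_sq]
      rw [cylFun, norm_mul, norm_ee, mul_one, Complex.norm_real, Real.norm_eq_abs, sq_abs]
  choose f hf e using h
  simp only [e]
  rw [← map_sum]
  congr 1
  ext z
  simp only [AddSubmonoidClass.coe_finsetSum, Finset.sum_apply, hf]
  rw [← Complex.ofReal_sum, sum_cylWeight_sq, Complex.ofReal_one]

/-- In the opposite order the squared weights appear translated by `2nμ`, which does not affect that
they sum to `1`. -/
theorem sum_star_frame_mul (n : ℤ) : ∑ i, star (frame c μ ν n i) * frame c μ ν n i = 1 := by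
  refine SmoothQHM.incl_injective ?_
  rw [map_sum, map_one, ← secL_one]
  have h : ∀ i, ∃ f : secSub c ν 0, (∀ z, f.1 z = ((cylWeight i (z.1 + 2 * n * μ) ^ 2 : ℝ) : ℂ)) ∧
      SmoothQHM.incl c μ ν (star (frame c μ ν n i) * frame c μ ν n i) = secL μ c ν 0 f := fun i => by
    have hm := cylWeight_mem i
    have hst := starSec_mem μ (cylFun_mem (c := c) (ν := ν) (n := n) hm)
    refine ⟨⟨fun z => ((cylWeight i (z.1 + 2 * n * μ) ^ 2 : ℝ) : ℂ), ?_, fun x y => rfl,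
      fun x y => ?_⟩, fun z => rfl, ?_⟩
    · have := (hm.1.continuous.pow 2).comp
        (g := fun x => (cylWeight i x : ℂ) ^ 2) (f := fun z : ℝ × ℝ => z.1 + 2 * n * μ) (by fun_prop)
      refine this.congr fun z => ?_
      simp
    · have := hm.2.1 (x + 2 * n * μ)
      rw [add_right_comm] at this
      simp only [Complex.ofReal_pow, this]
      simp [ee_zero]
    · rw [map_mul, map_star, frame, incl_cyl, star_secL_apply _ ⟨_, hst⟩ rfl fun x y => rfl]
      refine secL_mul_apply _ _ _ (by ring) fun x y => ?_
      push_cast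
      rw [show x - 2 * -n * μ = x + 2 * n * μ by ring, show y - 2 * -n * ν = y + 2 * n * ν by ring,
        mul_comm]
      simp only [Complex.star_def, Complex.mul_conj, Complex.normSq_eq_norm_sq]
      rw [cylFun, norm_mul, norm_ee, mul_one, Complex.norm_real, Real.norm_eq_abs, sq_abs]
      push_cast
      rfl
  choose f hf e using h
  simp only [e]
  rw [← map_sum]
  congr 1
  ext z
  simp only [AddSubmonoidClass.coe_finsetSum, Finset.sum_apply, hf]
  rw [← Complex.ofReal_sum, sum_cylWeight_sq, Complex.ofReal_one]

end Cyl

/-! ### Graded spaces of products -/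

section Graded

variable {R : Type*} [NonUnitalRing R] [StarRing R] [Module ℂ R] [IsScalarTower ℂ R R]
  [SMulCommClass ℂ R R] [StarModule ℂ R]

/-- The span of the products `p₁ ⋯ pₙ z` with `pᵢ ∈ P` and `z ∈ Z`. -/
def gradPow (Z P : Submodule ℂ R) : ℕ → Submodule ℂ R
  | 0 => Z
  | n + 1 => Submodule.span ℂ {x | ∃ p ∈ P, ∃ y ∈ gradPow Z P n, x = p * y}

/-- The relations between the coefficients `Z`, the module `P` and its adjoint `Q`. -/
structure IsGradedTriple (Z P Q : Submodule ℂ R) : Prop where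
  star_Z : ∀ z ∈ Z, star z ∈ Z
  star_P : ∀ p ∈ P, star p ∈ Q
  star_Q : ∀ q ∈ Q, star q ∈ P
  ZZ : ∀ z ∈ Z, ∀ z' ∈ Z, z * z' ∈ Z
  ZP : ∀ z ∈ Z, ∀ p ∈ P, z * p ∈ P
  ZQ : ∀ z ∈ Z, ∀ q ∈ Q, z * q ∈ Q
  PQ : ∀ p ∈ P, ∀ q ∈ Q, p * q ∈ Z
  QP : ∀ q ∈ Q, ∀ p ∈ P, q * p ∈ Z
  P_unit : ∀ p ∈ P, ∃ z ∈ Z, p = p * z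
  Q_unit : ∀ q ∈ Q, ∃ z ∈ Z, q = q * z

variable {Z P Q : Submodule ℂ R}

theorem IsGradedTriple.symm (h : IsGradedTriple Z P Q) : IsGradedTriple Z Q P :=
  ⟨h.star_Z, h.star_Q, h.star_P, h.ZZ, h.ZQ, h.ZP, h.QP, h.PQ, h.Q_unit, h.P_unit⟩

theorem mul_mem_gradPow_succ {n : ℕ} {p y : R} (hp : p ∈ P) (hy : y ∈ gradPow Z P n) :
    p * y ∈ gradPow Z P (n + 1) := Submodule.subset_span ⟨p, hp, y, hy, rfl⟩

theorem IsGradedTriple.Z_mul_mem (h : IsGradedTriple Z P Q) {n : ℕ} {z x : R} (hz : z ∈ Z)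
    (hx : x ∈ gradPow Z P n) : z * x ∈ gradPow Z P n := by
  cases n with
  | zero => exact h.ZZ z hz x hx
  | succ n =>
    induction hx using Submodule.span_induction with
    | mem x hx =>
      obtain ⟨p, hp, y, hy, rfl⟩ := hx
      rw [← mul_assoc]
      exact mul_mem_gradPow_succ (h.ZP z hz p hp) hy
    | zero => rw [mul_zero]; exact zero_mem _
    | add x y _ _ hx hy => rw [mul_add]; exact add_mem hx hy
    | smul a x _ hx => rw [mul_smul_comm]; exact Submodule.smul_mem _ _ hx

theorem IsGradedTriple.Q_mul_mem (h : IsGradedTriple Z P Q) {n : ℕ} {q x : R} (hq : q ∈ Q)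
    (hx : x ∈ gradPow Z P (n + 1)) : q * x ∈ gradPow Z P n := by
  induction hx using Submodule.span_induction with
  | mem x hx =>
    obtain ⟨p, hp, y, hy, rfl⟩ := hx
    rw [← mul_assoc]
    exact h.Z_mul_mem (h.QP q hq p hp) hy
  | zero => rw [mul_zero]; exact zero_mem _
  | add x y _ _ hx hy => rw [mul_add]; exact add_mem hx hy
  | smul a x _ hx => rw [mul_smul_comm]; exact Submodule.smul_mem _ _ hx

/-- The adjoint of the leading factor of `x` lies in `Q` and contracts with the leading factor of
`y`, since `QP ⊆ Z`. With `x = y` this reduces norm estimates in any degree to `Z`. -/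
theorem IsGradedTriple.star_mul_mem (h : IsGradedTriple Z P Q) {n : ℕ} {x y : R}
    (hx : x ∈ gradPow Z P n) (hy : y ∈ gradPow Z P n) : star x * y ∈ Z := by
  induction n generalizing x y with
  | zero => exact h.ZZ _ (h.star_Z _ hx) _ hy
  | succ n ih =>
    induction hx using Submodule.span_induction with
    | mem x hx =>
      obtain ⟨p, hp, x', hx', rfl⟩ := hx
      rw [star_mul, mul_assoc]
      exact ih hx' (h.Q_mul_mem (h.star_P p hp) hy)
    | zero => rw [star_zero, zero_mul]; exact zero_mem _
    | add x x' _ _ hx hx' => rw [star_add, add_mul]; exact add_mem hx hx'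
    | smul a x _ hx => rw [star_smul, smul_mul_assoc]; exact Submodule.smul_mem _ _ hx

/-- The homogeneous elements of degree `n`. -/
def gradDeg (Z P Q : Submodule ℂ R) : ℤ → Submodule ℂ R
  | Int.ofNat n => gradPow Z P n
  | Int.negSucc n => gradPow Z Q (n + 1)

theorem gradDeg_natCast (n : ℕ) : gradDeg Z P Q n = gradPow Z P n := rfl

theorem gradDeg_neg_natCast (n : ℕ) : gradDeg Z P Q (-n) = gradPow Z Q n := by
  cases n <;> rfl

theorem gradDeg_neg (n : ℤ) : gradDeg Z P Q (-n) = gradDeg Z Q P n := by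
  obtain ⟨m, rfl | rfl⟩ := n.eq_nat_or_neg
  · rw [gradDeg_neg_natCast, gradDeg_natCast]
  · rw [neg_neg, gradDeg_neg_natCast, gradDeg_natCast]

theorem IsGradedTriple.Z_mul_mem_gradDeg (h : IsGradedTriple Z P Q) {n : ℤ} {z x : R} (hz : z ∈ Z)
    (hx : x ∈ gradDeg Z P Q n) : z * x ∈ gradDeg Z P Q n := by
  obtain ⟨m, rfl | rfl⟩ := n.eq_nat_or_neg
  · exact h.Z_mul_mem hz hx
  · rw [gradDeg_neg_natCast] at *
    exact h.symm.Z_mul_mem hz hx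

theorem IsGradedTriple.P_mul_mem_gradDeg (h : IsGradedTriple Z P Q) {n : ℤ} {p x : R} (hp : p ∈ P)
    (hx : x ∈ gradDeg Z P Q n) : p * x ∈ gradDeg Z P Q (n + 1) := by
  obtain ⟨m, rfl | rfl⟩ := n.eq_nat_or_neg
  · exact mul_mem_gradPow_succ hp hx
  · cases m with
    | zero => exact mul_mem_gradPow_succ hp hx
    | succ m =>
      rw [gradDeg_neg_natCast] at hx
      rw [show -((m + 1 : ℕ) : ℤ) + 1 = -(m : ℤ) by push_cast; ring, gradDeg_neg_natCast]
      exact h.symm.Q_mul_mem hp hx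

theorem IsGradedTriple.mul_mem_of_nat (h : IsGradedTriple Z P Q) {m : ℕ} {n : ℤ} {x y : R}
    (hx : x ∈ gradPow Z P m) (hy : y ∈ gradDeg Z P Q n) : x * y ∈ gradDeg Z P Q (m + n) := by
  induction m generalizing x with
  | zero => simpa using h.Z_mul_mem_gradDeg hx hy
  | succ m ih =>
    induction hx using Submodule.span_induction with
    | mem x hx =>
      obtain ⟨p, hp, x', hx', rfl⟩ := hx
      rw [mul_assoc, show ((m + 1 : ℕ) : ℤ) + n = m + n + 1 by push_cast; ring]
      exact h.P_mul_mem_gradDeg hp (ih hx')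
    | zero => rw [zero_mul]; exact zero_mem _
    | add x x' _ _ hx hx' => rw [add_mul]; exact add_mem hx hx'
    | smul a x _ hx => rw [smul_mul_assoc]; exact Submodule.smul_mem _ _ hx

theorem IsGradedTriple.mul_mem (h : IsGradedTriple Z P Q) {m n : ℤ} {x y : R}
    (hx : x ∈ gradDeg Z P Q m) (hy : y ∈ gradDeg Z P Q n) : x * y ∈ gradDeg Z P Q (m + n) := by
  obtain ⟨k, rfl | rfl⟩ := m.eq_nat_or_neg
  · exact h.mul_mem_of_nat hx hy
  · rw [gradDeg_neg_natCast] at hx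
    -- Negative degrees are positive degrees of the triple with `P` and `Q` exchanged.
    have := h.symm.mul_mem_of_nat (n := -n) hx (by rwa [gradDeg_neg])
    rwa [show (k : ℤ) + -n = -(-k + n) by ring, gradDeg_neg] at this

/-- The ring need not have a unit, and degree one is spanned by products `p * z`; the local unit of
`P_unit` supplies the factor `z`. -/
theorem IsGradedTriple.P_le (h : IsGradedTriple Z P Q) : P ≤ gradDeg Z P Q 1 := fun p hp => by
  obtain ⟨z, hz, e⟩ := h.P_unit p hp
  rw [e]
  exact mul_mem_gradPow_succ (n := 0) hp hz

theorem IsGradedTriple.star_mem_of_nat (h : IsGradedTriple Z P Q) {n : ℕ} {x : R}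
    (hx : x ∈ gradPow Z P n) : star x ∈ gradPow Z Q n := by
  induction n generalizing x with
  | zero => exact h.star_Z _ hx
  | succ n ih =>
    induction hx using Submodule.span_induction with
    | mem x hx =>
      obtain ⟨p, hp, x', hx', rfl⟩ := hx
      rw [star_mul]
      exact h.symm.mul_mem_of_nat (n := 1) (ih hx') (h.symm.P_le (h.star_P p hp))
    | zero => rw [star_zero]; exact zero_mem _
    | add x x' _ _ hx hx' => rw [star_add]; exact add_mem hx hx'
    | smul a x _ hx => rw [star_smul]; exact Submodule.smul_mem _ _ hx

theorem IsGradedTriple.star_mem (h : IsGradedTriple Z P Q) {n : ℤ} {x : R}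
    (hx : x ∈ gradDeg Z P Q n) : star x ∈ gradDeg Z P Q (-n) := by
  obtain ⟨k, rfl | rfl⟩ := n.eq_nat_or_neg
  · rw [gradDeg_neg_natCast]; exact h.star_mem_of_nat hx
  · rw [gradDeg_neg_natCast] at hx
    rw [neg_neg]; exact h.symm.star_mem_of_nat hx

theorem IsGradedTriple.star_mul_self_mem (h : IsGradedTriple Z P Q) {n : ℤ} {x : R}
    (hx : x ∈ gradDeg Z P Q n) : star x * x ∈ Z := by
  obtain ⟨k, rfl | rfl⟩ := n.eq_nat_or_neg
  · exact h.star_mul_mem hx hx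
  · rw [gradDeg_neg_natCast] at hx; exact h.symm.star_mul_mem hx hx

/-- The sums of homogeneous elements of degrees `-N, …, N`. -/
def gradBand (Z P Q : Submodule ℂ R) (N : ℕ) : Submodule ℂ R :=
  Submodule.span ℂ {x | ∃ n : ℤ, |n| ≤ N ∧ x ∈ gradDeg Z P Q n}

theorem gradBand_mono {M N : ℕ} (h : M ≤ N) : gradBand Z P Q M ≤ gradBand Z P Q N :=
  Submodule.span_mono fun _ ⟨n, hn, hx⟩ => ⟨n, hn.trans (by exact_mod_cast h), hx⟩

theorem IsGradedTriple.mul_mem_gradBand (h : IsGradedTriple Z P Q) {M N : ℕ} {x y : R}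
    (hx : x ∈ gradBand Z P Q M) (hy : y ∈ gradBand Z P Q N) : x * y ∈ gradBand Z P Q (M + N) := by
  induction hx using Submodule.span_induction with
  | mem x hx =>
    obtain ⟨m, hm, hx⟩ := hx
    induction hy using Submodule.span_induction with
    | mem y hy =>
      obtain ⟨n, hn, hy⟩ := hy
      refine Submodule.subset_span ⟨m + n, ?_, h.mul_mem hx hy⟩
      push_cast
      exact (abs_add_le _ _).trans (add_le_add hm hn)
    | zero => rw [mul_zero]; exact zero_mem _
    | add x y _ _ hx hy => rw [mul_add]; exact add_mem hx hy
    | smul a x _ hx => rw [mul_smul_comm]; exact Submodule.smul_mem _ _ hx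
  | zero => rw [zero_mul]; exact zero_mem _
  | add x x' _ _ hx hx' => rw [add_mul]; exact add_mem hx hx'
  | smul a x _ hx => rw [smul_mul_assoc]; exact Submodule.smul_mem _ _ hx

theorem IsGradedTriple.star_mem_gradBand (h : IsGradedTriple Z P Q) {N : ℕ} {x : R}
    (hx : x ∈ gradBand Z P Q N) : star x ∈ gradBand Z P Q N := by
  induction hx using Submodule.span_induction with
  | mem x hx =>
    obtain ⟨m, hm, hx⟩ := hx
    exact Submodule.subset_span ⟨-m, by rwa [abs_neg], h.star_mem hx⟩
  | zero => rw [star_zero]; exact zero_mem _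
  | add x x' _ _ hx hx' => rw [star_add]; exact add_mem hx hx'
  | smul a x _ hx => rw [star_smul]; exact Submodule.smul_mem _ _ hx

theorem exists_sum_of_mem_gradBand {N : ℕ} {x : R} (hx : x ∈ gradBand Z P Q N) :
    ∃ f : ℤ → R, (∀ n, f n ∈ gradDeg Z P Q n) ∧ x = ∑ n ∈ Finset.Icc (-(N : ℤ)) N, f n := by
  induction hx using Submodule.span_induction with
  | mem x hx =>
    obtain ⟨m, hm, hx⟩ := hx
    refine ⟨fun n => if n = m then x else 0, fun n => ?_, ?_⟩
    · beta_reduce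
      split_ifs with hn
      · exact hn ▸ hx
      · exact zero_mem _
    · rw [Finset.sum_ite_eq', if_pos (Finset.mem_Icc.2 (abs_le.1 hm))]
  | zero => exact ⟨0, fun n => zero_mem _, by simp⟩
  | add x x' _ _ hx hx' =>
    obtain ⟨f, hf, rfl⟩ := hx
    obtain ⟨g, hg, rfl⟩ := hx'
    exact ⟨f + g, fun n => add_mem (hf n) (hg n), by simp [Finset.sum_add_distrib]⟩
  | smul a x _ hx =>
    obtain ⟨f, hf, rfl⟩ := hx
    exact ⟨a • f, fun n => Submodule.smul_mem _ _ (hf n), by simp [Finset.smul_sum]⟩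

end Graded

/-- The power trick: a factor linear in the exponent is lost against geometric growth. If `b < a`,
the right side divided by `a ^ 2 ^ j` would tend to `0`. -/
theorem le_of_pow_two_pow_le {a b K : ℝ} (hb : 0 ≤ b)
    (h : ∀ j : ℕ, a ^ 2 ^ j ≤ (K * 2 ^ j + 1) * b ^ 2 ^ j) : a ≤ b := by
  by_contra! hab
  have ha' : 0 < a := hb.trans_lt hab
  have h1 : Tendsto (fun m : ℕ => K * (m * (b / a) ^ m) + (b / a) ^ m) atTop (𝓝 (K * 0 + 0)) := by
    have hr : 0 ≤ b / a := by positivity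
    have hr' : b / a < 1 := (div_lt_one ha').2 hab
    exact ((tendsto_self_mul_const_pow_of_lt_one hr hr').const_mul K).add
      (tendsto_pow_atTop_nhds_zero_of_lt_one hr hr')
  have h2 := h1.comp (tendsto_pow_atTop_atTop_of_one_lt (r := 2) one_lt_two)
  have h3 : (1 : ℝ) ≤ K * 0 + 0 := by
    refine ge_of_tendsto' h2 fun j => ?_
    have := h j
    simp only [Function.comp]
    rw [← mul_assoc, ← add_one_mul, div_pow, mul_div_assoc', one_le_div (by positivity)]
    exact_mod_cast this
  norm_num at h3

/-! ### Graphs of covariant representations as homomorphisms -/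

section Universal

variable {c : ℤ} {μ ν : ℝ} {B : Type*} [NonUnitalCStarAlgebra B]

/-- A graded triple in `D × B` whose coefficients are the graph of a homomorphism defined on the
base. -/
structure IsGraphTriple (Z P Q : Submodule ℂ (QHM c μ ν × B)) : Prop extends
    IsGradedTriple Z P Q where
  Z_deg : ∀ z ∈ Z, z.1 ∈ qhmSpec c μ ν 0
  P_deg : ∀ p ∈ P, p.1 ∈ qhmSpec c μ ν 1
  Q_deg : ∀ q ∈ Q, q.1 ∈ qhmSpec c μ ν (-1)
  Z_norm : ∀ z ∈ Z, ‖z.2‖ ≤ ‖z.1‖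

variable {Z P Q : Submodule ℂ (QHM c μ ν × B)}

theorem fst_mem_of_gradPow {k : ℤ} (hZ : ∀ z ∈ Z, z.1 ∈ qhmSpec c μ ν 0)
    (hP : ∀ p ∈ P, p.1 ∈ qhmSpec c μ ν k) {n : ℕ} {x : QHM c μ ν × B} (hx : x ∈ gradPow Z P n) :
    x.1 ∈ qhmSpec c μ ν (n * k) := by
  induction n generalizing x with
  | zero => simpa using hZ x hx
  | succ n ih =>
    induction hx using Submodule.span_induction with
    | mem x hx =>
      obtain ⟨p, hp, y, hy, rfl⟩ := hx
      have := mul_mem_qhmSpec (hP p hp) (ih hy)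
      rwa [show k + n * k = ((n + 1 : ℕ) : ℤ) * k by push_cast; ring] at this
    | zero => exact zero_mem _
    | add x y _ _ hx hy => exact add_mem hx hy
    | smul a x _ hx => exact Submodule.smul_mem _ _ hx

theorem IsGraphTriple.fst_mem (h : IsGraphTriple Z P Q) {n : ℤ} {x : QHM c μ ν × B}
    (hx : x ∈ gradDeg Z P Q n) : x.1 ∈ qhmSpec c μ ν n := by
  obtain ⟨k, rfl | rfl⟩ := n.eq_nat_or_neg
  · simpa using fst_mem_of_gradPow h.Z_deg h.P_deg hx
  · rw [gradDeg_neg_natCast] at hx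
    simpa using fst_mem_of_gradPow h.Z_deg h.Q_deg hx

/-- Since `x⋆x` lies in `Z`, where the inequality is assumed, the C⋆-identity in both components
gives the inequality of the squares. -/
theorem IsGraphTriple.norm_le_of_gradDeg (h : IsGraphTriple Z P Q) {n : ℤ} {x : QHM c μ ν × B}
    (hx : x ∈ gradDeg Z P Q n) : ‖x.2‖ ≤ ‖x.1‖ := by
  have h1 := h.Z_norm _ (h.star_mul_self_mem hx)
  simp only [Prod.fst_mul, Prod.snd_mul, Prod.fst_star, Prod.snd_star,
    CStarRing.norm_star_mul_self] at h1
  exact abs_le_of_sq_le_sq' (by simpa [sq] using h1) (norm_nonneg _) |>.2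

/-- The first entry of each component is a spectral projection of `x.1`, hence no larger than `x.1`,
and there are `2N + 1` components. No gauge action on `B` is used. -/
theorem IsGraphTriple.norm_le_of_gradBand (h : IsGraphTriple Z P Q) {N : ℕ} {x : QHM c μ ν × B}
    (hx : x ∈ gradBand Z P Q N) : ‖x.2‖ ≤ (2 * N + 1) * ‖x.1‖ := by
  obtain ⟨f, hf, e⟩ := exists_sum_of_mem_gradBand hx
  have h1 : ∀ m ∈ Finset.Icc (-(N : ℤ)) N, specProj c μ ν m x.1 = (f m).1 := fun m hm => by
    rw [e, Prod.fst_sum, map_sum]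
    simp only [fun n => specProj_of_mem (h.fst_mem (hf n)) m]
    rw [Finset.sum_ite_eq', if_pos hm]
  have h2 : ∀ m ∈ Finset.Icc (-(N : ℤ)) N, ‖(f m).2‖ ≤ ‖x.1‖ := fun m hm =>
    (h.norm_le_of_gradDeg (hf m)).trans (h1 m hm ▸ norm_specProj_le m x.1)
  have h3 : x.2 = ∑ n ∈ Finset.Icc (-(N : ℤ)) N, (f n).2 := by
    conv_lhs => rw [e]
    rw [Prod.snd_sum]
  rw [h3]
  refine (norm_sum_le_of_le _ h2).trans (le_of_eq ?_)
  rw [Finset.sum_const, Int.card_Icc, nsmul_eq_mul]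
  congr 1
  have : ((N : ℤ) + 1 - -(N : ℤ)).toNat = 2 * N + 1 := by omega
  rw [this]
  push_cast
  ring

/-- The crude bound is applied to `(x⋆x)^(2^j)`. Its norm is an exact power in each component by
self-adjointness, while the width of its band grows only linearly in `2^j`. -/
theorem IsGraphTriple.norm_le (h : IsGraphTriple Z P Q) {N : ℕ} {x : QHM c μ ν × B}
    (hx : x ∈ gradBand Z P Q N) : ‖x.2‖ ≤ ‖x.1‖ := by
  set y : ℕ → QHM c μ ν × B := fun j => Nat.rec (star x * x) (fun _ y => y * y) j with hy
  have hy1 : ∀ j, y (j + 1) = y j * y j := fun j => rfl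
  have hmem : ∀ j, y j ∈ gradBand Z P Q (2 ^ j * (N + N)) := fun j => by
    induction j with
    | zero =>
      rw [pow_zero, one_mul]
      exact h.mul_mem_gradBand (h.star_mem_gradBand hx) hx
    | succ j ih =>
      rw [hy1, show 2 ^ (j + 1) * (N + N) = 2 ^ j * (N + N) + 2 ^ j * (N + N) by ring]
      exact h.mul_mem_gradBand ih ih
  have hsa : ∀ j, star (y j) = y j := fun j => by
    induction j with
    | zero => exact (star_mul _ _).trans (by rw [star_star]; rfl)
    | succ j ih => rw [hy1, star_mul, ih]
  have hn1 : ∀ j, ‖(y j).1‖ = (‖x.1‖ ^ 2) ^ 2 ^ j := fun j => by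
    induction j with
    | zero =>
      rw [pow_zero, pow_one, sq]
      exact CStarRing.norm_star_mul_self
    | succ j ih =>
      have h0 : star (y j).1 = (y j).1 := congr_arg Prod.fst (hsa j)
      have h1 : ‖(y j).1 * (y j).1‖ = ‖(y j).1‖ * ‖(y j).1‖ := by
        conv_lhs => arg 1; arg 1; rw [← h0]
        exact CStarRing.norm_star_mul_self
      rw [hy1, Prod.fst_mul, h1, ih]
      ring
  have hn2 : ∀ j, ‖(y j).2‖ = (‖x.2‖ ^ 2) ^ 2 ^ j := fun j => by
    induction j with
    | zero =>
      rw [pow_zero, pow_one, sq]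
      exact CStarRing.norm_star_mul_self
    | succ j ih =>
      have h0 : star (y j).2 = (y j).2 := congr_arg Prod.snd (hsa j)
      have h1 : ‖(y j).2 * (y j).2‖ = ‖(y j).2‖ * ‖(y j).2‖ := by
        conv_lhs => arg 1; arg 1; rw [← h0]
        exact CStarRing.norm_star_mul_self
      rw [hy1, Prod.snd_mul, h1, ih]
      ring
  have key : ‖x.2‖ ^ 2 ≤ ‖x.1‖ ^ 2 := by
    -- The element `y j` lies in the band of width `2^j * 2N`, for which the crude factor is `4N *
    -- 2^j + 1`.
    refine le_of_pow_two_pow_le (K := 4 * N) (by positivity) fun j => ?_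
    have := h.norm_le_of_gradBand (hmem j)
    rw [hn1, hn2] at this
    refine this.trans (le_of_eq ?_)
    push_cast
    ring
  exact abs_le_of_sq_le_sq' key (norm_nonneg _) |>.2

/-- The algebra of all sums of homogeneous elements. -/
def gradAll (Z P Q : Submodule ℂ (QHM c μ ν × B)) : Submodule ℂ (QHM c μ ν × B) :=
  ⨆ N, gradBand Z P Q N

theorem mem_gradAll {x : QHM c μ ν × B} : x ∈ gradAll Z P Q ↔ ∃ N, x ∈ gradBand Z P Q N :=
  Submodule.mem_iSup_of_directed _ (monotone_nat_of_le_succ fun N =>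
    gradBand_mono N.le_succ).directed_le

theorem IsGraphTriple.norm_le_of_closure (h : IsGraphTriple Z P Q) {x : QHM c μ ν × B}
    (hx : x ∈ (gradAll Z P Q).topologicalClosure) : ‖x.2‖ ≤ ‖x.1‖ := by
  have : IsClosed {x : QHM c μ ν × B | ‖x.2‖ ≤ ‖x.1‖} :=
    isClosed_le (by fun_prop) (by fun_prop)
  refine closure_minimal (fun y hy => ?_) this hx
  obtain ⟨N, hN⟩ := mem_gradAll.1 hy
  exact h.norm_le hN

/-- If the first components are dense, the closure is the graph of a homomorphism. -/
theorem IsGraphTriple.exists_hom (h : IsGraphTriple Z P Q)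
    (hd : Dense {d : QHM c μ ν | ∃ b, (d, b) ∈ gradAll Z P Q}) :
    ∃ ρ : QHM c μ ν →⋆ₙₐ[ℂ] B, ∀ x ∈ gradAll Z P Q, ρ x.1 = x.2 := by
  set G := (gradAll Z P Q).topologicalClosure with hG
  have hmul : ∀ x ∈ G, ∀ y ∈ G, x * y ∈ G := fun x hx y hy =>
    map_mem_closure₂ continuous_mul hx hy fun a ha b hb => by
      obtain ⟨M, hM⟩ := mem_gradAll.1 ha
      obtain ⟨N, hN⟩ := mem_gradAll.1 hb
      exact mem_gradAll.2 ⟨_, h.mul_mem_gradBand hM hN⟩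
  have hstar : ∀ x ∈ G, star x ∈ G := fun x hx =>
    map_mem_closure continuous_star hx fun a ha => by
      obtain ⟨M, hM⟩ := mem_gradAll.1 ha
      exact mem_gradAll.2 ⟨_, h.star_mem_gradBand hM⟩
  -- Over `0` the norm inequality leaves only `0`, so the closure is the graph of a map; every
  -- algebraic identity below is an instance of this uniqueness.
  have huniq : ∀ d b b', (d, b) ∈ G → (d, b') ∈ G → b = b' := fun d b b' hb hb' => by
    have := h.norm_le_of_closure (sub_mem hb hb')
    simp only [Prod.mk_sub_mk, sub_self, norm_zero] at this
    exact sub_eq_zero.1 (norm_le_zero_iff.1 this)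
  have hex : ∀ d, ∃ b, (d, b) ∈ G := fun d => by
    obtain ⟨u, hu, hlim⟩ := mem_closure_iff_seq_limit.1 (hd d)
    choose b hb using hu
    have hcau : CauchySeq b := by
      rw [Metric.cauchySeq_iff]
      intro ε hε
      obtain ⟨N, hN⟩ := Metric.cauchySeq_iff.1 hlim.cauchySeq ε hε
      refine ⟨N, fun m hm n hn => lt_of_le_of_lt ?_ (hN m hm n hn)⟩
      rw [dist_eq_norm, dist_eq_norm]
      exact h.norm_le_of_closure ((gradAll Z P Q).le_topologicalClosure (sub_mem (hb m) (hb n)))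
    obtain ⟨b', hb'⟩ := cauchySeq_tendsto_of_complete hcau
    exact ⟨b', mem_closure_of_tendsto (hlim.prodMk_nhds hb') (Eventually.of_forall hb)⟩
  choose ρ hρ using hex
  have hsmul : ∀ (a : ℂ) d, ρ (a • d) = a • ρ d := fun a d =>
    huniq (a • d) _ _ (hρ _) (show (a • (d, ρ d)) ∈ G from G.smul_mem a (hρ d))
  have hzero : ρ 0 = 0 := huniq 0 _ _ (hρ _) G.zero_mem
  have hadd : ∀ d d', ρ (d + d') = ρ d + ρ d' := fun d d' =>
    huniq (d + d') _ _ (hρ _) (show (d, ρ d) + (d', ρ d') ∈ G from G.add_mem (hρ d) (hρ d'))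
  have hmul' : ∀ d d', ρ (d * d') = ρ d * ρ d' := fun d d' =>
    huniq (d * d') _ _ (hρ _) (show (d, ρ d) * (d', ρ d') ∈ G from hmul _ (hρ d) _ (hρ d'))
  have hstar' : ∀ d, ρ (star d) = star (ρ d) := fun d =>
    huniq (star d) _ _ (hρ _) (show star (d, ρ d) ∈ G from hstar _ (hρ d))
  exact ⟨{ toFun := ρ, map_smul' := hsmul, map_zero' := hzero, map_add' := hadd,
            map_mul' := hmul', map_star' := hstar' }, fun x hx =>
    huniq x.1 _ _ (hρ _) ((gradAll Z P Q).le_topologicalClosure hx)⟩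

end Universal

/-! ### The Pimsner algebra structure -/

section Pimsner

variable {c : ℤ} {μ ν : ℝ}

/-- Induction on the homogeneous elements, by multiplication with the elements of a frame of degree
one and their adjoints. -/
theorem homogeneous_induction {D : Type*} [Ring D] [StarRing D] [Algebra ℂ D]
    (ι : D →⋆ₐ[ℂ] QHM c μ ν) {x : Fin 2 → D} (hx : ∀ i, ι (x i) ∈ qhmSpec c μ ν 1)
    (h1 : ∑ i, x i * star (x i) = 1) (h2 : ∑ i, star (x i) * x i = 1) {p : ℤ → D → Prop}
    (h0 : ∀ d, ι d ∈ qhmSpec c μ ν 0 → p 0 d)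
    (hadd : ∀ n d d', p n d → p n d' → p n (d + d'))
    (hpos : ∀ n : ℤ, 0 ≤ n → ∀ i d, p n d → p (n + 1) (x i * d))
    (hneg : ∀ n : ℤ, n ≤ 0 → ∀ i d, p n d → p (n - 1) (star (x i) * d)) (n : ℤ) (d : D)
    (hd : ι d ∈ qhmSpec c μ ν n) : p n d := by
  have hstar : ∀ i, ι (star (x i)) ∈ qhmSpec c μ ν (-1) := fun i => by
    rw [map_star]; exact star_mem_qhmSpec (hx i)
  induction n using Int.induction_on generalizing d with
  | zero => exact h0 d hd
  | succ n ih =>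
    -- The frame identity writes `d` as a combination of elements one degree closer to zero.
    -- Induction therefore only ever moves outward from degree zero.
    have e : d = x 0 * (star (x 0) * d) + x 1 * (star (x 1) * d) := by
      rw [← mul_assoc, ← mul_assoc, ← add_mul, ← Fin.sum_univ_two fun i => x i * star (x i), h1,
        one_mul]
    have hi : ∀ i, p (n + 1) (x i * (star (x i) * d)) := fun i => by
      refine hpos n (by positivity) i _ (ih _ ?_)
      rw [map_mul]
      simpa using mul_mem_qhmSpec (hstar i) hd
    rw [e]
    exact hadd _ _ _ (hi 0) (hi 1)
  | pred n ih =>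
    have e : d = star (x 0) * (x 0 * d) + star (x 1) * (x 1 * d) := by
      rw [← mul_assoc, ← mul_assoc, ← add_mul, ← Fin.sum_univ_two fun i => star (x i) * x i, h2,
        one_mul]
    have hi : ∀ i, p (-n - 1) (star (x i) * (x i * d)) := fun i => by
      refine hneg (-n) (by simp) i _ (ih _ ?_)
      rw [map_mul]
      simpa using mul_mem_qhmSpec (hx i) hd
    rw [e]
    exact hadd _ _ _ (hi 0) (hi 1)

theorem incl_frame_one_mem (i : Fin 2) :
    SmoothQHM.incl c μ ν (frame c μ ν 1 i) ∈ qhmSpec c μ ν 1 := incl_frame_mem 1 i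

theorem sum_incl_frame_mul_star :
    ∑ i, SmoothQHM.incl c μ ν (frame c μ ν 1 i) * star (SmoothQHM.incl c μ ν (frame c μ ν 1 i)) =
      1 := by
  rw [← map_one (SmoothQHM.incl c μ ν), ← sum_frame_mul_star 1, map_sum]
  simp only [map_mul, map_star]

theorem sum_star_incl_frame_mul :
    ∑ i, star (SmoothQHM.incl c μ ν (frame c μ ν 1 i)) * SmoothQHM.incl c μ ν (frame c μ ν 1 i) =
      1 := by
  rw [← map_one (SmoothQHM.incl c μ ν), ← sum_star_frame_mul 1, map_sum]
  simp only [map_mul, map_star]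

theorem mul_mem_gradAll {B : Type*} [NonUnitalCStarAlgebra B]
    {Z P Q : Submodule ℂ (QHM c μ ν × B)} (h : IsGradedTriple Z P Q) {x y : QHM c μ ν × B}
    (hx : x ∈ gradAll Z P Q) (hy : y ∈ gradAll Z P Q) : x * y ∈ gradAll Z P Q := by
  obtain ⟨M, hM⟩ := mem_gradAll.1 hx
  obtain ⟨N, hN⟩ := mem_gradAll.1 hy
  exact mem_gradAll.2 ⟨_, h.mul_mem_gradBand hM hN⟩

theorem mk_mul_mem_gradAll {B : Type*} [NonUnitalCStarAlgebra B]
    {Z P Q : Submodule ℂ (QHM c μ ν × B)} (h : IsGradedTriple Z P Q) {a a' : QHM c μ ν} {b b' : B}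
    (hx : (a, b) ∈ gradAll Z P Q) (hy : (a', b') ∈ gradAll Z P Q) :
    (a * a', b * b') ∈ gradAll Z P Q := mul_mem_gradAll h hx hy

theorem mk_star_mem_gradAll {B : Type*} [NonUnitalCStarAlgebra B]
    {Z P Q : Submodule ℂ (QHM c μ ν × B)} (h : IsGradedTriple Z P Q) {a : QHM c μ ν} {b : B}
    (hx : (a, b) ∈ gradAll Z P Q) : (star a, star b) ∈ gradAll Z P Q := by
  obtain ⟨M, hM⟩ := mem_gradAll.1 hx
  have hs := h.star_mem_gradBand hM
  exact mem_gradAll.2 ⟨M, by simpa only [Prod.star_def] using hs⟩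

theorem mem_gradAll_of_gradDeg {B : Type*} [NonUnitalCStarAlgebra B]
    {Z P Q : Submodule ℂ (QHM c μ ν × B)} {n : ℤ} {x : QHM c μ ν × B}
    (hx : x ∈ gradDeg Z P Q n) : x ∈ gradAll Z P Q :=
  mem_gradAll.2 ⟨n.natAbs, Submodule.subset_span ⟨n, by simp, hx⟩⟩

theorem dense_gradAll {B : Type*} [NonUnitalCStarAlgebra B] {Z P Q : Submodule ℂ (QHM c μ ν × B)}
    (h : IsGradedTriple Z P Q) (hZ : ∀ d ∈ qhmSpec c μ ν 0, ∃ b, (d, b) ∈ Z)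
    (hP : ∀ d ∈ qhmSpec c μ ν 1, ∃ b, (d, b) ∈ P) :
    Dense {d : QHM c μ ν | ∃ b, (d, b) ∈ gradAll Z P Q} := by
  have hhom : ∀ (n : ℤ) (d : QHM c μ ν), d ∈ qhmSpec c μ ν n → ∃ b, (d, b) ∈ gradAll Z P Q := by
    refine homogeneous_induction (StarAlgHom.id ℂ _) (p := fun _ d => ∃ b, (d, b) ∈ gradAll Z P Q)
      incl_frame_one_mem sum_incl_frame_mul_star sum_star_incl_frame_mul ?_ ?_ ?_ ?_
    · intro d hd
      obtain ⟨b, hb⟩ := hZ d hd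
      exact ⟨b, mem_gradAll_of_gradDeg (n := 0) hb⟩
    · rintro _ d d' ⟨b, hb⟩ ⟨b', hb'⟩
      exact ⟨b + b', add_mem hb hb'⟩
    · rintro _ - i d ⟨b, hb⟩
      obtain ⟨b', hb'⟩ := hP _ (incl_frame_one_mem i)
      exact ⟨b' * b, mk_mul_mem_gradAll h (mem_gradAll_of_gradDeg (h.P_le hb')) hb⟩
    · rintro _ - i d ⟨b, hb⟩
      obtain ⟨b', hb'⟩ := hP _ (incl_frame_one_mem i)
      exact ⟨star b' * b, mk_mul_mem_gradAll h
        (mk_star_mem_gradAll h (mem_gradAll_of_gradDeg (h.P_le hb'))) hb⟩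
  refine QHM.dense_span_qhmSpec.mono fun d hd => ?_
  induction hd using Submodule.span_induction with
  | mem d hd =>
    obtain ⟨n, hn⟩ := hd
    exact hhom n d hn
  | zero => exact ⟨0, zero_mem _⟩
  | add x y _ _ hx hy =>
    obtain ⟨b, hb⟩ := hx
    obtain ⟨b', hb'⟩ := hy
    exact ⟨b + b', add_mem hb hb'⟩
  | smul a x _ hx =>
    obtain ⟨b, hb⟩ := hx
    exact ⟨a • b, Submodule.smul_mem _ a hb⟩

section Rep

variable {B : Type*} [NonUnitalCStarAlgebra B] (π : qhmBase c μ ν →⋆ₙₐ[ℂ] B)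
  (t : qhmSpec c μ ν 1 →ₗ[ℂ] B)

/-- The graph of the representation of the coefficients. -/
def baseGraph : Submodule ℂ (QHM c μ ν × B) :=
  LinearMap.range ((qhmBase c μ ν).subtype.toAlgHom.toLinearMap.prod
    { toFun := π, map_add' := map_add π, map_smul' := map_smul π })

/-- The graph of the representation of the module. -/
def moduleGraph : Submodule ℂ (QHM c μ ν × B) :=
  LinearMap.range ((qhmSpec c μ ν 1).subtype.prod t)

/-- The adjoints of the elements of a subspace. -/
def starSubmodule {R : Type*} [NonUnitalRing R] [StarRing R] [Module ℂ R] [StarModule ℂ R]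
    (P : Submodule ℂ R) : Submodule ℂ R where
  carrier := {x | star x ∈ P}
  add_mem' ha hb := by
    rw [Set.mem_ofPred_eq, star_add]; exact add_mem ha hb
  zero_mem' := by rw [Set.mem_ofPred_eq, star_zero]; exact zero_mem _
  smul_mem' z x hx := by
    rw [Set.mem_ofPred_eq, star_smul]; exact Submodule.smul_mem _ _ hx

variable {π t}

theorem mem_moduleGraph {x : QHM c μ ν × B} :
    x ∈ moduleGraph t ↔ ∃ ξ : qhmSpec c μ ν 1, ((ξ : QHM c μ ν), t ξ) = x := Iff.rfl

theorem mem_starSubmodule {R : Type*} [NonUnitalRing R] [StarRing R] [Module ℂ R] [StarModule ℂ R]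
    {P : Submodule ℂ R} {x : R} : x ∈ starSubmodule P ↔ star x ∈ P := Iff.rfl

theorem norm_apply_le_of_base (a : qhmBase c μ ν) : ‖π a‖ ≤ ‖(a : QHM c μ ν)‖ := by
  let _ : CStarAlgebra (qhmBase c μ ν) :=
    StarSubalgebra.cstarAlgebra _ (h_closed := isClosed_qhmBase)
  exact NonUnitalStarAlgHom.norm_apply_le π a

theorem isGraphTriple
    (hl : ∀ (a : qhmBase c μ ν) (ξ : qhmSpec c μ ν 1)
      (h : (a : QHM c μ ν) * (ξ : QHM c μ ν) ∈ qhmSpec c μ ν 1), t ⟨_, h⟩ = π a * t ξ)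
    (hr : ∀ (ξ η : qhmSpec c μ ν 1) (h : star (ξ : QHM c μ ν) * (η : QHM c μ ν) ∈ qhmBase c μ ν),
      π ⟨_, h⟩ = star (t ξ) * t η)
    (hr' : ∀ (ξ η : qhmSpec c μ ν 1) (h : (ξ : QHM c μ ν) * star (η : QHM c μ ν) ∈ qhmBase c μ ν),
      π ⟨_, h⟩ = t ξ * star (t η)) :
    IsGraphTriple (baseGraph π) (moduleGraph t) (starSubmodule (moduleGraph t)) := by
  have hZP : ∀ z ∈ baseGraph π, ∀ p ∈ moduleGraph t, z * p ∈ moduleGraph t := by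
    rintro _ ⟨a, rfl⟩ _ ⟨ξ, rfl⟩
    have h : (a : QHM c μ ν) * (ξ : QHM c μ ν) ∈ qhmSpec c μ ν 1 := by
      simpa using mul_mem_qhmSpec (mem_qhmBase_iff.1 a.2) ξ.2
    exact ⟨⟨_, h⟩, Prod.ext rfl (hl a ξ h)⟩
  -- Right linearity of `t` is not among the assumptions. It follows from compatibility with the
  -- scalar products, which gives `(T - UV)⋆(T - UV) = 0`.
  have hPZ : ∀ z ∈ baseGraph π, ∀ p ∈ moduleGraph t, p * z ∈ moduleGraph t := by
    rintro _ ⟨⟨a, ha⟩, rfl⟩ _ ⟨⟨ξ, hξ⟩, rfl⟩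
    have h : ξ * a ∈ qhmSpec c μ ν 1 := by
      simpa using mul_mem_qhmSpec hξ (mem_qhmBase_iff.1 ha)
    refine ⟨⟨_, h⟩, Prod.ext rfl ?_⟩
    change t ⟨ξ * a, h⟩ = t ⟨ξ, hξ⟩ * π ⟨a, ha⟩
    have hin : ∀ {ξ η : QHM c μ ν}, ξ ∈ qhmSpec c μ ν 1 → η ∈ qhmSpec c μ ν 1 →
        star ξ * η ∈ qhmBase c μ ν := fun h h' =>
      mem_qhmBase_iff.2 (by simpa using mul_mem_qhmSpec (star_mem_qhmSpec h) h')
    have hm : ∀ (x : QHM c μ ν) (hx : x ∈ qhmBase c μ ν) (y : QHM c μ ν) (hy : y ∈ qhmBase c μ ν)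
        (hxy : x * y ∈ qhmBase c μ ν), π ⟨x * y, hxy⟩ = π ⟨x, hx⟩ * π ⟨y, hy⟩ :=
      fun x hx y hy hxy => map_mul π ⟨x, hx⟩ ⟨y, hy⟩
    set T := t ⟨ξ * a, h⟩ with hT
    set U := t ⟨ξ, hξ⟩ with hU
    set V := π ⟨a, ha⟩ with hV
    have e1 : star T * T = star T * U * V := by
      rw [← hr ⟨_, h⟩ ⟨_, h⟩ (hin h h), ← hr ⟨_, h⟩ ⟨_, hξ⟩ (hin h hξ), hV,
        ← hm _ _ _ ha (mul_mem (hin h hξ) ha)]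
      congr 2
    have e2 : star U * T = star U * U * V := by
      rw [← hr ⟨_, hξ⟩ ⟨_, h⟩ (hin hξ h), ← hr ⟨_, hξ⟩ ⟨_, hξ⟩ (hin hξ hξ), hV,
        ← hm _ _ _ ha (mul_mem (hin hξ hξ) ha)]
      congr 2
    have : star (T - U * V) * (T - U * V) = 0 := by
      rw [star_sub, star_mul, sub_mul, mul_sub, mul_sub, ← mul_assoc (star T), ← e1, sub_self,
        mul_assoc, mul_assoc, ← mul_assoc (star U) U, ← e2, sub_self, sub_self]
    exact sub_eq_zero.1 (CStarRing.star_mul_self_eq_zero_iff _ |>.1 this)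
  have hsZ : ∀ z ∈ baseGraph π, star z ∈ baseGraph π := by
    rintro _ ⟨a, rfl⟩
    exact ⟨star a, Prod.ext rfl (map_star π a)⟩
  -- The element `π 1` need not be a unit of `B`, but `(1, π 1)` acts as a unit on the graph of `t`
  -- and so provides the local units.
  have hone : ((1, π 1) : QHM c μ ν × B) ∈ baseGraph π := ⟨1, rfl⟩
  have hZQ : ∀ z ∈ baseGraph π, ∀ q ∈ starSubmodule (moduleGraph t),
      z * q ∈ starSubmodule (moduleGraph t) := fun z hz q hq => by
    rw [mem_starSubmodule, star_mul]
    exact hPZ _ (hsZ z hz) _ hq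
  have huniq : ∀ x ∈ moduleGraph t, ∀ y ∈ moduleGraph t, x.1 = y.1 → x = y := by
    rintro _ ⟨ξ, rfl⟩ _ ⟨η, rfl⟩ h
    rw [show ξ = η from Subtype.ext h]
  have hQ : ∀ q ∈ starSubmodule (moduleGraph t),
      ∃ η : qhmSpec c μ ν 1, q = (star (η : QHM c μ ν), star (t η)) := fun q hq => by
    obtain ⟨η, e⟩ := mem_moduleGraph.1 (mem_starSubmodule.1 hq)
    exact ⟨η, by rw [← star_star q, ← e]; rfl⟩
  refine ⟨⟨hsZ, fun p hp => ?_, fun q hq => hq, ?_, hZP, hZQ, ?_, ?_, fun p hp => ?_,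
    fun q hq => ?_⟩, ?_, ?_, ?_, ?_⟩
  · rwa [mem_starSubmodule, star_star]
  · rintro _ ⟨a, rfl⟩ _ ⟨a', rfl⟩
    exact ⟨a * a', Prod.ext rfl (map_mul π a a')⟩
  · rintro _ ⟨ξ, rfl⟩ q hq
    obtain ⟨η, rfl⟩ := hQ q hq
    have hm : (ξ : QHM c μ ν) * star (η : QHM c μ ν) ∈ qhmBase c μ ν :=
      mem_qhmBase_iff.2 (by simpa using mul_mem_qhmSpec ξ.2 (star_mem_qhmSpec η.2))
    exact ⟨⟨_, hm⟩, Prod.ext rfl (hr' ξ η hm)⟩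
  · rintro q hq _ ⟨ξ, rfl⟩
    obtain ⟨η, rfl⟩ := hQ q hq
    have hm : star (η : QHM c μ ν) * (ξ : QHM c μ ν) ∈ qhmBase c μ ν :=
      mem_qhmBase_iff.2 (by simpa using mul_mem_qhmSpec (star_mem_qhmSpec η.2) ξ.2)
    exact ⟨⟨_, hm⟩, Prod.ext rfl (hr η ξ hm)⟩
  · exact ⟨_, hone, huniq _ hp _ (hPZ _ hone _ hp) (mul_one _).symm⟩
  · refine ⟨_, hone, star_injective ?_⟩
    rw [star_mul]
    exact huniq _ hq _ (hZP _ (hsZ _ hone) _ hq) (by simp)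
  · rintro _ ⟨a, rfl⟩
    exact mem_qhmBase_iff.1 a.2
  · rintro _ ⟨ξ, rfl⟩
    exact ξ.2
  · intro q hq
    obtain ⟨η, rfl⟩ := hQ q hq
    exact star_mem_qhmSpec η.2
  · rintro _ ⟨a, rfl⟩
    exact norm_apply_le_of_base a

end Rep

/-- The frame of degree one carries the structure: `∑ ξ⋆ξ = 1` gives fullness already without
closure, and `∑ ξξ⋆ = 1` gives injectivity of the left action. Universality is the graph
construction. -/
theorem isPimsnerAlgebra.{v} : IsPimsnerAlgebra.{0, v} (qhmBase c μ ν) (qhmSpec c μ ν 1) where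
  isClosed_base := isClosed_qhmBase
  isClosed_module := isClosed_qhmSpec 1
  left_mul a ha ξ hξ := by simpa using mul_mem_qhmSpec (mem_qhmBase_iff.1 ha) hξ
  right_mul a ha ξ hξ := by simpa using mul_mem_qhmSpec hξ (mem_qhmBase_iff.1 ha)
  inner_right ξ hξ η hη :=
    mem_qhmBase_iff.2 (by simpa using mul_mem_qhmSpec (star_mem_qhmSpec hξ) hη)
  inner_left ξ hξ η hη :=
    mem_qhmBase_iff.2 (by simpa using mul_mem_qhmSpec hξ (star_mem_qhmSpec hη))
  full := by
    refine subset_antisymm (closure_minimal (fun x hx => ?_) isClosed_qhmBase) fun a ha => ?_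
    · have : Submodule.span ℂ {x : QHM c μ ν | ∃ ξ ∈ qhmSpec c μ ν 1, ∃ η ∈ qhmSpec c μ ν 1,
          x = star ξ * η} ≤ qhmSpec c μ ν 0 := Submodule.span_le.2 <| by
        rintro _ ⟨ξ, hξ, η, hη, rfl⟩
        simpa using mul_mem_qhmSpec (star_mem_qhmSpec hξ) hη
      exact mem_qhmBase_iff.2 (this hx)
    · refine subset_closure ?_
      rw [← one_mul a, ← sum_star_incl_frame_mul, Finset.sum_mul]
      refine sum_mem fun i _ => Submodule.subset_span ⟨_, incl_frame_one_mem i, _, ?_, mul_assoc _ _ _⟩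
      simpa using mul_mem_qhmSpec (incl_frame_one_mem i) (mem_qhmBase_iff.1 ha)
  left_injective a _ h := by
    rw [← mul_one a, ← sum_incl_frame_mul_star, Finset.mul_sum]
    refine Finset.sum_eq_zero fun i _ => ?_
    rw [← mul_assoc, h _ (incl_frame_one_mem i), zero_mul]
  generated := by
    refine QHM.dense_span_qhmSpec.mono ?_
    refine fun d hd => Submodule.span_le (p := Subalgebra.toSubmodule (Algebra.adjoin ℂ _)).2 ?_ hd
    rintro d ⟨n, hn⟩
    revert hn
    refine homogeneous_induction (StarAlgHom.id ℂ _) (p := fun _ d => d ∈ Algebra.adjoin ℂ _)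
      incl_frame_one_mem sum_incl_frame_mul_star sum_star_incl_frame_mul ?_ ?_ ?_ ?_ n d
    · exact fun d hd => Algebra.subset_adjoin (Or.inl (mem_qhmBase_iff.2 hd))
    · exact fun _ d d' hd hd' => add_mem hd hd'
    · exact fun _ _ i d hd =>
        mul_mem (Algebra.subset_adjoin (Or.inr (Or.inl (incl_frame_one_mem i)))) hd
    · refine fun _ _ i d hd => mul_mem (Algebra.subset_adjoin (Or.inr (Or.inr ?_))) hd
      rw [star_star]
      exact incl_frame_one_mem i
  universal B _ π t hl hr hr' := by
    have h := isGraphTriple hl hr hr'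
    obtain ⟨ρ, hρ⟩ := h.exists_hom (dense_gradAll h.toIsGradedTriple
      (fun d hd => ⟨_, ⟨d, mem_qhmBase_iff.2 hd⟩, rfl⟩) (fun d hd => ⟨_, ⟨d, hd⟩, rfl⟩))
    exact ⟨ρ, fun a => hρ (a, π a) (mem_gradAll_of_gradDeg (n := 0) ⟨a, rfl⟩),
      fun ξ => hρ (ξ, t ξ) (mem_gradAll_of_gradDeg (h.P_le ⟨ξ, rfl⟩))⟩

theorem isGaugeAction : IsGaugeAction (qhmBase c μ ν) (qhmSpec c μ ν 1) (qhmGauge c μ ν) :=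
  fun t => ⟨fun a ha => ha t, fun ξ hξ => by simpa using hξ t⟩

/-- Sums of homogeneous elements are dense in the smooth topology, and each homogeneous element is a
finite sum of products of frame elements, their adjoints and elements of the base. The frame
consists of smooth elements, so no factor leaves `𝒟`. -/
theorem isGeneratedByModule :
    IsGeneratedByModule (qhmBase c μ ν) (qhmSpec c μ ν 1) (SmoothQHM.incl c μ ν) := by
  refine SmoothQHM.dense_span_homogeneous.mono ?_
  refine fun d hd => Submodule.span_le (p := Subalgebra.toSubmodule (Algebra.adjoin ℂ _)).2 ?_ hd
  rintro d ⟨n, hn⟩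
  revert hn
  refine homogeneous_induction _ (p := fun _ d => d ∈ Algebra.adjoin ℂ _)
    incl_frame_one_mem (sum_frame_mul_star 1) (sum_star_frame_mul 1) ?_ ?_ ?_ ?_ n d
  · exact fun d hd => Algebra.subset_adjoin (Or.inr (Or.inr (mem_qhmBase_iff.2 hd)))
  · exact fun _ d d' hd hd' => add_mem hd hd'
  · exact fun _ _ i d hd =>
      mul_mem (Algebra.subset_adjoin (Or.inl (incl_frame_one_mem i))) hd
  · refine fun _ _ i d hd => mul_mem (Algebra.subset_adjoin (Or.inr (Or.inl ?_))) hd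
    rw [star_star]
    exact incl_frame_one_mem i

end Pimsner

/-! ### Polynomial growth of the frames and tameness -/

section Tame

variable {c : ℤ} {μ ν : ℝ}

theorem SmoothQHM.seminorm_star (w : List (Fin 3)) (d : SmoothQHM c μ ν) :
    SmoothQHM.seminorm w (star d) = SmoothQHM.seminorm w d := by
  rw [seminorm_apply, seminorm_apply, wder_star, map_star, norm_star]

theorem exists_wder_frame_bound (w : List (Fin 3)) :
    ∃ C : ℝ, 0 ≤ C ∧ ∀ n i, ‖SmoothQHM.incl c μ ν (SmoothQHM.wder w (frame c μ ν n i))‖ ≤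
      C * (1 + |(n : ℝ)|) ^ (w.map derWeight).sum := by
  choose C hC using fun i : Fin 2 =>
    wder_cyl_bound (c := c) (μ := μ) (ν := ν) w (⟨_, cylWeight_mem i⟩ : cylSub (cylShift i))
  refine ⟨∑ i, |C i|, Finset.sum_nonneg fun _ _ => abs_nonneg _, fun n i => (hC i n).trans ?_⟩
  gcongr
  exact (le_abs_self _).trans
    (Finset.single_le_sum (f := fun i => |C i|) (fun _ _ => abs_nonneg _) (Finset.mem_univ i))

theorem exists_seminorm_frame_bound {q : Seminorm ℂ (SmoothQHM c μ ν)} (hq : Continuous q) :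
    ∃ (C : ℝ) (k : ℕ), 0 ≤ C ∧ ∀ n i, q (frame c μ ν n i) ≤ C * (1 + |(n : ℝ)|) ^ k ∧
      q (star (frame c μ ν n i)) ≤ C * (1 + |(n : ℝ)|) ^ k := by
  obtain ⟨s, M, hM⟩ := SmoothQHM.exists_seminorm_bound hq
  choose C hC0 hC using exists_wder_frame_bound (c := c) (μ := μ) (ν := ν)
  have key : ∀ n i, M * ∑ w ∈ s, SmoothQHM.seminorm w (frame c μ ν n i) ≤
      M * (∑ w ∈ s, C w) * (1 + |(n : ℝ)|) ^ (s.sup fun w => (w.map derWeight).sum) := by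
    intro n i
    rw [mul_assoc, Finset.sum_mul]
    gcongr with w hw
    refine (hC w n i).trans ?_
    gcongr
    · exact hC0 w
    · linarith [abs_nonneg (n : ℝ)]
    · exact Finset.le_sup (f := fun w : List (Fin 3) => (w.map derWeight).sum) hw
  refine ⟨_, _, mul_nonneg M.2 (Finset.sum_nonneg fun w _ => hC0 w), fun n i =>
    ⟨(hM _).trans (key n i), (hM _).trans ?_⟩⟩
  simp only [SmoothQHM.seminorm_star]
  exact key n i

variable (c μ ν) in
/-- A word of elements of degree one whose product is the frame element of degree `n + 1`. -/
def frameWord (i : Fin 2) : ℕ → List (SmoothQHM c μ ν)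
  | 0 => [frame c μ ν 1 i]
  | n + 1 => frameWord i n ++ [frameStep c μ ν (n + 1) i]

theorem length_frameWord (i : Fin 2) (n : ℕ) : (frameWord c μ ν i n).length = n + 1 := by
  induction n with
  | zero => rfl
  | succ n ih => rw [frameWord, List.length_append, ih]; rfl

theorem prod_frameWord (i : Fin 2) (n : ℕ) :
    (frameWord c μ ν i n).prod = frame c μ ν (n + 1 : ℕ) i := by
  induction n with
  | zero => simp [frameWord]
  | succ n ih => rw [frameWord, List.prod_append, ih, List.prod_singleton, frame_mul_frameStep]

theorem incl_mem_of_mem_frameWord (i : Fin 2) (n : ℕ) :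
    ∀ x ∈ frameWord c μ ν i n, SmoothQHM.incl c μ ν x ∈ qhmSpec c μ ν 1 := by
  induction n with
  | zero => simpa [frameWord] using incl_frame_one_mem i
  | succ n ih =>
    intro x hx
    rw [frameWord, List.mem_append, List.mem_singleton] at hx
    obtain hx | rfl := hx
    · exact ih x hx
    · exact incl_frameStep_mem _ i

/-- Index `2n + j` carries the word of length `n + 1` whose product is the frame element `j` of
degree `n + 1`. Growth is therefore that of the frame, which is polynomial, whereas estimating the
factors of a word separately would not bound it so. -/
theorem isTame : IsTame (qhmSpec c μ ν 1) (SmoothQHM.incl c μ ν) := by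
  refine ⟨2, fun i => frameWord c μ ν (Fin.ofNat 2 i) (i / 2), by norm_num,
    fun i => incl_mem_of_mem_frameWord _ _, fun i => length_frameWord _ _, fun n => ?_,
    fun p hp => ?_⟩
  · have h : ∀ j < 2, (n * 2 + j) / 2 = n := fun j hj => by omega
    simp only [prod_frameWord, Finset.sum_range_succ, Finset.range_zero, Finset.sum_empty, zero_add]
    rw [h 0 (by norm_num), h 1 (by norm_num)]
    have h0 : Fin.ofNat 2 (n * 2 + 0) = 0 := Fin.ext (by simp)
    have h1 : Fin.ofNat 2 (n * 2 + 1) = 1 := Fin.ext (by simp)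
    rw [h0, h1]
    simpa [Fin.sum_univ_two] using sum_frame_mul_star (c := c) (μ := μ) (ν := ν) (n + 1 : ℕ)
  · obtain ⟨C, k, hC0, hC⟩ := exists_seminorm_frame_bound hp
    refine ⟨C * 2 ^ k, k, fun i => ?_⟩
    -- The element with index `i` has degree `i / 2 + 1`, and `1 + (i / 2 + 1) ≤ 2 * (1 + i)`; hence
    -- the factor `2 ^ k`.
    have hle : C * (1 + |(((i / 2 + 1 : ℕ) : ℤ) : ℝ)|) ^ k ≤ C * 2 ^ k * (1 + i : ℝ) ^ k := by
      rw [mul_assoc, ← mul_pow]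
      gcongr
      have : i / 2 ≤ i := Nat.div_le_self _ _
      have : ((i / 2 : ℕ) : ℝ) ≤ i := by exact_mod_cast this
      rw [abs_of_nonneg (by positivity), Int.cast_natCast, Nat.cast_add, Nat.cast_one]
      linarith
    rw [prod_frameWord]
    exact ⟨(hC _ _).1.trans hle, (hC _ _).2.trans hle⟩

/-- The exponent is the total weight of the word: `0` for `∂₁`, `2` for `∂₂` and `1` for `∂₃`. -/
theorem exists_heisDer_frame_bound (n₁ n₂ n₃ : ℕ) : ∃ C : ℝ, ∀ n i,
    ‖(heisDer c μ ν 2)^[n₃] ((heisDer c μ ν 1)^[n₂] ((heisDer c μ ν 0)^[n₁]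
      (SmoothQHM.incl c μ ν (frame c μ ν n i))))‖ ≤ C * (1 + |(n : ℝ)|) ^ (n₃ + 2 * n₂) := by
  obtain ⟨C, -, hC⟩ := exists_wder_frame_bound (c := c) (μ := μ) (ν := ν)
    (List.replicate n₃ 2 ++ (List.replicate n₂ 1 ++ List.replicate n₁ 0))
  have h : ∀ (k : ℕ) (j : Fin 3) (d : QHM c μ ν),
      (List.replicate k j).foldr (heisDer c μ ν) d = (heisDer c μ ν j)^[k] d := fun k j d => by
    induction k with
    | zero => rfl
    | succ k ih => rw [List.replicate_succ, List.foldr_cons, ih, Function.iterate_succ_apply']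
  refine ⟨C, fun n i => ?_⟩
  have := hC n i
  rw [SmoothQHM.incl_wder, List.foldr_append, List.foldr_append, h, h, h] at this
  refine this.trans (le_of_eq ?_)
  simp [derWeight, mul_comm]

end Tame

/-! ### Projective tensor products -/

section Projective

variable {V W : Type*} [AddCommGroup V] [Module ℂ V] [AddCommGroup W] [Module ℂ W]

/-- An estimate on elementary tensors is summed over any representation of `z` and survives the
infimum. All continuity statements for projective tensor products go through it. -/
theorem le_projSeminorm {F : Type*} [AddCommGroup F] [Module ℂ F] {p : Seminorm ℂ V}
    {q : Seminorm ℂ W} {r : Seminorm ℂ F} (L : V ⊗[ℂ] W →ₗ[ℂ] F) {C : ℝ} (hC : 0 ≤ C)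
    (h : ∀ v w, r (L (v ⊗ₜ w)) ≤ C * (p v * q w)) (z : V ⊗[ℂ] W) :
    r (L z) ≤ C * projSeminorm p q z := by
  change _ ≤ C • sInf (projValues p q z)
  rw [← Real.sInf_smul_of_nonneg hC]
  refine le_csInf ((projValues_nonempty p q z).smul_set) ?_
  rintro _ ⟨_, ⟨l, rfl, rfl⟩, rfl⟩
  induction l with
  | nil => simp
  | cons a l ih =>
    simp only [List.map_cons, List.sum_cons, map_add, smul_eq_mul, mul_add] at ih ⊢
    exact (map_add_le_add r _ _).trans (add_le_add (h _ _) ih)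

namespace ProjTensor

/-- The elementary tensors. -/
def tmul (v : V) (w : W) : ProjTensor V W := (v ⊗ₜ[ℂ] w : V ⊗[ℂ] W)

/-- The tensor product of two linear maps. -/
def map {V' W' : Type*} [AddCommGroup V'] [Module ℂ V'] [AddCommGroup W'] [Module ℂ W']
    (f : V →ₗ[ℂ] V') (g : W →ₗ[ℂ] W') : ProjTensor V W →ₗ[ℂ] ProjTensor V' W' :=
  (TensorProduct.map f g : V ⊗[ℂ] W →ₗ[ℂ] V' ⊗[ℂ] W')

/-- The tensor product of two seminorms. -/
def semi (p : Seminorm ℂ V) (q : Seminorm ℂ W) : Seminorm ℂ (ProjTensor V W) := projSeminorm p q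

theorem semi_tmul_le (p : Seminorm ℂ V) (q : Seminorm ℂ W) (v : V) (w : W) :
    semi p q (tmul v w) ≤ p v * q w :=
  csInf_le ⟨0, projValues_nonneg p q _⟩ ⟨[(v, w)], by simp [tmul], by simp⟩

theorem le_semi {F : Type*} [AddCommGroup F] [Module ℂ F] {p : Seminorm ℂ V}
    {q : Seminorm ℂ W} {r : Seminorm ℂ F} (L : ProjTensor V W →ₗ[ℂ] F) {C : ℝ} (hC : 0 ≤ C)
    (h : ∀ v w, r (L (tmul v w)) ≤ C * (p v * q w)) (z : ProjTensor V W) :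
    r (L z) ≤ C * semi p q z := le_projSeminorm (V := V) (W := W) L hC h z

variable [TopologicalSpace V] [TopologicalSpace W]

theorem continuous_semi {p : Seminorm ℂ V} {q : Seminorm ℂ W} (hp : Continuous p)
    (hq : Continuous q) : Continuous (semi p q) :=
  (ProjTensor.withSeminorms V W).continuous_seminorm (⟨p, hp⟩, ⟨q, hq⟩)

theorem continuous_of_le {F : Type*} [AddCommGroup F] [Module ℂ F] [TopologicalSpace F]
    {ι : Type*} {r : SeminormFamily ℂ F ι} (hr : WithSeminorms r) (L : ProjTensor V W →ₗ[ℂ] F)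
    (h : ∀ i, ∃ (p : Seminorm ℂ V) (q : Seminorm ℂ W), Continuous p ∧ Continuous q ∧
      ∀ v w, r i (L (tmul v w)) ≤ p v * q w) : Continuous L := by
  refine WithSeminorms.continuous_of_continuous_comp hr L fun i => ?_
  obtain ⟨p, q, hp, hq, h⟩ := h i
  refine Seminorm.continuous_of_le (continuous_semi hp hq) fun z => ?_
  have := le_semi (r := r i) (p := p) (q := q) L zero_le_one
    (fun v w => by rw [one_mul]; exact h v w) z
  rwa [one_mul] at this

theorem continuous_map {V' W' : Type*} [AddCommGroup V'] [Module ℂ V'] [AddCommGroup W']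
    [Module ℂ W'] [TopologicalSpace V'] [TopologicalSpace W'] {f : V →ₗ[ℂ] V'} {g : W →ₗ[ℂ] W'}
    (hf : Continuous f) (hg : Continuous g) : Continuous (map f g) := by
  refine continuous_of_le (ProjTensor.withSeminorms V' W') (map f g) fun ⟨p, q⟩ => ?_
  refine ⟨p.1.comp f, q.1.comp g, p.2.comp hf, q.2.comp hg, fun v w => ?_⟩
  exact semi_tmul_le p.1 q.1 (f v) (g w)

theorem uniformContinuous_map {V' W' : Type*} [AddCommGroup V'] [Module ℂ V']
    [AddCommGroup W'] [Module ℂ W'] [TopologicalSpace V'] [TopologicalSpace W'] {f : V →ₗ[ℂ] V'}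
    {g : W →ₗ[ℂ] W'} (hf : Continuous f) (hg : Continuous g) : UniformContinuous (map f g) :=
  uniformContinuous_addMonoidHom_of_continuous (continuous_map hf hg)

end ProjTensor

end Projective

/-! ### Algebras with jointly continuous multiplication -/

section LCMul

/-- Joint continuity of the multiplication in terms of seminorms. -/
def IsSeminormMul (V : Type*) [Ring V] [Algebra ℂ V] [TopologicalSpace V] : Prop :=
  ∀ q : Seminorm ℂ V, Continuous q → ∃ s : Seminorm ℂ V, Continuous s ∧
    ∀ x y, q (x * y) ≤ s x * s y

variable {V : Type*} [Ring V] [Algebra ℂ V] [TopologicalSpace V]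

theorem seminorm_sum_apply {ι E : Type*} [AddCommGroup E] [Module ℂ E]
    (p : ι → Seminorm ℂ E) (s : Finset ι) (d : E) : (∑ i ∈ s, p i) d = ∑ i ∈ s, p i d := by
  classical
  induction s using Finset.induction_on with
  | empty => simp
  | insert a t ha ih => rw [Finset.sum_insert ha, Finset.sum_insert ha, ← ih]; rfl

theorem isSeminormMul_of_withSeminorms {ι : Type*} {p : SeminormFamily ℂ V ι} (hp : WithSeminorms p)
    (h : ∀ i, ∃ s : Seminorm ℂ V, Continuous s ∧ ∀ x y, p i (x * y) ≤ s x * s y) :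
    IsSeminormMul V := fun q hq => by
  obtain ⟨s, C, -, hle⟩ := Seminorm.bound_of_continuous hp q hq
  choose t ht hmul using h
  have hap : ∀ x, ((C + 1) • ∑ i ∈ s, t i) x = (C + 1) * ∑ i ∈ s, t i x := fun x => by
    rw [smul_apply, seminorm_sum_apply, NNReal.smul_def, smul_eq_mul]; rfl
  -- The factor `C + 1` occurs in both seminorms, and `C ≤ (C + 1)²`.
  refine ⟨(C + 1) • ∑ i ∈ s, t i, ?_, fun x y => ?_⟩
  · have : Continuous fun x => ((C : ℝ) + 1) * ∑ i ∈ s, t i x :=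
      continuous_const.mul (continuous_finsetSum _ fun i _ => ht i)
    exact this.congr fun x => (hap x).symm
  · rw [hap, hap]
    have h1 : q (x * y) ≤ C * ∑ i ∈ s, p i (x * y) := by
      refine (hle (x * y)).trans ?_
      rw [smul_apply, NNReal.smul_def, smul_eq_mul]
      gcongr
      exact (Seminorm.finset_sup_le_sum p s (x * y)).trans (seminorm_sum_apply _ _ _).le
    have h2 : ∑ i ∈ s, p i (x * y) ≤ (∑ i ∈ s, t i x) * ∑ i ∈ s, t i y := by
      rw [Finset.sum_mul]
      refine Finset.sum_le_sum fun i hi => (hmul i x y).trans ?_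
      gcongr
      exact Finset.single_le_sum (f := fun i => t i y) (fun _ _ => apply_nonneg _ _) hi
    have h3 : 0 ≤ (∑ i ∈ s, t i x) * ∑ i ∈ s, t i y :=
      mul_nonneg (Finset.sum_nonneg fun _ _ => apply_nonneg _ _)
        (Finset.sum_nonneg fun _ _ => apply_nonneg _ _)
    have hC : (0 : ℝ) ≤ C := C.2
    calc q (x * y) ≤ C * ((∑ i ∈ s, t i x) * ∑ i ∈ s, t i y) := h1.trans (by gcongr)
      _ ≤ (C + 1) * (C + 1) * ((∑ i ∈ s, t i x) * ∑ i ∈ s, t i y) := by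
        gcongr; nlinarith
      _ = _ := by ring

theorem ContinuousMul.of_seminorms {V : Type*} [Ring V] [Module ℂ V] [TopologicalSpace V]
    [IsTopologicalAddGroup V] {ι : Type*} {p : SeminormFamily ℂ V ι} (hp : WithSeminorms p)
    (h : ∀ i, ∃ s : Seminorm ℂ V, Continuous s ∧ ∀ x y, p i (x * y) ≤ s x * s y) :
    ContinuousMul V := by
  refine ⟨continuous_iff_continuousAt.2 fun ⟨a, b⟩ => ?_⟩
  rw [ContinuousAt, hp.tendsto_nhds]
  intro i ε hε
  obtain ⟨s, hs, hmul⟩ := h i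
  have hcont : Continuous fun z : V × V =>
      s (z.1 - a) * s (z.2 - b) + s (z.1 - a) * s b + s a * s (z.2 - b) := by fun_prop
  have h0 := hcont.tendsto (a, b)
  simp only [sub_self, map_zero, zero_mul, mul_zero, add_zero] at h0
  filter_upwards [h0.eventually (gt_mem_nhds hε)] with z hz
  refine lt_of_le_of_lt ?_ hz
  have e : z.1 * z.2 - a * b = (z.1 - a) * (z.2 - b) + (z.1 - a) * b + a * (z.2 - b) := by
    noncomm_ring
  rw [e]
  refine (map_add_le_add _ _ _).trans (add_le_add ((map_add_le_add _ _ _).trans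
    (add_le_add (hmul _ _) (hmul _ _))) (hmul _ _))

theorem ProjTensor.tmul_mul_tmul {W : Type*} [Ring W] [Algebra ℂ W] (v v' : V) (w w' : W) :
    tmul v w * tmul v' w' = tmul (v * v') (w * w') :=
  Algebra.TensorProduct.tmul_mul_tmul v v' w w'

/-- The estimate for elementary tensors is extended to one factor at a time, as each one-sided
multiplication is linear. -/
theorem ProjTensor.continuousMul {W : Type*} [Ring W] [Algebra ℂ W] [TopologicalSpace W]
    (hV : IsSeminormMul V) (hW : IsSeminormMul W) : ContinuousMul (ProjTensor V W) := by
  refine ContinuousMul.of_seminorms (ProjTensor.withSeminorms V W) fun ⟨p, q⟩ => ?_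
  obtain ⟨p', hp', hpp⟩ := hV p.1 p.2
  obtain ⟨q', hq', hqq⟩ := hW q.1 q.2
  refine ⟨semi p' q', continuous_semi hp' hq', fun x y => ?_⟩
  have h1 : ∀ v w y, semi p.1 q.1 (tmul v w * y) ≤ (p' v * q' w) * semi p' q' y := fun v w y => by
    refine le_semi (r := semi p.1 q.1)
      (LinearMap.mulLeft ℂ (v ⊗ₜ w : V ⊗[ℂ] W) : V ⊗[ℂ] W →ₗ[ℂ] V ⊗[ℂ] W) (by positivity)
      (fun v' w' => ?_) y
    change semi p.1 q.1 (tmul v w * tmul v' w') ≤ _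
    rw [tmul_mul_tmul]
    refine (semi_tmul_le _ _ _ _).trans ?_
    calc p.1 (v * v') * q.1 (w * w') ≤ (p' v * p' v') * (q' w * q' w') :=
          mul_le_mul (hpp _ _) (hqq _ _) (apply_nonneg _ _) (by positivity)
      _ = _ := by ring
  change semi p.1 q.1 (x * y) ≤ _
  rw [mul_comm]
  refine le_semi (r := semi p.1 q.1)
      (LinearMap.mulRight ℂ (y : V ⊗[ℂ] W) : V ⊗[ℂ] W →ₗ[ℂ] V ⊗[ℂ] W) (apply_nonneg _ _)
      (fun v w => ?_) x
  change semi p.1 q.1 (tmul v w * y) ≤ _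
  rw [mul_comm]
  exact h1 v w y

end LCMul

/-! ### Summable families of linear maps into a completion -/

section SummableFamily

variable {κ D X ι : Type*} [AddCommGroup D] [Module ℂ D] [TopologicalSpace D]
  [IsTopologicalAddGroup D]
  [AddCommGroup X] [Module ℂ X] [UniformSpace X] [IsUniformAddGroup X]
  [UniformContinuousConstSMul ℂ X] {P : SeminormFamily ℂ X ι}

/-- A family of linear maps that is summable, uniformly on bounded sets. -/
def IsSummableFamily (P : SeminormFamily ℂ X ι) (u : κ → D →ₗ[ℂ] X) : Prop :=
  ∀ i, ∃ (c : κ → ℝ) (p : Seminorm ℂ D), (∀ n, 0 ≤ c n) ∧ Summable c ∧ Continuous p ∧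
    ∀ n d, P i (u n d) ≤ c n * p d

variable {u : κ → D →ₗ[ℂ] X}

theorem seminorm_sum_le {p : Seminorm ℂ X} {x : κ → X} {c : κ → ℝ} (h : ∀ n, p (x n) ≤ c n)
    (t : Finset κ) : p (∑ n ∈ t, x n) ≤ ∑ n ∈ t, c n := by
  classical
  induction t using Finset.induction_on with
  | empty => simp
  | insert a t ha ih =>
    rw [Finset.sum_insert ha, Finset.sum_insert ha]
    exact (map_add_le_add p _ _).trans (add_le_add (h a) ih)

/-- A neighbourhood of `0` in the completion restricts to one in `X` and there contains a ball of
finitely many seminorms. Finite partial sums are thus controlled without extending the seminorms to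
the completion. -/
theorem IsSummableFamily.exists_bound (hP : WithSeminorms P) (hu : IsSummableFamily P u)
    {e : Set (UniformSpace.Completion X)} (he : e ∈ 𝓝 0) :
    ∃ (s : Finset ι) (r : ℝ) (c : ι → κ → ℝ) (p : ι → Seminorm ℂ D), 0 < r ∧ (∀ i n, 0 ≤ c i n) ∧
      (∀ i, Summable (c i)) ∧ (∀ i, Continuous (p i)) ∧
      ∀ (t : Finset κ) d, (∀ i ∈ s, ∑ n ∈ t, c i n * p i d < r) →
        ∑ n ∈ t, (u n d : UniformSpace.Completion X) ∈ e := by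
  have he' : (fun x : X => (x : UniformSpace.Completion X)) ⁻¹' e ∈ 𝓝 (0 : X) :=
    (UniformSpace.Completion.continuous_coe X).continuousAt.preimage_mem_nhds
      (by rwa [UniformSpace.Completion.coe_zero])
  obtain ⟨⟨s, r⟩, hr, hsub⟩ := hP.hasBasis_zero_ball.mem_iff.1 he'
  choose c p hc0 hc hp hle using hu
  refine ⟨s, r, c, p, hr, hc0, hc, hp, fun t d h => ?_⟩
  have hmem := hsub (a := ∑ n ∈ t, u n d) ?_
  · rw [Set.mem_preimage] at hmem
    have := map_sum (UniformSpace.Completion.toCompl (α := X)) (fun n => u n d) t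
    simp only [UniformSpace.Completion.toCompl_apply] at this
    rwa [← this]
  · rw [Seminorm.mem_ball_zero]
    exact Seminorm.finset_sup_apply_lt hr fun i hi =>
      (seminorm_sum_le (fun n => hle i n d) t).trans_lt (h i hi)

theorem IsSummableFamily.summable (hP : WithSeminorms P) (hu : IsSummableFamily P u) (d : D) :
    Summable fun n => (u n d : UniformSpace.Completion X) := by
  classical
  rw [summable_iff_vanishing]
  intro e he
  obtain ⟨s, r, c, p, hr, -, hc, -, h⟩ := hu.exists_bound hP he
  have hvan : ∀ i, ∃ s₀ : Finset κ, ∀ t : Finset κ, Disjoint t s₀ →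
      ∑ n ∈ t, c i n * p i d < r := fun i => by
    obtain ⟨s₀, h₀⟩ := summable_iff_vanishing.1 ((hc i).mul_right (p i d)) (Set.Iio r)
      (Iio_mem_nhds hr)
    exact ⟨s₀, h₀⟩
  choose s₀ hs₀ using hvan
  refine ⟨s.biUnion s₀, fun t ht => h t d fun i hi => hs₀ i t ?_⟩
  exact ht.mono_right (Finset.subset_biUnion_of_mem s₀ hi)

/-- The sum of a summable family of linear maps. -/
def IsSummableFamily.sum (hP : WithSeminorms P) (hu : IsSummableFamily P u) :
    D →ₗ[ℂ] UniformSpace.Completion X where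
  toFun d := ∑' n, (u n d : UniformSpace.Completion X)
  map_add' d d' := by
    simp only [map_add, UniformSpace.Completion.coe_add]
    exact (hu.summable hP d).tsum_add (hu.summable hP d')
  map_smul' a d := by
    simp only [map_smul, UniformSpace.Completion.coe_smul, RingHom.id_apply]
    exact (hu.summable hP d).tsum_const_smul a

theorem IsSummableFamily.hasSum (hP : WithSeminorms P) (hu : IsSummableFamily P u) (d : D) :
    HasSum (fun n => (u n d : UniformSpace.Completion X)) (hu.sum hP d) :=
  (hu.summable hP d).hasSum

/-- For `d` near `0` all partial sums lie in a given closed neighbourhood of `0`, and so does their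
limit; closed neighbourhoods form a basis. -/
theorem IsSummableFamily.continuous_sum (hP : WithSeminorms P) (hu : IsSummableFamily P u) :
    Continuous (hu.sum hP) := by
  refine continuous_of_continuousAt_zero (hu.sum hP) ?_
  rw [ContinuousAt, map_zero, (closed_nhds_basis (0 : UniformSpace.Completion X)).tendsto_right_iff]
  rintro e ⟨he, hcl⟩
  obtain ⟨s, r, c, p, hr, hc0, hc, hp, h⟩ := hu.exists_bound hP he
  have hev : ∀ᶠ d in 𝓝 (0 : D), ∀ i ∈ s, (∑' n, c i n) * p i d < r := by
    rw [eventually_all_finset]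
    intro i hi
    have : Tendsto (fun d => (∑' n, c i n) * p i d) (𝓝 0) (𝓝 0) := by
      have := ((hp i).const_mul (∑' n, c i n)).tendsto 0
      simpa using this
    exact this.eventually (gt_mem_nhds hr)
  filter_upwards [hev] with d hd
  refine hcl.mem_of_tendsto (hu.hasSum hP d) (Eventually.of_forall fun t => h t d fun i hi => ?_)
  refine lt_of_le_of_lt ?_ (hd i hi)
  rw [← Finset.sum_mul]
  gcongr
  exact (hc i).sum_le_tsum t fun n _ => hc0 i n

end SummableFamily

/-! ### The Fréchet algebra of smooth functions on the circle -/

namespace SmoothCircle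

theorem ext_eval {f g : SmoothCircle} (h : ∀ t, eval t f = eval t g) : f = g :=
  Subtype.ext (funext h)

theorem eval_mul (t : ℝ) (f g : SmoothCircle) : eval t (f * g) = eval t f * eval t g := rfl

theorem differentiableAt_eval (f : SmoothCircle) (t : ℝ) :
    DifferentiableAt ℝ (fun t => eval t f) t :=
  (f.contDiff.differentiable (by simp)).differentiableAt

/-- The derivative as a linear map. -/
def derL : SmoothCircle →ₗ[ℂ] SmoothCircle where
  toFun := derivative
  map_add' f g := ext_eval fun t => by
    change deriv (fun t => eval t (f + g)) t = deriv _ t + deriv _ t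
    simp only [map_add]
    exact deriv_fun_add (f.differentiableAt_eval t) (g.differentiableAt_eval t)
  map_smul' a f := ext_eval fun t => by
    change deriv (fun t => eval t (a • f)) t = a • deriv _ t
    simp only [map_smul]
    exact deriv_fun_const_smul a (f.differentiableAt_eval t)

theorem eval_derL (t : ℝ) (f : SmoothCircle) : eval t (derL f) = deriv (fun t => eval t f) t := rfl

theorem derL_mul (f g : SmoothCircle) : derL (f * g) = derL f * g + f * derL g :=
  ext_eval fun t => by
    rw [map_add, eval_mul, eval_mul, eval_derL, eval_derL, eval_derL]
    simp only [eval_mul]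
    exact deriv_fun_mul (f.differentiableAt_eval t) (g.differentiableAt_eval t)

theorem eval_derL_pow (k : ℕ) (f : SmoothCircle) :
    (fun t => eval t ((derL ^ k) f)) = iteratedDeriv k fun t => eval t f := by
  induction k with
  | zero => simp
  | succ k ih =>
    rw [iteratedDeriv_succ, ← ih, pow_succ']
    rfl

theorem exists_bound (f : SmoothCircle) : ∃ C, ∀ t, ‖eval t f‖ ≤ C := by
  obtain ⟨C, hC⟩ := (isCompact_Icc : IsCompact (Set.Icc (0 : ℝ) 1)).exists_bound_of_continuousOn
    f.contDiff.continuous.continuousOn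
  refine ⟨C, fun t => ?_⟩
  have hp : Function.Periodic (fun t => eval t f) 1 := f.periodic
  obtain ⟨t', ht', e⟩ := hp.exists_mem_Ico₀ one_pos t
  rw [e]
  exact hC _ (Set.Ico_subset_Icc_self ht')

theorem bddAbove_norm (f : SmoothCircle) : BddAbove (Set.range fun t => ‖eval t f‖) := by
  obtain ⟨C, hC⟩ := f.exists_bound
  exact ⟨C, by rintro _ ⟨t, rfl⟩; exact hC t⟩

/-- The supremum norm. -/
def supSeminorm : Seminorm ℂ SmoothCircle :=
  Seminorm.ofSMulLE (fun f => ⨆ t, ‖eval t f‖) (by simp)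
    (fun f g => ciSup_le fun t => by
      rw [map_add]
      exact (norm_add_le _ _).trans
        (add_le_add (le_ciSup f.bddAbove_norm t) (le_ciSup g.bddAbove_norm t)))
    (fun a f => ciSup_le fun t => by
      rw [map_smul, norm_smul]
      exact mul_le_mul_of_nonneg_left (le_ciSup f.bddAbove_norm t) (norm_nonneg a))

theorem norm_eval_le (f : SmoothCircle) (t : ℝ) : ‖eval t f‖ ≤ supSeminorm f :=
  le_ciSup f.bddAbove_norm t

theorem supSeminorm_le {f : SmoothCircle} {C : ℝ} (h : ∀ t, ‖eval t f‖ ≤ C) :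
    supSeminorm f ≤ C := ciSup_le h

/-- The seminorms that define the topology. -/
def seminorm : SeminormFamily ℂ SmoothCircle ℕ := fun k => supSeminorm.comp (derL ^ k)

theorem seminorm_apply (k : ℕ) (f : SmoothCircle) :
    seminorm k f = supSeminorm ((derL ^ k) f) := rfl

/-- The `k`-th derivative with the topology of uniform convergence. -/
def derU (k : ℕ) : SmoothCircle →+ UniformFun ℝ ℂ where
  toFun f := UniformFun.ofFun fun t => eval t ((derL ^ k) f)
  map_zero' := by simp only [map_zero]; rfl
  map_add' f g := by simp only [map_add]; rfl

theorem topology_eq : (inferInstance : TopologicalSpace SmoothCircle) =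
    ⨅ k : ℕ, TopologicalSpace.induced (derU k) inferInstance := by
  refine iInf_congr fun k => ?_
  congr 1
  funext f
  exact congr_arg UniformFun.ofFun (eval_derL_pow k f).symm

instance : IsTopologicalAddGroup SmoothCircle := by
  have := topologicalAddGroup_iInf (ts' := fun k : ℕ => TopologicalSpace.induced (derU k)
    inferInstance) fun k => topologicalAddGroup_induced (derU k)
  rwa [← topology_eq] at this

theorem withSeminorms : WithSeminorms seminorm := by
  rw [SeminormFamily.withSeminorms_iff_nhds_eq_iInf]
  refine (congr_arg (fun t => @nhds _ t 0) topology_eq).trans ?_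
  rw [nhds_iInf]
  refine iInf_congr fun k => ?_
  rw [nhds_induced, map_zero]
  refine le_antisymm (tendsto_iff_comap.1 ?_) (tendsto_iff_comap.1 ?_)
  · have h : Tendsto (derU k) (comap (derU k) (𝓝 0)) (𝓝 0) := tendsto_comap
    rw [UniformFun.tendsto_iff_tendstoUniformly, Metric.tendstoUniformly_iff] at h
    rw [Metric.tendsto_nhds]
    intro ε hε
    filter_upwards [h (ε / 2) (by positivity)] with f hf
    rw [Real.dist_eq, sub_zero, abs_of_nonneg (apply_nonneg _ _), seminorm_apply]
    refine (supSeminorm_le fun t => ?_).trans_lt (half_lt_self hε)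
    have := hf t
    rw [dist_comm, dist_eq_norm] at this
    have e : UniformFun.toFun (0 : UniformFun ℝ ℂ) t = 0 := rfl
    rw [e, sub_zero] at this
    exact this.le
  · rw [UniformFun.tendsto_iff_tendstoUniformly, Metric.tendstoUniformly_iff]
    intro ε hε
    have h : Tendsto (seminorm k) (comap (seminorm k) (𝓝 0)) (𝓝 0) := tendsto_comap
    filter_upwards [h.eventually (gt_mem_nhds hε)] with f hf t
    rw [dist_comm, dist_eq_norm]
    have e : UniformFun.toFun (0 : UniformFun ℝ ℂ) t = 0 := rfl
    rw [e, sub_zero]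
    exact (norm_eval_le ((derL ^ k) f) t).trans_lt hf

theorem continuous_derL : Continuous derL := by
  refine WithSeminorms.continuous_of_continuous_comp withSeminorms _ fun k => ?_
  have : (seminorm k).comp derL = seminorm (k + 1) := by
    ext f
    rw [seminorm_apply, pow_succ]
    rfl
  rw [this]
  exact withSeminorms.continuous_seminorm _

theorem isSeminormMul : IsSeminormMul SmoothCircle := by
  refine isSeminormMul_of_withSeminorms withSeminorms fun k => ?_
  induction k with
  | zero =>
    refine ⟨seminorm 0, withSeminorms.continuous_seminorm 0, fun f g => ?_⟩
    refine supSeminorm_le fun t => ?_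
    change ‖eval t (f * g)‖ ≤ _
    rw [eval_mul, norm_mul]
    exact mul_le_mul (norm_eval_le f t) (norm_eval_le g t) (norm_nonneg _) (apply_nonneg _ _)
  | succ k ih =>
    obtain ⟨s, hs, h⟩ := ih
    refine ⟨s + s.comp derL, hs.add (hs.comp continuous_derL), fun f g => ?_⟩
    have e : seminorm (k + 1) (f * g) = seminorm k (derL f * g + f * derL g) := by
      rw [← derL_mul, seminorm_apply, pow_succ]; rfl
    rw [e]
    refine (map_add_le_add _ _ _).trans ((add_le_add (h _ _) (h _ _)).trans ?_)
    have h1 := apply_nonneg s f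
    have h2 := apply_nonneg s g
    have h3 := apply_nonneg s (derL f)
    have h4 := apply_nonneg s (derL g)
    change _ ≤ (s f + s (derL f)) * (s g + s (derL g))
    nlinarith

/-- The character `t ↦ e(nt)`. -/
def char (n : ℤ) : SmoothCircle :=
  ⟨fun t => ee (n * t), contDiff_ee.comp (by fun_prop), fun t => by
    beta_reduce
    rw [mul_add, mul_one, ee_add, ee_intCast, mul_one]⟩

theorem eval_char (n : ℤ) (t : ℝ) : eval t (char n) = ee (n * t) := rfl

theorem char_zero : char 0 = 1 := ext_eval fun t => by
  rw [eval_char, Int.cast_zero, zero_mul, ee_zero]; rfl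

theorem char_mul (m n : ℤ) : char m * char n = char (m + n) := ext_eval fun t => by
  rw [eval_mul, eval_char, eval_char, eval_char, ← ee_add]
  congr 1
  push_cast
  ring

theorem derL_char (n : ℤ) : derL (char n) = (2 * Real.pi * Complex.I * n : ℂ) • char n :=
  ext_eval fun t => by
    rw [map_smul, eval_derL]
    simp only [eval_char]
    have := ((hasDerivAt_id t).const_mul (n : ℝ)).ee_comp
    simp only [id, mul_one] at this
    rw [this.deriv]
    push_cast
    simp only [smul_eq_mul]

theorem seminorm_char_le (k : ℕ) (n : ℤ) :
    seminorm k (char n) ≤ (2 * Real.pi) ^ k * (1 + |(n : ℝ)|) ^ k := by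
  have h : (derL ^ k) (char n) = (2 * Real.pi * Complex.I * n : ℂ) ^ k • char n := by
    induction k with
    | zero => simp
    | succ k ih =>
      rw [pow_succ', Module.End.mul_apply, ih, map_smul, derL_char, smul_smul, pow_succ]
  rw [seminorm_apply, h, map_smul_eq_mul, norm_pow]
  have h1 : supSeminorm (char n) ≤ 1 := supSeminorm_le fun t => by rw [eval_char, norm_ee]
  have h2 : ‖(2 * Real.pi * Complex.I * n : ℂ)‖ ≤ 2 * Real.pi * (1 + |(n : ℝ)|) := by
    simp only [norm_mul, Complex.norm_ofNat, Complex.norm_real, Complex.norm_I,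
      Complex.norm_intCast, Real.norm_eq_abs, abs_of_pos Real.pi_pos, mul_one]
    gcongr
    linarith
  rw [← mul_pow]
  calc _ ≤ ‖(2 * Real.pi * Complex.I * n : ℂ)‖ ^ k * 1 := by gcongr
    _ ≤ _ := by rw [mul_one]; gcongr

theorem exists_char_bound {q : Seminorm ℂ SmoothCircle} (hq : Continuous q) :
    ∃ (C : ℝ) (k : ℕ), 0 ≤ C ∧ ∀ n, q (char n) ≤ C * (1 + |(n : ℝ)|) ^ k := by
  obtain ⟨s, M, -, hM⟩ := Seminorm.bound_of_continuous withSeminorms q hq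
  have hpi := Real.pi_pos
  refine ⟨M * ∑ k ∈ s, (2 * Real.pi) ^ k, s.sup id, by positivity, fun n => ?_⟩
  refine (hM _).trans ?_
  rw [smul_apply, NNReal.smul_def, smul_eq_mul, mul_assoc, Finset.sum_mul]
  have hM0 : (0 : ℝ) ≤ M := M.2
  gcongr
  refine ((Seminorm.finset_sup_le_sum seminorm s _).trans (seminorm_sum_apply _ _ _).le).trans ?_
  refine Finset.sum_le_sum fun k hk => (seminorm_char_le k n).trans ?_
  gcongr
  · linarith [abs_nonneg (n : ℝ)]
  · exact Finset.le_sup (f := id) hk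

end SmoothCircle

theorem SmoothQHM.isSeminormMul {c : ℤ} {μ ν : ℝ} : IsSeminormMul (SmoothQHM c μ ν) := by
  refine isSeminormMul_of_withSeminorms withSeminorms fun w => ?_
  induction w using List.reverseRecOn with
  | nil =>
    refine ⟨seminorm [], withSeminorms.continuous_seminorm _, fun f g => ?_⟩
    rw [seminorm_apply, wder_nil, map_mul]
    exact norm_mul_le _ _
  | append_singleton w i ih =>
    obtain ⟨s, hs, h⟩ := ih
    refine ⟨s + s.comp (der i), hs.add (hs.comp (continuous_der i)), fun f g => ?_⟩
    have e : seminorm (w ++ [i]) (f * g) = seminorm w (der i f * g + f * der i g) := by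
      rw [← der_mul, seminorm_apply, wder_append]; rfl
    rw [e]
    refine (map_add_le_add _ _ _).trans ((add_le_add (h _ _) (h _ _)).trans ?_)
    have h1 := apply_nonneg s f
    have h2 := apply_nonneg s g
    have h3 := apply_nonneg s (der i f)
    have h4 := apply_nonneg s (der i g)
    change _ ≤ (s f + s (der i f)) * (s g + s (der i g))
    nlinarith

/-! ### Gauge smoothness -/

section GaugeSmooth

variable {c : ℤ} {μ ν : ℝ}

instance : ContinuousMul (ProjTensor SmoothCircle (SmoothQHM c μ ν)) :=
  ProjTensor.continuousMul SmoothCircle.isSeminormMul SmoothQHM.isSeminormMul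

instance : IsTopologicalRing (ProjTensor SmoothCircle (SmoothQHM c μ ν)) where

namespace SmoothQHM

/-- The gauge action on the smooth elements. -/
def gauge (t : ℝ) (d : SmoothQHM c μ ν) : SmoothQHM c μ ν :=
  mk (qhmGauge c μ ν t (incl c μ ν d)) (by
    have h := mem_qhmSmooth_iff.1 d.incl_mem
    rw [mem_qhmSmooth_iff]
    simp only [heisAct_qhmGauge]
    exact ((heisActL c μ ν (0, 0, -t)).restrictScalars ℝ).contDiff.comp h)

theorem incl_gauge (t : ℝ) (d : SmoothQHM c μ ν) :
    incl c μ ν (gauge t d) = qhmGauge c μ ν t (incl c μ ν d) := rfl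

theorem der_gauge (i : Fin 3) (t : ℝ) (d : SmoothQHM c μ ν) :
    der i (gauge t d) = gauge t (der i d) := by
  refine incl_injective ?_
  rw [incl_der, incl_gauge, incl_gauge, incl_der, heisDer]
  simp only [heisAct_qhmGauge]
  exact (((heisActL c μ ν (0, 0, -t)).restrictScalars ℝ).hasFDerivAt.comp_hasDerivAt (0 : ℝ)
    (hasDerivAt_heisAct d.incl_mem i)).deriv

theorem wder_gauge (w : List (Fin 3)) (t : ℝ) (d : SmoothQHM c μ ν) :
    wder w (gauge t d) = gauge t (wder w d) := by
  induction w with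
  | nil => rfl
  | cons i w ih => rw [wder_cons, ih, der_gauge, wder_cons]

theorem continuous_gauge (t : ℝ) : Continuous (gauge (c := c) (μ := μ) (ν := ν) t) := by
  refine continuous_of_wderI fun w => ?_
  simp only [wderI_apply, wder_gauge, incl_gauge]
  exact (continuous_heisAct _).comp (continuous_wderI w)

theorem gauge_add (t : ℝ) (d d' : SmoothQHM c μ ν) : gauge t (d + d') = gauge t d + gauge t d' :=
  incl_injective (by simp only [incl_gauge, map_add])

theorem gauge_of_mem {n : ℤ} {d : SmoothQHM c μ ν} (hd : incl c μ ν d ∈ qhmSpec c μ ν n) (t : ℝ) :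
    gauge t d = ee (n * t) • d :=
  incl_injective (by rw [incl_gauge, hd t, map_smul])

theorem proj_of_mem {m : ℤ} {d : SmoothQHM c μ ν} (hd : incl c μ ν d ∈ qhmSpec c μ ν m) (n : ℤ) :
    proj n d = if m = n then d else 0 :=
  incl_injective (by rw [incl_proj, specProj_of_mem hd]; split_ifs <;> simp)

/-- The map `d ↦ e(n⋅) ⊗ d_n`. -/
def charProj (n : ℤ) : SmoothQHM c μ ν →ₗ[ℂ] ProjTensor SmoothCircle (SmoothQHM c μ ν) :=
  (TensorProduct.mk ℂ SmoothCircle (SmoothQHM c μ ν) (SmoothCircle.char n)).comp (proj n)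

theorem charProj_apply (n : ℤ) (d : SmoothQHM c μ ν) :
    charProj n d = ProjTensor.tmul (SmoothCircle.char n) (proj n d) := rfl

/-- Seminorms of the character `e(n·)` grow like some power `k` of the degree, and decay of order `k
+ 2` of the components leaves a summable factor. -/
theorem isSummableFamily_charProj : IsSummableFamily
    (ProjTensor.seminorms SmoothCircle (SmoothQHM c μ ν)) charProj := fun ⟨p, q⟩ => by
  obtain ⟨C, k, hC, hp⟩ := SmoothCircle.exists_char_bound p.2
  obtain ⟨q', hq', hle⟩ := exists_seminorm_proj_le' q.2 (k + 2)
  refine ⟨fun n => C * ((1 + |(n : ℝ)|) ^ 2)⁻¹, q', fun n => by positivity,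
    summable_one_add_abs_sq.mul_left C, hq', fun n d => ?_⟩
  refine (ProjTensor.semi_tmul_le p.1 q.1 _ _).trans ?_
  have h1 : (0 : ℝ) < (1 + |(n : ℝ)|) ^ 2 := by positivity
  calc _ ≤ C * (1 + |(n : ℝ)|) ^ k * q.1 (proj n d) :=
        mul_le_mul_of_nonneg_right (hp n) (apply_nonneg _ _)
    _ = C * ((1 + |(n : ℝ)|) ^ 2)⁻¹ * ((1 + |(n : ℝ)|) ^ (k + 2) * q.1 (proj n d)) := by
        field_simp
        ring
    _ ≤ _ := by gcongr; exact hle n d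

/-- The gauge action as a map into the smooth functions on the circle. -/
def gaugeHom : SmoothQHM c μ ν →ₗ[ℂ]
    UniformSpace.Completion (ProjTensor SmoothCircle (SmoothQHM c μ ν)) :=
  isSummableFamily_charProj.sum (ProjTensor.withSeminorms _ _)

theorem continuous_gaugeHom : Continuous (gaugeHom (c := c) (μ := μ) (ν := ν)) :=
  isSummableFamily_charProj.continuous_sum (ProjTensor.withSeminorms _ _)

theorem gaugeHom_of_mem {n : ℤ} {d : SmoothQHM c μ ν} (hd : incl c μ ν d ∈ qhmSpec c μ ν n) :
    gaugeHom d = (ProjTensor.tmul (SmoothCircle.char n) d :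
      ProjTensor SmoothCircle (SmoothQHM c μ ν)) := by
  refine (isSummableFamily_charProj.hasSum (ProjTensor.withSeminorms _ _) d).unique ?_
  have h := hasSum_single (f := fun m => (charProj m d :
    UniformSpace.Completion (ProjTensor SmoothCircle (SmoothQHM c μ ν)))) n fun m hm => by
      rw [charProj_apply, proj_of_mem hd, if_neg (Ne.symm hm)]
      exact (congr_arg _ (TensorProduct.tmul_zero _ _)).trans UniformSpace.Completion.coe_zero
  rwa [charProj_apply, proj_of_mem hd, if_pos rfl] at h

theorem gaugeHom_one : gaugeHom (1 : SmoothQHM c μ ν) = 1 := by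
  have h : incl c μ ν 1 ∈ qhmSpec c μ ν 0 := by
    rw [map_one]; exact mem_qhmBase_iff.1 (one_mem _)
  rw [gaugeHom_of_mem h, SmoothCircle.char_zero]
  rfl

/-- Continuous additive functions that agree on homogeneous elements are equal. -/
theorem eq_of_homogeneous {Y : Type*} [TopologicalSpace Y] [T2Space Y] [AddCommGroup Y]
    {f g : SmoothQHM c μ ν →+ Y} (hf : Continuous f) (hg : Continuous g)
    (h : ∀ n d, incl c μ ν d ∈ qhmSpec c μ ν n → f d = g d) (d : SmoothQHM c μ ν) : f d = g d := by
  have h1 := (hasSum_proj d).map f hf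
  have h2 := (hasSum_proj d).map g hg
  have e : f ∘ (fun n => proj n d) = g ∘ fun n => proj n d := funext fun n =>
    h n _ (specProj_mem n _)
  rw [e] at h1
  exact h1.unique h2

/-- Both sides are continuous and additive in each factor, which reduces the claim to homogeneous
factors; there it is multiplicativity of the characters. -/
theorem gaugeHom_mul (d d' : SmoothQHM c μ ν) : gaugeHom (d * d') = gaugeHom d * gaugeHom d' := by
  have hc := continuous_gaugeHom (c := c) (μ := μ) (ν := ν)
  refine eq_of_homogeneous (f := (gaugeHom.toAddMonoidHom).comp (AddMonoidHom.mulRight d'))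
    (g := (AddMonoidHom.mulRight (gaugeHom d')).comp gaugeHom.toAddMonoidHom)
    (hc.comp (continuous_id.mul continuous_const)) (hc.mul continuous_const) ?_ d
  intro m d hd
  refine eq_of_homogeneous (f := (gaugeHom.toAddMonoidHom).comp (AddMonoidHom.mulLeft d))
    (g := (AddMonoidHom.mulLeft (gaugeHom d)).comp gaugeHom.toAddMonoidHom)
    (hc.comp (continuous_const.mul continuous_id)) (continuous_const.mul hc) ?_ d'
  intro n d' hd'
  change gaugeHom (d * d') = gaugeHom d * gaugeHom d'
  rw [gaugeHom_of_mem hd, gaugeHom_of_mem hd', gaugeHom_of_mem (n := m + n) (by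
    rw [map_mul]; exact mul_mem_qhmSpec hd hd'), ← SmoothCircle.char_mul, ← ProjTensor.tmul_mul_tmul,
    UniformSpace.Completion.coe_mul]

theorem evalTensor_tmul (t : ℝ) (f : SmoothCircle) (d : SmoothQHM c μ ν) :
    evalTensor (SmoothQHM c μ ν) t (ProjTensor.tmul f d) = SmoothCircle.eval t f • d := rfl

theorem uniformContinuous_evalTensor (t : ℝ) :
    UniformContinuous (evalTensor (SmoothQHM c μ ν) t) := by
  refine uniformContinuous_addMonoidHom_of_continuous
    (ProjTensor.continuous_of_le withSeminorms _ fun w => ?_)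
  refine ⟨SmoothCircle.seminorm 0, seminorm w, SmoothCircle.withSeminorms.continuous_seminorm 0,
    withSeminorms.continuous_seminorm w, fun f d => ?_⟩
  rw [evalTensor_tmul, map_smul_eq_mul]
  exact mul_le_mul_of_nonneg_right (SmoothCircle.norm_eval_le f t) (apply_nonneg _ _)

/-- Evaluation at `t` extends continuously to the completion, so it suffices that it sends `e(n·) ⊗
d` to `e(nt)d = γ_t(d)` for `d` of degree `n`. -/
theorem isGaugeSmooth : IsGaugeSmooth (qhmGauge c μ ν) (incl c μ ν) := by
  refine ⟨gauge, gaugeHom, incl_gauge, continuous_gaugeHom, gaugeHom_one, map_add _, map_smul _,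
    gaugeHom_mul, fun t => ?_⟩
  have hu := uniformContinuous_evalTensor (c := c) (μ := μ) (ν := ν) t
  refine eq_of_homogeneous
    (f := ((evalTensor (SmoothQHM c μ ν) t).toAddMonoidHom.completion hu.continuous).comp
      gaugeHom.toAddMonoidHom)
    (g := UniformSpace.Completion.toCompl.comp (AddMonoidHom.mk' (gauge t) (gauge_add t)))
    (UniformSpace.Completion.continuous_map.comp continuous_gaugeHom)
    ((UniformSpace.Completion.continuous_coe _).comp (continuous_gauge t)) fun n d hd => ?_
  change UniformSpace.Completion.map (evalTensor (SmoothQHM c μ ν) t) (gaugeHom d) =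
    (gauge t d : UniformSpace.Completion (SmoothQHM c μ ν))
  rw [gaugeHom_of_mem hd, UniformSpace.Completion.map_coe hu, evalTensor_tmul, gauge_of_mem hd,
    SmoothCircle.eval_char]

end SmoothQHM

end GaugeSmooth

/-! ### The smooth Toeplitz algebra -/

section Toeplitz

/-- The unit vectors of `ℓ²(ℕ)`. -/
def unitVec (i : ℕ) : ell2 ℕ := lp.single 2 i 1

theorem unitVec_apply (i j : ℕ) : unitVec i j = if j = i then 1 else 0 := by
  rw [unitVec, lp.single_apply]
  by_cases h : j = i
  · subst h; simp
  · simp [h]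

theorem inner_unitVec (i : ℕ) (φ : ell2 ℕ) : inner ℂ (unitVec i) φ = φ i := by
  rw [unitVec, lp.inner_single_left]; simp

theorem shiftStar_apply (φ : ell2 ℕ) (i : ℕ) : shiftStar φ i = φ (i + 1) := one_mul _

theorem shiftStar_unitVec_succ (i : ℕ) : shiftStar (unitVec (i + 1)) = unitVec i := by
  ext j
  rw [shiftStar_apply, unitVec_apply, unitVec_apply]
  simp

theorem shiftStar_unitVec_zero : shiftStar (unitVec 0) = 0 := by
  ext j
  rw [shiftStar_apply, unitVec_apply]
  simp

theorem inner_shift (φ ψ : ell2 ℕ) : inner ℂ φ (shift ψ) = inner ℂ (shiftStar φ) ψ := by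
  rw [shift, ContinuousLinearMap.star_eq_adjoint, ContinuousLinearMap.adjoint_inner_right]

theorem shift_apply_zero (φ : ell2 ℕ) : shift φ 0 = 0 := by
  rw [← inner_unitVec, inner_shift, shiftStar_unitVec_zero, inner_zero_left]

theorem shift_apply_succ (φ : ell2 ℕ) (i : ℕ) : shift φ (i + 1) = φ i := by
  rw [← inner_unitVec, inner_shift, shiftStar_unitVec_succ, inner_unitVec]

theorem shiftStar_mul_shift : shiftStar * shift = 1 := by
  ext φ i
  exact (shiftStar_apply _ _).trans (shift_apply_succ φ i)

theorem shiftStar_mul_vacuum : shiftStar * (1 - shift * shiftStar) = 0 := by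
  rw [mul_sub, ← mul_assoc, shiftStar_mul_shift, mul_one, one_mul, sub_self]

theorem shift_unitVec (i : ℕ) : shift (unitVec i) = unitVec (i + 1) := by
  ext j
  cases j with
  | zero => rw [shift_apply_zero, unitVec_apply]; simp
  | succ j => rw [shift_apply_succ, unitVec_apply, unitVec_apply]; simp

theorem shift_mul_matrixUnit (i j : ℕ) : shift * matrixUnit (i, j) = matrixUnit (i + 1, j) := by
  simp only [matrixUnit, pow_succ', mul_assoc]

theorem shiftStar_mul_matrixUnit_succ (i j : ℕ) :
    shiftStar * matrixUnit (i + 1, j) = matrixUnit (i, j) := by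
  rw [← shift_mul_matrixUnit, ← mul_assoc, shiftStar_mul_shift, one_mul]

theorem shiftStar_mul_matrixUnit_zero (j : ℕ) : shiftStar * matrixUnit (0, j) = 0 := by
  simp only [matrixUnit, pow_zero, one_mul]
  rw [← mul_assoc, shiftStar_mul_vacuum, zero_mul]

theorem shiftPow_natCast (n : ℕ) : shiftPow n = shift ^ n := by
  rw [shiftPow, if_pos (by positivity), Int.toNat_natCast]

theorem shiftPow_neg_natCast (n : ℕ) : shiftPow (-n) = shiftStar ^ n := by
  cases n with
  | zero => simp [shiftPow]
  | succ n => rw [shiftPow, if_neg (by push_cast; omega), neg_neg, Int.toNat_natCast]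

theorem shift_mul_shiftPow {n : ℤ} (hn : 0 ≤ n) : shift * shiftPow n = shiftPow (n + 1) := by
  lift n to ℕ using hn
  rw [shiftPow_natCast, ← Nat.cast_succ, shiftPow_natCast, pow_succ']

theorem shiftStar_mul_shiftPow {n : ℤ} (hn : n ≤ 0) :
    shiftStar * shiftPow n = shiftPow (n - 1) := by
  obtain ⟨m, rfl⟩ := Int.exists_eq_neg_ofNat hn
  rw [shiftPow_neg_natCast, show -(m : ℤ) - 1 = -((m + 1 : ℕ) : ℤ) by push_cast; ring,
    shiftPow_neg_natCast, pow_succ']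

theorem shiftStar_mul_shiftPow_succ (n : ℕ) :
    shiftStar * shiftPow (n + 1 : ℕ) = shiftPow n := by
  rw [shiftPow_natCast, shiftPow_natCast, pow_succ', ← mul_assoc, shiftStar_mul_shift, one_mul]

/-- Multiplying a negative power by `S` leaves a defect, because `SS̄ = 1 - e`; it is a matrix unit.
This is how the compact part enters the Toeplitz algebra. -/
theorem shift_mul_shiftPow_neg (n : ℕ) :
    shift * shiftPow (-(n + 1 : ℕ)) = shiftPow (-n) - matrixUnit (0, n) := by
  rw [shiftPow_neg_natCast, shiftPow_neg_natCast, pow_succ', matrixUnit]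
  simp only [pow_zero, one_mul, sub_mul]
  rw [sub_sub_cancel, mul_assoc]

/-- The matrix entries of an operator on `ℓ²(ℕ)`. -/
def opEntry (i j : ℕ) : (ell2 ℕ →L[ℂ] ell2 ℕ) →L[ℂ] ℂ :=
  (innerSL ℂ (unitVec i)).comp (ContinuousLinearMap.apply ℂ (ell2 ℕ) (unitVec j))

theorem opEntry_apply (i j : ℕ) (T : ell2 ℕ →L[ℂ] ell2 ℕ) :
    opEntry i j T = T (unitVec j) i := inner_unitVec i _

theorem shift_pow_unitVec (n j : ℕ) : (shift ^ n) (unitVec j) = unitVec (j + n) := by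
  induction n with
  | zero => rfl
  | succ n ih => rw [pow_succ', mul_apply_eq_comp, ih, shift_unitVec]; rfl

theorem shiftStar_pow_unitVec (n j : ℕ) :
    (shiftStar ^ n) (unitVec j) = if n ≤ j then unitVec (j - n) else 0 := by
  induction n with
  | zero => rfl
  | succ n ih =>
    rw [pow_succ', mul_apply_eq_comp, ih]
    split_ifs with h1 h2 h2
    · rw [show j - n = (j - (n + 1)) + 1 by omega, shiftStar_unitVec_succ]
    · rw [show j - n = 0 by omega, shiftStar_unitVec_zero]
    · omega
    · rw [map_zero]

theorem vacuum_unitVec (j : ℕ) :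
    (1 - shift * shiftStar) (unitVec j) = if j = 0 then unitVec 0 else 0 := by
  cases j with
  | zero => simp [shiftStar_unitVec_zero]
  | succ j => simp [shiftStar_unitVec_succ, shift_unitVec]

theorem opEntry_shiftPow (i j : ℕ) (n : ℤ) :
    opEntry i j (shiftPow n) = if n = (i : ℤ) - j then 1 else 0 := by
  rw [opEntry_apply]
  obtain ⟨m, rfl | rfl⟩ := n.eq_nat_or_neg
  · rw [shiftPow_natCast, shift_pow_unitVec, unitVec_apply]
    congr 1
    exact propext (by omega)
  · rw [shiftPow_neg_natCast, shiftStar_pow_unitVec]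
    split_ifs with h1 h2 h2
    · rw [unitVec_apply, if_pos (by omega)]
    · rw [unitVec_apply, if_neg (by omega)]
    · omega
    · rfl

theorem opEntry_matrixUnit (i j : ℕ) (a : ℕ × ℕ) :
    opEntry i j (matrixUnit a) = if a = (i, j) then 1 else 0 := by
  rw [opEntry_apply, matrixUnit, mul_apply_eq_comp, mul_apply_eq_comp, shiftStar_pow_unitVec]
  obtain ⟨k, l⟩ := a
  simp only [Prod.mk.injEq]
  split_ifs with h1 h2 h2
  · rw [vacuum_unitVec, if_pos (by omega), shift_pow_unitVec, unitVec_apply, if_pos (by omega)]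
  · rw [vacuum_unitVec]
    split_ifs with h3
    · rw [shift_pow_unitVec, unitVec_apply, if_neg (by omega)]
    · rw [map_zero]; rfl
  · omega
  · rw [map_zero, map_zero]; rfl

theorem SmoothCompact.summable_smul (k : SmoothCompact) :
    Summable fun a => SmoothCompact.entry a k • matrixUnit a := by
  refine Summable.of_norm_bounded ((k.summable 0 0).mul_right 2) fun a => ?_
  rw [norm_smul]
  simpa using mul_le_mul_of_nonneg_left (norm_matrixUnit_le a) (norm_nonneg _)

theorem SmoothCircle.summable_smul (f : SmoothCircle) :
    Summable fun n => SmoothCircle.coeff n f • shiftPow n := by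
  refine Summable.of_norm_bounded f.summable_coeff fun n => ?_
  rw [norm_smul]
  exact mul_le_of_le_one_right (norm_nonneg _) (norm_shiftPow_le n)

theorem toeplitzIncl_apply (k : SmoothCompact) (f : SmoothCircle) :
    toeplitzIncl (k, f) = ∑' a, SmoothCompact.entry a k • matrixUnit a +
      ∑' n, SmoothCircle.coeff n f • shiftPow n := rfl

theorem opEntry_toeplitzIncl (i j : ℕ) (k : SmoothCompact) (f : SmoothCircle) :
    opEntry i j (toeplitzIncl (k, f)) =
      SmoothCompact.entry (i, j) k + SmoothCircle.coeff (i - j) f := by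
  rw [toeplitzIncl_apply, map_add, (opEntry i j).map_tsum k.summable_smul,
    (opEntry i j).map_tsum f.summable_smul]
  simp only [map_smul, opEntry_matrixUnit, opEntry_shiftPow, smul_eq_mul, mul_ite, mul_one,
    mul_zero, tsum_ite_eq]

theorem SmoothCircle.eq_zero_of_coeff {f : SmoothCircle} (h : ∀ n, coeff n f = 0) : f = 0 := by
  have hp : Function.Periodic (fun t => eval t f) 1 := f.periodic
  have hc : Continuous hp.lift := continuous_coinduced_dom.2 f.contDiff.continuous
  have h0 : ∀ n, fourierCoeff (T := (1 : ℝ)) hp.lift n = 0 := fun n => by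
    rw [fourierCoeff_eq_intervalIntegral _ n 0, ← h n, one_div, inv_one, one_smul, zero_add]
    refine intervalIntegral.integral_congr fun t _ => ?_
    beta_reduce
    rw [fourier_coe_apply, Function.Periodic.lift_coe, smul_eq_mul, mul_comm, ee]
    congr 2
    push_cast
    ring
  refine ext_eval fun t => ?_
  have hs := has_pointwise_sum_fourier_series_of_summable (T := (1 : ℝ)) (f := ⟨hp.lift, hc⟩)
    (by simp [funext h0]) (t : AddCircle (1 : ℝ))
  have h1 : ∀ n, fourierCoeff (T := (1 : ℝ)) (⟨hp.lift, hc⟩ : C(AddCircle (1 : ℝ), ℂ)) n = 0 := h0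
  simp only [h1, zero_smul] at hs
  rw [map_zero]
  exact hs.unique hasSum_zero

theorem SmoothCompact.entry_le (k : SmoothCompact) :
    ∃ C : ℝ, ∀ i j : ℕ, (1 + i : ℝ) * ‖entry (i, j) k‖ ≤ C := by
  obtain ⟨C, hC⟩ := k.2 1 0
  refine ⟨C, fun i j => ?_⟩
  have := hC i j
  rwa [pow_one, pow_zero, mul_one] at this

/-- Along a diagonal the Toeplitz entries are constant while the entries of a smooth compact matrix
tend to zero. Both parts are therefore determined by the operator, and products may be read off in
the bounded operators. -/
theorem toeplitzIncl_injective : Function.Injective toeplitzIncl := by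
  rw [← LinearMap.ker_eq_bot, LinearMap.ker_eq_bot']
  rintro ⟨k, f⟩ h
  have hent : ∀ i j : ℕ, SmoothCompact.entry (i, j) k + SmoothCircle.coeff (i - j) f = 0 :=
    fun i j => by rw [← opEntry_toeplitzIncl, h, map_zero]
  have hf : f = 0 := by
    refine SmoothCircle.eq_zero_of_coeff fun n => ?_
    obtain ⟨C, hC⟩ := k.entry_le
    -- The positions `(j + n⁺, j + n⁻)` run down the diagonal of index `n`.
    have h1 : ∀ j : ℕ, ‖SmoothCircle.coeff n f‖ ≤ C * (1 / ((j : ℝ) + 1)) := fun j => by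
      have e := hent (j + n.toNat) (j + (-n).toNat)
      rw [show ((j + n.toNat : ℕ) : ℤ) - ((j + (-n).toNat : ℕ) : ℤ) = n by omega] at e
      rw [← norm_neg, ← eq_neg_of_add_eq_zero_left e, mul_one_div, le_div_iff₀ (by positivity)]
      refine le_trans ?_ (hC (j + n.toNat) (j + (-n).toNat))
      rw [mul_comm]
      refine mul_le_mul_of_nonneg_right ?_ (norm_nonneg _)
      push_cast
      have : (0 : ℝ) ≤ n.toNat := by positivity
      linarith
    have h2 := tendsto_one_div_add_atTop_nhds_zero_nat (𝕜 := ℝ).const_mul C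
    rw [mul_zero] at h2
    exact norm_le_zero_iff.1 (ge_of_tendsto' h2 h1)
  subst hf
  have hk : k = 0 := Subtype.ext (funext fun ⟨i, j⟩ => by
    have := hent i j
    rwa [map_zero, add_zero] at this)
  rw [hk]
  rfl

theorem SmoothCircle.coeff_char (m n : ℤ) : coeff m (char n) = if m = n then 1 else 0 := by
  have h : coeff m (char n) = ∫ t in (0 : ℝ)..1, ee (((n - m : ℤ) : ℝ) * t) :=
    intervalIntegral.integral_congr fun t _ => by
      beta_reduce
      rw [eval_char, ← ee_add]
      congr 1
      push_cast
      ring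
  rw [h, integral_ee_mul]
  congr 1
  exact propext (by omega)

/-- The matrix units among the smooth compact operators. -/
def SmoothCompact.unit (a : ℕ × ℕ) : SmoothCompact :=
  ⟨Pi.single a 1, fun m n => ⟨(1 + a.1 : ℝ) ^ m * (1 + a.2 : ℝ) ^ n, fun i j => by
    by_cases h : (i, j) = a
    · subst h; simp
    · rw [Pi.single_eq_of_ne h, norm_zero, mul_zero]; positivity⟩⟩

theorem SmoothCompact.entry_unit (a b : ℕ × ℕ) :
    entry b (unit a) = if b = a then 1 else 0 := Pi.single_apply a 1 b

theorem toeplitzIncl_unit (a : ℕ × ℕ) : toeplitzIncl (SmoothCompact.unit a, 0) = matrixUnit a := by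
  rw [toeplitzIncl_apply]
  simp [SmoothCompact.entry_unit]

theorem toeplitzIncl_char (n : ℤ) : toeplitzIncl (0, SmoothCircle.char n) = shiftPow n := by
  rw [toeplitzIncl_apply]
  simp [SmoothCircle.coeff_char]

end Toeplitz

/-! ### The canonical splitting -/

section Split

variable {c : ℤ} {μ ν : ℝ}

variable (c μ ν) in
/-- The generators `𝒜 ⊗ 1`, `S(𝓔) ⊗ S` and `S̄(𝓔) ⊗ S̄` of the Toeplitz algebra. -/
def toeplitzGen : Set (SmoothQHM c μ ν ⊗[ℂ] (ell2 ℕ →L[ℂ] ell2 ℕ)) :=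
  {x | (∃ a : SmoothQHM c μ ν, SmoothQHM.incl c μ ν a ∈ qhmBase c μ ν ∧ x = a ⊗ₜ 1) ∨
    (∃ ξ : SmoothQHM c μ ν, SmoothQHM.incl c μ ν ξ ∈ qhmSpec c μ ν 1 ∧ x = ξ ⊗ₜ shift) ∨
    (∃ ξ : SmoothQHM c μ ν, SmoothQHM.incl c μ ν ξ ∈ qhmSpec c μ ν 1 ∧ x = star ξ ⊗ₜ shiftStar)}

variable (c μ ν) in
/-- The span of the tensors `d ⊗ Sⁿ` with `d` of degree `n`. -/
def gradedTensors : Submodule ℂ (SmoothQHM c μ ν ⊗[ℂ] SmoothToeplitz) :=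
  Submodule.span ℂ {x | ∃ (n : ℤ) (d : SmoothQHM c μ ν),
    SmoothQHM.incl c μ ν d ∈ qhmSpec c μ ν n ∧ x = d ⊗ₜ (0, SmoothCircle.char n)}

variable (c μ ν) in
/-- The span of the tensors `d ⊗ E_{ij}`. -/
def matrixTensors : Submodule ℂ (SmoothQHM c μ ν ⊗[ℂ] SmoothToeplitz) :=
  Submodule.span ℂ {x | ∃ (a : ℕ × ℕ) (d : SmoothQHM c μ ν), x = d ⊗ₜ (SmoothCompact.unit a, 0)}

variable (c μ ν) in
/-- The inclusion of `D ⊗ 𝒯` into `D ⊗ B(ℓ²(ℕ))`. -/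
def tensorIncl : SmoothQHM c μ ν ⊗[ℂ] SmoothToeplitz →ₗ[ℂ]
    SmoothQHM c μ ν ⊗[ℂ] (ell2 ℕ →L[ℂ] ell2 ℕ) :=
  TensorProduct.map LinearMap.id toeplitzIncl

theorem tensorIncl_injective : Function.Injective (tensorIncl c μ ν) :=
  Module.Flat.lTensor_preserves_injective_linearMap toeplitzIncl toeplitzIncl_injective

/-- The induction on homogeneous elements only moves away from degree zero. There `S` and `S̄`
multiply the powers without defect, which is the reason for the sign conditions in
`homogeneous_induction`. -/
theorem tmul_shiftPow_mem_adjoin (n : ℤ) (d : SmoothQHM c μ ν)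
    (hd : SmoothQHM.incl c μ ν d ∈ qhmSpec c μ ν n) :
    d ⊗ₜ shiftPow n ∈ Algebra.adjoin ℂ (toeplitzGen c μ ν) := by
  refine homogeneous_induction (SmoothQHM.incl c μ ν)
    (p := fun n d => d ⊗ₜ shiftPow n ∈ Algebra.adjoin ℂ (toeplitzGen c μ ν))
    incl_frame_one_mem (sum_frame_mul_star 1) (sum_star_frame_mul 1) ?_ ?_ ?_ ?_ n d hd
  · exact fun d hd => Algebra.subset_adjoin (Or.inl ⟨d, mem_qhmBase_iff.2 hd, rfl⟩)
  · intro n d d' h h'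
    rw [TensorProduct.add_tmul]
    exact add_mem h h'
  · intro n hn i d h
    rw [← shift_mul_shiftPow hn, ← Algebra.TensorProduct.tmul_mul_tmul]
    exact mul_mem (Algebra.subset_adjoin (Or.inr (Or.inl ⟨_, incl_frame_one_mem i, rfl⟩))) h
  · intro n hn i d h
    rw [← shiftStar_mul_shiftPow hn, ← Algebra.TensorProduct.tmul_mul_tmul]
    exact mul_mem (Algebra.subset_adjoin (Or.inr (Or.inr ⟨_, incl_frame_one_mem i, rfl⟩))) h

theorem tensorIncl_mem_adjoin {y : SmoothQHM c μ ν ⊗[ℂ] SmoothToeplitz}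
    (hy : y ∈ gradedTensors c μ ν) :
    tensorIncl c μ ν y ∈ Algebra.adjoin ℂ (toeplitzGen c μ ν) := by
  have : gradedTensors c μ ν ≤
      (Subalgebra.toSubmodule (Algebra.adjoin ℂ (toeplitzGen c μ ν))).comap (tensorIncl c μ ν) := by
    refine Submodule.span_le.2 ?_
    rintro _ ⟨n, d, hd, rfl⟩
    change d ⊗ₜ toeplitzIncl (0, SmoothCircle.char n) ∈ Algebra.adjoin ℂ (toeplitzGen c μ ν)
    rw [toeplitzIncl_char]
    exact tmul_shiftPow_mem_adjoin n d hd
  exact this hy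

variable (c μ ν) in
/-- The image of the sum of the two spans in `D ⊗ B(ℓ²(ℕ))`. -/
def tensorImage : Submodule ℂ (SmoothQHM c μ ν ⊗[ℂ] (ell2 ℕ →L[ℂ] ell2 ℕ)) :=
  (matrixTensors c μ ν ⊔ gradedTensors c μ ν).map (tensorIncl c μ ν)

theorem tmul_matrixUnit_mem (d : SmoothQHM c μ ν) (a : ℕ × ℕ) :
    d ⊗ₜ matrixUnit a ∈ tensorImage c μ ν := by
  rw [← toeplitzIncl_unit]
  exact ⟨_, Submodule.mem_sup_left (Submodule.subset_span ⟨a, d, rfl⟩), rfl⟩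

theorem tmul_shiftPow_mem {n : ℤ} {d : SmoothQHM c μ ν}
    (hd : SmoothQHM.incl c μ ν d ∈ qhmSpec c μ ν n) : d ⊗ₜ shiftPow n ∈ tensorImage c μ ν := by
  rw [← toeplitzIncl_char]
  exact ⟨_, Submodule.mem_sup_right (Submodule.subset_span ⟨n, d, hd, rfl⟩), rfl⟩

theorem tensorImage_induction {p : SmoothQHM c μ ν ⊗[ℂ] (ell2 ℕ →L[ℂ] ell2 ℕ) → Prop}
    (hM : ∀ d a, p (d ⊗ₜ matrixUnit a))
    (hG : ∀ n d, SmoothQHM.incl c μ ν d ∈ qhmSpec c μ ν n → p (d ⊗ₜ shiftPow n)) (h0 : p 0)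
    (hadd : ∀ x y, p x → p y → p (x + y)) (hsmul : ∀ (z : ℂ) x, p x → p (z • x))
    {x : SmoothQHM c μ ν ⊗[ℂ] (ell2 ℕ →L[ℂ] ell2 ℕ)} (hx : x ∈ tensorImage c μ ν) : p x := by
  have : tensorImage c μ ν ≤
      { carrier := {x | p x}, add_mem' := hadd _ _, zero_mem' := h0, smul_mem' := hsmul } := by
    refine Submodule.map_le_iff_le_comap.2 (sup_le (Submodule.span_le.2 ?_) (Submodule.span_le.2 ?_))
    · rintro _ ⟨a, d, rfl⟩
      change p (d ⊗ₜ toeplitzIncl (SmoothCompact.unit a, 0))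
      rw [toeplitzIncl_unit]
      exact hM d a
    · rintro _ ⟨n, d, hd, rfl⟩
      change p (d ⊗ₜ toeplitzIncl (0, SmoothCircle.char n))
      rw [toeplitzIncl_char]
      exact hG n d hd
  exact this hx

theorem tensorOp_mul_zero (g : SmoothQHM c μ ν ⊗[ℂ] (ell2 ℕ →L[ℂ] ell2 ℕ)) : g * 0 = 0 :=
  (Algebra.TensorProduct.mul g).map_zero

theorem tensorOp_mul_add (g x y : SmoothQHM c μ ν ⊗[ℂ] (ell2 ℕ →L[ℂ] ell2 ℕ)) :
    g * (x + y) = g * x + g * y := (Algebra.TensorProduct.mul g).map_add x y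

theorem tensorOp_add_mul (g x y : SmoothQHM c μ ν ⊗[ℂ] (ell2 ℕ →L[ℂ] ell2 ℕ)) :
    (x + y) * g = x * g + y * g := (Algebra.TensorProduct.mul.map_add₂ x y g)

/-- Left multiplication by a generator respects the degrees up to tensors `d ⊗ E_{ij}`, and these
are allowed with arbitrary `d`, so no further terms arise. -/
theorem toeplitzGen_mul_mem {g x : SmoothQHM c μ ν ⊗[ℂ] (ell2 ℕ →L[ℂ] ell2 ℕ)}
    (hg : g ∈ toeplitzGen c μ ν) (hx : x ∈ tensorImage c μ ν) : g * x ∈ tensorImage c μ ν := by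
  refine tensorImage_induction (p := fun x => g * x ∈ tensorImage c μ ν) ?_ ?_
    (by rw [tensorOp_mul_zero]; exact zero_mem _)
    (fun x y hx hy => by rw [tensorOp_mul_add]; exact add_mem hx hy)
    (fun z x hx => by rw [mul_smul_comm]; exact Submodule.smul_mem _ _ hx) hx
  · rintro d ⟨i, j⟩
    obtain ⟨a, -, rfl⟩ | ⟨ξ, -, rfl⟩ | ⟨ξ, -, rfl⟩ := hg
    · rw [Algebra.TensorProduct.tmul_mul_tmul, one_mul]
      exact tmul_matrixUnit_mem _ _
    · rw [Algebra.TensorProduct.tmul_mul_tmul, shift_mul_matrixUnit]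
      exact tmul_matrixUnit_mem _ _
    · rw [Algebra.TensorProduct.tmul_mul_tmul]
      cases i with
      | zero =>
        rw [shiftStar_mul_matrixUnit_zero, TensorProduct.tmul_zero]
        exact zero_mem _
      | succ i =>
        rw [shiftStar_mul_matrixUnit_succ]
        exact tmul_matrixUnit_mem _ _
  · intro n d hd
    obtain ⟨a, ha, rfl⟩ | ⟨ξ, hξ, rfl⟩ | ⟨ξ, hξ, rfl⟩ := hg
    · rw [Algebra.TensorProduct.tmul_mul_tmul, one_mul]
      refine tmul_shiftPow_mem ?_
      rw [map_mul]
      simpa using mul_mem_qhmSpec (mem_qhmBase_iff.1 ha) hd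
    · have hm : SmoothQHM.incl c μ ν (ξ * d) ∈ qhmSpec c μ ν (n + 1) := by
        rw [map_mul, add_comm]
        exact mul_mem_qhmSpec hξ hd
      rw [Algebra.TensorProduct.tmul_mul_tmul]
      obtain hn | hn := le_or_gt 0 n
      · rw [shift_mul_shiftPow hn]
        exact tmul_shiftPow_mem hm
      · obtain ⟨k, rfl⟩ : ∃ k : ℕ, n = -(k + 1 : ℕ) := ⟨(-n - 1).toNat, by omega⟩
        rw [shift_mul_shiftPow_neg, TensorProduct.tmul_sub]
        refine sub_mem (tmul_shiftPow_mem ?_) (tmul_matrixUnit_mem _ _)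
        rwa [show -((k + 1 : ℕ) : ℤ) + 1 = -k by push_cast; ring] at hm
    · have hm : SmoothQHM.incl c μ ν (star ξ * d) ∈ qhmSpec c μ ν (n - 1) := by
        rw [map_mul, map_star, sub_eq_add_neg, add_comm]
        exact mul_mem_qhmSpec (star_mem_qhmSpec hξ) hd
      rw [Algebra.TensorProduct.tmul_mul_tmul]
      obtain hn | hn := le_or_gt n 0
      · rw [shiftStar_mul_shiftPow hn]
        exact tmul_shiftPow_mem hm
      · obtain ⟨k, rfl⟩ : ∃ k : ℕ, n = (k + 1 : ℕ) := ⟨(n - 1).toNat, by omega⟩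
        rw [shiftStar_mul_shiftPow_succ]
        refine tmul_shiftPow_mem ?_
        rwa [show ((k + 1 : ℕ) : ℤ) - 1 = k by push_cast; ring] at hm

theorem adjoin_le_tensorImage {x : SmoothQHM c μ ν ⊗[ℂ] (ell2 ℕ →L[ℂ] ell2 ℕ)}
    (hx : x ∈ Algebra.adjoin ℂ (toeplitzGen c μ ν)) : x ∈ tensorImage c μ ν := by
  have key : ∀ m ∈ tensorImage c μ ν, x * m ∈ tensorImage c μ ν := by
    induction hx using Algebra.adjoin_induction with
    | mem g hg => exact fun m hm => toeplitzGen_mul_mem hg hm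
    | algebraMap z =>
      intro m hm
      rw [← Algebra.smul_def]
      exact Submodule.smul_mem _ _ hm
    | add x y _ _ hx hy => intro m hm; rw [tensorOp_add_mul]; exact add_mem (hx m hm) (hy m hm)
    | mul x y _ _ hx hy => intro m hm; rw [mul_assoc]; exact hx _ (hy m hm)
  -- The image is only known to be stable under left multiplication; it contains the unit `1 ⊗ S⁰`,
  -- hence `x`.
  rw [← mul_one x]
  refine key 1 ?_
  have h : SmoothQHM.incl c μ ν 1 ∈ qhmSpec c μ ν 0 := by
    rw [map_one]; exact mem_qhmBase_iff.1 (one_mem _)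
  have := tmul_shiftPow_mem h
  rwa [show shiftPow 0 = 1 from shiftPow_natCast 0 ▸ pow_zero _] at this

variable (c μ ν) in
/-- The projection of `D ⊗ 𝒯` to the summand `D ⊗ C^∞(S¹)`. -/
def symbolProj : SmoothQHM c μ ν ⊗[ℂ] SmoothToeplitz →ₗ[ℂ] SmoothQHM c μ ν ⊗[ℂ] SmoothToeplitz :=
  TensorProduct.map LinearMap.id (LinearMap.inr ℂ SmoothCompact SmoothCircle) ∘ₗ
    TensorProduct.map LinearMap.id (LinearMap.snd ℂ SmoothCompact SmoothCircle)

theorem symbolProj_mem {y : SmoothQHM c μ ν ⊗[ℂ] SmoothToeplitz}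
    (hy : y ∈ matrixTensors c μ ν ⊔ gradedTensors c μ ν) :
    symbolProj c μ ν y ∈ gradedTensors c μ ν := by
  have : matrixTensors c μ ν ⊔ gradedTensors c μ ν ≤
      (gradedTensors c μ ν).comap (symbolProj c μ ν) := by
    refine sup_le (Submodule.span_le.2 ?_) (Submodule.span_le.2 ?_)
    · rintro _ ⟨a, d, rfl⟩
      change d ⊗ₜ ((0 : SmoothCompact), (0 : SmoothCircle)) ∈ gradedTensors c μ ν
      rw [show ((0 : SmoothCompact), (0 : SmoothCircle)) = 0 from rfl, TensorProduct.tmul_zero]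
      exact zero_mem _
    · rintro _ ⟨n, d, hd, rfl⟩
      exact Submodule.subset_span ⟨n, d, hd, rfl⟩
  exact this hy

/-- By injectivity of the inclusion, `z` itself is a sum of matrix tensors and graded tensors. The
projection retains graded tensors, and these come from the generated algebra. -/
theorem symbolProj_mem_toeplitzPre {z : SmoothQHM c μ ν ⊗[ℂ] SmoothToeplitz}
    (hz : z ∈ toeplitzPre (qhmBase c μ ν) (qhmSpec c μ ν 1) (SmoothQHM.incl c μ ν)) :
    symbolProj c μ ν z ∈
      toeplitzPre (qhmBase c μ ν) (qhmSpec c μ ν 1) (SmoothQHM.incl c μ ν) := by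
  obtain ⟨y, hy, e⟩ := adjoin_le_tensorImage (c := c) (μ := μ) (ν := ν) hz
  rw [← tensorIncl_injective e]
  exact tensorIncl_mem_adjoin (symbolProj_mem hy)

/-- The Toeplitz algebra is the closure of its algebraic part, and the composite of the two extended
maps is continuous; on algebraic tensors it is `symbolProj`. -/
theorem isCanonicallySplit :
    IsCanonicallySplit (qhmBase c μ ν) (qhmSpec c μ ν 1) (SmoothQHM.incl c μ ν) := by
  intro x hx
  have h0 : Continuous (LinearMap.id : SmoothQHM c μ ν →ₗ[ℂ] SmoothQHM c μ ν) := continuous_id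
  have h1 := ProjTensor.uniformContinuous_map h0
    (show Continuous (LinearMap.snd ℂ SmoothCompact SmoothCircle) from continuous_snd)
  have h2 := ProjTensor.uniformContinuous_map h0
    (show Continuous (LinearMap.inr ℂ SmoothCompact SmoothCircle) from
      Continuous.prodMk_right (0 : SmoothCompact))
  refine map_mem_closure (f := fun x => ProjTensor.mapC LinearMap.id
    (LinearMap.inr ℂ SmoothCompact SmoothCircle) (ProjTensor.mapC LinearMap.id
      (LinearMap.snd ℂ SmoothCompact SmoothCircle) x))
    (UniformSpace.Completion.continuous_map.comp UniformSpace.Completion.continuous_map) hx ?_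
  rintro _ ⟨z, hz, rfl⟩
  refine ⟨symbolProj c μ ν z, symbolProj_mem_toeplitzPre hz, ?_⟩
  beta_reduce
  have e1 := UniformSpace.Completion.map_coe h1 z
  have e2 := UniformSpace.Completion.map_coe h2
    (ProjTensor.map LinearMap.id (LinearMap.snd ℂ SmoothCompact SmoothCircle) z)
  exact (e2.symm.trans (congr_arg _ e1.symm))

end Split

/-! ### Smooth functions on the torus as the base of the smooth quantum Heisenberg manifold -/

namespace SmoothTorus

theorem continuous_of_eventually {Y : Type*} [TopologicalSpace Y] {F : Y → SmoothTorus}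
    (h : ∀ (k : ℕ) (y₀ : Y) (ε : ℝ), 0 < ε → ∀ᶠ y in 𝓝 y₀, ∀ z,
      ‖iteratedFDeriv ℝ k ((F y).1 - (F y₀).1) z‖ < ε) : Continuous F := by
  refine continuous_iInf_rng.2 fun k => continuous_induced_rng.2 ?_
  rw [continuous_iff_continuousAt]
  intro y₀
  rw [ContinuousAt, UniformFun.tendsto_iff_tendstoUniformly, Metric.tendstoUniformly_iff]
  intro ε hε
  filter_upwards [h k y₀ ε hε] with y hy z
  have := hy z
  rw [iteratedFDeriv_sub_apply ((F y).2.1.of_le (by exact_mod_cast le_top)).contDiffAt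
    ((F y₀).2.1.of_le (by exact_mod_cast le_top)).contDiffAt] at this
  rw [dist_comm, dist_eq_norm]
  exact this

theorem eventually_norm_lt (f₀ : SmoothTorus) (k : ℕ) {ε : ℝ} (hε : 0 < ε) :
    ∀ᶠ f in 𝓝 f₀, ∀ z, ‖iteratedFDeriv ℝ k (f.1 - f₀.1) z‖ < ε := by
  have hc : Continuous fun f : SmoothTorus => UniformFun.ofFun (iteratedFDeriv ℝ k f.1) :=
    continuous_iInf_dom (i := k) continuous_induced_dom
  have h := hc.tendsto f₀
  rw [UniformFun.tendsto_iff_tendstoUniformly, Metric.tendstoUniformly_iff] at h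
  filter_upwards [h ε hε] with f hf z
  have := hf z
  rw [dist_comm, dist_eq_norm] at this
  rw [iteratedFDeriv_sub_apply (f.2.1.of_le (by exact_mod_cast le_top)).contDiffAt
    (f₀.2.1.of_le (by exact_mod_cast le_top)).contDiffAt]
  exact this

variable (c : ℤ) (μ ν : ℝ)

theorem mem_secSub (f : SmoothTorus) : f.1 ∈ secSub c ν 0 :=
  ⟨f.2.1.continuous, fun x y => (f.2.2 x y).2, fun x y => by simp [ee_zero, (f.2.2 x y).1]⟩

/-- The smooth sections of degree `0` are the smooth functions on the torus. -/
def ofSecSub {f : ℝ × ℝ → ℂ} (hf : f ∈ secSub c ν 0) (hs : ContDiff ℝ ∞ f) : SmoothTorus :=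
  ⟨f, hs, fun x y => ⟨by simpa [ee_zero] using hf.2.2 x y, hf.2.1 x y⟩⟩

/-- Differences of smooth functions on the torus. -/
def sub (f g : SmoothTorus) : SmoothTorus :=
  ⟨f.1 - g.1, f.2.1.sub g.2.1, fun x y =>
    ⟨by simp [(f.2.2 x y).1, (g.2.2 x y).1], by simp [(f.2.2 x y).2, (g.2.2 x y).2]⟩⟩

/-- A smooth function on the torus as an element of the smooth QHM. -/
def toSmooth (f : SmoothTorus) : SmoothQHM c μ ν :=
  SmoothQHM.mk (secL μ c ν 0 ⟨f.1, f.mem_secSub c ν⟩) (secL_mem_qhmSmooth _ f.2.1)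

theorem incl_toSmooth (f : SmoothTorus) :
    SmoothQHM.incl c μ ν (f.toSmooth c μ ν) = secL μ c ν 0 ⟨f.1, f.mem_secSub c ν⟩ := rfl

theorem incl_toSmooth_eq_toQHM (f : SmoothTorus) :
    SmoothQHM.incl c μ ν (f.toSmooth c μ ν) = f.toQHM c μ ν := rfl

theorem toSmooth_sub (f g : SmoothTorus) :
    (sub f g).toSmooth c μ ν = f.toSmooth c μ ν - g.toSmooth c μ ν :=
  SmoothQHM.incl_injective (by
    rw [map_sub, incl_toSmooth, incl_toSmooth, incl_toSmooth, ← map_sub]; rfl)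

/-- The action of the generators on the smooth functions on the torus. -/
def tder (i : Fin 3) (f : SmoothTorus) : SmoothTorus :=
  ofSecSub c 0 (secDer_mem μ (f.mem_secSub c 0) f.2.1 i) (contDiff_secDer f.2.1 i)

theorem der_toSmooth (i : Fin 3) (f : SmoothTorus) :
    SmoothQHM.der i (f.toSmooth c μ ν) = (tder c μ i f).toSmooth c μ ν :=
  SmoothQHM.incl_injective (by
    rw [SmoothQHM.incl_der, incl_toSmooth, heisDer_secL _ f.2.1]; rfl)

theorem tder_val (i : Fin 3) (f : SmoothTorus) : (tder c μ i f).1 = secDer c μ 0 f.1 i := rfl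

theorem tder_zero_apply (f : SmoothTorus) (z : ℝ × ℝ) :
    (tder c μ 0 f).1 z = -fderiv ℝ f.1 z (1, 0) := rfl

/-- The multiplication term of `∂₂` carries the degree as a factor and disappears in degree zero. -/
theorem tder_one_apply (f : SmoothTorus) (z : ℝ × ℝ) :
    (tder c μ 1 f).1 z = -fderiv ℝ f.1 z (0, 1) := by
  rw [tder_val]; simp [secDer]

theorem tder_two_apply (f : SmoothTorus) (z : ℝ × ℝ) : (tder c μ 2 f).1 z = 0 := by
  rw [tder_val]; simp [secDer]

theorem differentiableAt (f : SmoothTorus) (z : ℝ × ℝ) : DifferentiableAt ℝ f.1 z :=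
  (f.2.1.differentiable (by simp)).differentiableAt

theorem tder_sub (i : Fin 3) (f g : SmoothTorus) :
    (tder c μ i f).1 - (tder c μ i g).1 = (tder c μ i (sub f g)).1 := by
  funext z
  have h : fderiv ℝ (f.1 - g.1) z = fderiv ℝ f.1 z - fderiv ℝ g.1 z :=
    fderiv_sub (f.differentiableAt z) (g.differentiableAt z)
  have e : (sub f g).1 = f.1 - g.1 := rfl
  fin_cases i
  · simp only [Fin.zero_eta, Pi.sub_apply, tder_zero_apply, e, h, sub_apply]; ring
  · simp only [Fin.mk_one, Pi.sub_apply, tder_one_apply, e, h, sub_apply]; ring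
  · simp only [Fin.reduceFinMk, Pi.sub_apply, tder_two_apply, sub_zero]

theorem norm_iteratedFDeriv_tder_le (i : Fin 3) (f : SmoothTorus) (k : ℕ) (z : ℝ × ℝ) :
    ‖iteratedFDeriv ℝ k (tder c μ i f).1 z‖ ≤ ‖iteratedFDeriv ℝ (k + 1) f.1 z‖ := by
  have hv : ∀ v : ℝ × ℝ, ‖v‖ = 1 → ‖iteratedFDeriv ℝ k (fun z => -fderiv ℝ f.1 z v) z‖ ≤
      ‖iteratedFDeriv ℝ (k + 1) f.1 z‖ := fun v hv => by
    have h1 : ContDiff ℝ ∞ (fderiv ℝ f.1) := f.2.1.fderiv_right (by simp)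
    have h2 : (fun z => -fderiv ℝ f.1 z v) = -fun z => fderiv ℝ f.1 z v := rfl
    rw [h2, iteratedFDeriv_neg_apply, norm_neg, ← norm_iteratedFDeriv_fderiv]
    refine (norm_iteratedFDeriv_clm_apply_const h1.contDiffAt (n := k)
      (by exact_mod_cast le_top)).trans ?_
    rw [hv, one_mul]
  fin_cases i
  · exact hv (1, 0) (by simp [Prod.norm_def])
  · have : (tder c μ 1 f).1 = fun z => -fderiv ℝ f.1 z (0, 1) := funext fun z => tder_one_apply c μ f z
    simp only [Fin.mk_one, this]
    exact hv (0, 1) (by simp [Prod.norm_def])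
  · have : (tder c μ 2 f).1 = fun _ => 0 := funext fun z => tder_two_apply c μ f z
    simp only [Fin.reduceFinMk, this]
    rw [iteratedFDeriv_fun_zero]
    simp

theorem continuous_tder (i : Fin 3) : Continuous (tder c μ i) := by
  refine continuous_of_eventually fun k f₀ ε hε => ?_
  filter_upwards [eventually_norm_lt f₀ (k + 1) hε] with f hf z
  rw [tder_sub]
  exact (norm_iteratedFDeriv_tder_le c μ i (sub f f₀) k z).trans_lt (hf z)

theorem continuous_incl_toSmooth :
    Continuous fun f : SmoothTorus => SmoothQHM.incl c μ ν (f.toSmooth c μ ν) := by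
  rw [continuous_iff_continuousAt]
  intro f₀
  rw [ContinuousAt, Metric.tendsto_nhds]
  intro ε hε
  filter_upwards [eventually_norm_lt f₀ 0 (half_pos hε)] with f hf
  rw [dist_eq_norm, ← map_sub, ← toSmooth_sub, incl_toSmooth]
  refine (norm_secL_le _ (half_pos hε).le fun z => ?_).trans_lt (half_lt_self hε)
  have := hf z
  rw [norm_iteratedFDeriv_zero] at this
  exact this.le

theorem continuous_toSmooth : Continuous (toSmooth c μ ν) := by
  refine SmoothQHM.continuous_of_wderI fun w => ?_
  induction w using List.reverseRecOn with
  | nil => exact continuous_incl_toSmooth c μ ν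
  | append_singleton w i ih =>
    have : (fun f => SmoothQHM.wderI (w ++ [i]) (toSmooth c μ ν f)) =
        fun f => SmoothQHM.wderI w ((tder c μ i f).toSmooth c μ ν) := by
      funext f
      rw [SmoothQHM.wderI_apply, SmoothQHM.wder_append, SmoothQHM.wder_cons, SmoothQHM.wder_nil,
        der_toSmooth]
      rfl
    rw [this]
    exact ih.comp (continuous_tder c μ i)

theorem toSmooth_coef (f : SmoothTorus) (z : ℝ × ℝ) :
    QHM.coef (z.1, z.2, 0) (z.1, z.2, 0) (SmoothQHM.incl c μ ν (f.toSmooth c μ ν)) = f.1 z := by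
  rw [incl_toSmooth, coef_secL, if_pos (by simp [qhmShift])]

/-- Values are diagonal matrix coefficients, which are dominated by the operator norm. This gives
the inverse direction of the comparison of topologies its starting point. -/
theorem norm_le (f : SmoothTorus) (z : ℝ × ℝ) :
    ‖f.1 z‖ ≤ ‖SmoothQHM.incl c μ ν (f.toSmooth c μ ν)‖ := by
  rw [← toSmooth_coef c μ ν]
  exact QHM.norm_coef_le _ _ _

theorem fderiv_eq (f : SmoothTorus) : fderiv ℝ f.1 =
    ⇑(-ContinuousLinearMap.smulRightL ℝ (ℝ × ℝ) ℂ (ContinuousLinearMap.fst ℝ ℝ ℝ)) ∘ (tder c μ 0 f).1 +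
    ⇑(-ContinuousLinearMap.smulRightL ℝ (ℝ × ℝ) ℂ (ContinuousLinearMap.snd ℝ ℝ ℝ)) ∘
      (tder c μ 1 f).1 := by
  funext z
  refine ContinuousLinearMap.ext fun v => ?_
  have hv : v = v.1 • ((1 : ℝ), (0 : ℝ)) + v.2 • ((0 : ℝ), (1 : ℝ)) := by ext <;> simp
  conv_lhs => rw [hv]
  rw [map_add, map_smul, map_smul]
  simp only [Pi.add_apply, Function.comp, add_apply, neg_apply, tder_zero_apply, tder_one_apply]
  simp

/-- The differential is a fixed continuous linear expression in `∂₁f` and `∂₂f`, so a derivative of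
order `k + 1` is bounded by derivatives of order `k` of these two functions. -/
theorem exists_seminorm_iteratedFDeriv_le (k : ℕ) :
    ∃ q : Seminorm ℂ (SmoothQHM c μ ν), Continuous q ∧
      ∀ (f : SmoothTorus) z, ‖iteratedFDeriv ℝ k f.1 z‖ ≤ q (f.toSmooth c μ ν) := by
  induction k with
  | zero =>
    refine ⟨SmoothQHM.seminorm [], SmoothQHM.withSeminorms.continuous_seminorm _, fun f z => ?_⟩
    rw [norm_iteratedFDeriv_zero]
    exact f.norm_le c μ ν z
  | succ k ih =>
    obtain ⟨q, hq, h⟩ := ih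
    set L₁ := -ContinuousLinearMap.smulRightL ℝ (ℝ × ℝ) ℂ (ContinuousLinearMap.fst ℝ ℝ ℝ)
    set L₂ := -ContinuousLinearMap.smulRightL ℝ (ℝ × ℝ) ℂ (ContinuousLinearMap.snd ℝ ℝ ℝ)
    refine ⟨‖L₁‖₊ • q.comp (SmoothQHM.der 0) + ‖L₂‖₊ • q.comp (SmoothQHM.der 1), ?_, fun f z => ?_⟩
    · have : Continuous fun d => ‖L₁‖ * q (SmoothQHM.der 0 d) + ‖L₂‖ * q (SmoothQHM.der 1 d) :=
        ((hq.comp (SmoothQHM.continuous_der 0)).const_mul _).add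
          ((hq.comp (SmoothQHM.continuous_der 1)).const_mul _)
      exact this
    · have hs : ∀ i, ContDiff ℝ k (tder c μ i f).1 := fun i =>
        (tder c μ i f).2.1.of_le (by exact_mod_cast le_top)
      rw [← norm_iteratedFDeriv_fderiv, fderiv_eq c μ f, iteratedFDeriv_add_apply
        (L₁.contDiff.comp (hs 0)).contDiffAt (L₂.contDiff.comp (hs 1)).contDiffAt]
      refine (norm_add_le _ _).trans ?_
      change _ ≤ ‖L₁‖ * q (SmoothQHM.der 0 (f.toSmooth c μ ν)) +
        ‖L₂‖ * q (SmoothQHM.der 1 (f.toSmooth c μ ν))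
      rw [der_toSmooth, der_toSmooth]
      refine add_le_add ((L₁.norm_iteratedFDeriv_comp_left (hs 0).contDiffAt le_rfl).trans ?_)
        ((L₂.norm_iteratedFDeriv_comp_left (hs 1).contDiffAt le_rfl).trans ?_)
      · exact mul_le_mul_of_nonneg_left (h _ z) (norm_nonneg _)
      · exact mul_le_mul_of_nonneg_left (h _ z) (norm_nonneg _)

end SmoothTorus

/-! ### Elements of degree zero as functions on the torus -/

section Diagonal

variable {c : ℤ} {μ ν : ℝ}

/-- The diagonal matrix coefficients of an element of the QHM. -/
def QHM.diag (d : QHM c μ ν) (z : ℝ × ℝ) : ℂ := QHM.coef (z.1, z.2, 0) (z.1, z.2, 0) d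

/-- The diagonal is one fixed coefficient evaluated along translates of `d`, so it inherits
smoothness from the orbit map. -/
theorem QHM.diag_eq (d : QHM c μ ν) (z : ℝ × ℝ) :
    d.diag z = QHM.coef (0, 0, 0) (0, 0, 0) (heisAct c μ ν (-z.1, -z.2, 0) d) := by
  rw [coef_heisAct]
  simp [ee_zero, QHM.diag]

theorem QHM.diag_periodic (d : QHM c μ ν) (x y : ℝ) :
    d.diag (x + 1, y) = d.diag (x, y) ∧ d.diag (x, y + 1) = d.diag (x, y) := by
  refine QHM.dense_ofFun.induction (P := fun d : QHM c μ ν => d.diag (x + 1, y) = d.diag (x, y) ∧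
    d.diag (x, y + 1) = d.diag (x, y)) ?_ ?_ d
  · rintro _ ⟨F, hF, rfl⟩
    simp only [QHM.diag, QHM.coef_ofFun]
    have h1 := hF.quasi x y 0
    have h2 := hF.periodic x y 0
    simp only [Int.cast_zero, mul_zero, zero_mul, ee_zero, one_mul] at h1
    simp [qhmShift, h1, h2]
  · exact (isClosed_eq (QHM.coef _ _).continuous (QHM.coef _ _).continuous).inter
      (isClosed_eq (QHM.coef _ _).continuous (QHM.coef _ _).continuous)

theorem QHM.contDiff_diag {d : QHM c μ ν} (hd : d ∈ qhmSmooth c μ ν) : ContDiff ℝ ∞ d.diag := by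
  have h := mem_qhmSmooth_iff.1 hd
  have e : d.diag = fun z : ℝ × ℝ =>
    QHM.coef (0, 0, 0) (0, 0, 0) (heisAct c μ ν (-z.1, -z.2, 0) d) := funext d.diag_eq
  rw [e]
  exact ((QHM.coef (0, 0, 0) (0, 0, 0)).restrictScalars ℝ).contDiff.comp
    (h.comp (f := fun z : ℝ × ℝ => (-z.1, -z.2, (0 : ℝ))) (by fun_prop))

/-- The symbol of an element of the smooth QHM of degree zero. -/
def SmoothQHM.symbol (d : SmoothQHM c μ ν) : SmoothTorus :=
  ⟨(SmoothQHM.incl c μ ν d).diag, QHM.contDiff_diag d.incl_mem, QHM.diag_periodic _⟩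

theorem SmoothTorus.symbol_toSmooth (f : SmoothTorus) : (f.toSmooth c μ ν).symbol = f :=
  Subtype.ext (funext fun z => f.toSmooth_coef c μ ν z)

/-- In degree zero a coefficient vanishes unless `z = w`, and the diagonal ones do not depend on the
level; the symbol therefore determines the element. -/
theorem SmoothQHM.toSmooth_symbol {d : SmoothQHM c μ ν}
    (hd : SmoothQHM.incl c μ ν d ∈ qhmBase c μ ν) : d.symbol.toSmooth c μ ν = d := by
  refine SmoothQHM.incl_injective (QHM.ext_coef fun z w => ?_)
  rw [SmoothTorus.incl_toSmooth, coef_secL]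
  have h0 : ∀ z, qhmShift μ ν 0 z = z := fun z => by simp [qhmShift]
  rw [h0]
  split_ifs with h
  · subst h
    have := QHM.coef_shift_level (μ := μ) (ν := ν) z.1 z.2.1 z.2.2 0 (SmoothQHM.incl c μ ν d)
    rw [h0, h0] at this
    exact this.symm
  · by_cases hp : z.2.2 - w.2.2 = 0
    · exact (QHM.coef_eq_zero (by rwa [hp, h0]) _).symm
    · exact (coef_eq_zero_of_mem_qhmSpec (mem_qhmBase_iff.1 hd) hp).symm

theorem SmoothQHM.continuous_symbol :
    Continuous fun d : {d : SmoothQHM c μ ν // SmoothQHM.incl c μ ν d ∈ qhmBase c μ ν} =>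
      d.1.symbol := by
  refine SmoothTorus.continuous_of_eventually fun k d₀ ε hε => ?_
  obtain ⟨q, hq, h⟩ := SmoothTorus.exists_seminorm_iteratedFDeriv_le c μ ν k
  have hc : Continuous fun d : {d : SmoothQHM c μ ν // SmoothQHM.incl c μ ν d ∈ qhmBase c μ ν} =>
      q (d.1 - d₀.1) := hq.comp (continuous_subtype_val.sub continuous_const)
  have ht := hc.tendsto d₀
  rw [sub_self, map_zero] at ht
  filter_upwards [ht.eventually (gt_mem_nhds hε)] with d hd z
  have := h (SmoothTorus.sub d.1.symbol d₀.1.symbol) z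
  rw [SmoothTorus.toSmooth_sub, toSmooth_symbol d.2, toSmooth_symbol d₀.2] at this
  exact this.trans_lt hd

variable (c μ ν) in
/-- The base of the smooth QHM is the algebra of smooth functions on the torus. -/
def torusHomeo :
    SmoothTorus ≃ₜ {d : SmoothQHM c μ ν // SmoothQHM.incl c μ ν d ∈ qhmBase c μ ν} where
  toFun f := ⟨f.toSmooth c μ ν, mem_qhmBase_iff.2 (secL_mem_qhmSpec _)⟩
  invFun d := d.1.symbol
  left_inv f := f.symbol_toSmooth
  right_inv d := Subtype.ext (SmoothQHM.toSmooth_symbol d.2)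
  continuous_toFun := (SmoothTorus.continuous_toSmooth c μ ν).subtype_mk _
  continuous_invFun := SmoothQHM.continuous_symbol

end Diagonal

/-! ### The smooth Pimsner algebra and the main result -/

theorem isSmoothPimsnerAlgebra.{v} (c : ℤ) (μ ν : ℝ) :
    IsSmoothPimsnerAlgebra.{0, v, 0} (qhmBase c μ ν) (qhmSpec c μ ν 1) (qhmGauge c μ ν)
      (SmoothQHM.incl c μ ν) where
  pimsner := isPimsnerAlgebra
  gauge := isGaugeAction
  lcAlgebra := SmoothQHM.isFrechetAlgebra.toIsLCAlgebra
  injective := SmoothQHM.incl_injective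
  continuous := SmoothQHM.continuous_incl
  closed_base := isClosed_qhmBase.preimage SmoothQHM.continuous_incl
  gaugeSmooth := SmoothQHM.isGaugeSmooth
  generated := isGeneratedByModule
  split := isCanonicallySplit
  tame := isTame

end

universe v

theorem proposition10p5 (c : ℤ) (hc : 0 < c) (μ ν : ℝ) :
    IsFrechetAlgebra (SmoothQHM c μ ν) ∧
    IsSmoothPimsnerAlgebra.{0, v, 0} (qhmBase c μ ν) (qhmSpec c μ ν 1) (qhmGauge c μ ν)
      (SmoothQHM.incl c μ ν) ∧
    (∃ Φ : SmoothTorus ≃ₜ {d : SmoothQHM c μ ν // SmoothQHM.incl c μ ν d ∈ qhmBase c μ ν},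
      ∀ f, SmoothQHM.incl c μ ν (Φ f).1 = f.toQHM c μ ν) ∧
    ∃ ξ : ℤ → Fin 2 → SmoothQHM c μ ν,
      (∀ n i, SmoothQHM.incl c μ ν (ξ n i) ∈ qhmSpec c μ ν n) ∧
      (∀ n, ∑ i, star (ξ n i) * ξ n i = 1) ∧
      (∀ n, ∑ i, ξ n i * star (ξ n i) = 1) ∧
      ∀ n₁ n₂ n₃ : ℕ, ∃ C : ℝ, ∀ n i,
        ‖(heisDer c μ ν 2)^[n₃] ((heisDer c μ ν 1)^[n₂] ((heisDer c μ ν 0)^[n₁]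
          (SmoothQHM.incl c μ ν (ξ n i))))‖ ≤ C * (1 + |(n : ℝ)|) ^ (n₃ + 2 * n₂) := by
  exact ⟨SmoothQHM.isFrechetAlgebra, isSmoothPimsnerAlgebra c μ ν,
    ⟨torusHomeo c μ ν, fun f => f.incl_toSmooth_eq_toQHM c μ ν⟩,
    frame c μ ν, incl_frame_mem, sum_star_frame_mul, sum_frame_mul_star,
    exists_heisDer_frame_bound⟩
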